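/- Let $({\cal V},g)$ be a spacetime: a smooth 4-dimensional manifold with a smooth metric of signature $(-,+,+,+)$, Riemann tensor $R_{\alpha\beta\lambda\mu}$ and Bel tensor $$B_{\alpha\beta\lambda\mu}=R_{\alpha\rho\lambda\sigma}R_{\beta}{}^{\rho}{}_{\mu}{}^{\sigma}+R_{\alpha\rho\mu\sigma}R_{\beta}{}^{\rho}{}_{\lambda}{}^{\sigma}-\tfrac12 g_{\alpha\beta}R_{\rho\tau\lambda\sigma}R^{\rho\tau}{}_{\mu}{}^{\sigma}-\tfrac12 g_{\lambda\mu}R_{\alpha\rho\sigma\tau}R_{\beta}{}^{\rho\sigma\tau}+\tfrac18 g_{\alpha\beta}g_{\lambda\mu}R_{\rho\tau\sigma\nu}R^{\rho\tau\sigma\nu}.$$ For Killing vector fields $\xi_1,\xi_2,\xi_3$ the Bel current is the vector field $j(\xi_1,\xi_2,\xi_3)$ with $j_\mu(\xi_1,\xi_2,\xi_3)=B_{(\alpha\beta\lambda)\mu}\,\xi_1^\alpha\xi_2^\beta\xi_3^\lambda$; write $j(\xi_1,\xi_2)=j(\xi_1,\xi_2,\xi_2)$ and $j(\xi)=j(\xi,\xi,\xi)$.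 The same letter denotes a vector field and the metrically equivalent 1-form. No field equations are assumed, and the Bel tensor need not be divergence-free. (1) If $\xi$ is a hypersurface-orthogonal Killing vector field, that is, $\xi\wedge d\xi=0$, then at every point $j(\xi)$ is a multiple of $\xi$, and $\nabla_\mu j^\mu(\xi)=0$. (2) Let $\xi$ and $\eta$ be Killing vector fields with $[\xi,\eta]=0$ and $\xi\wedge\eta\wedge d\xi=\xi\wedge\eta\wedge d\eta=0$. Then, at every point at which they span a non-null 2-plane, that is, $(\xi\cdot\xi)(\eta\cdot\eta)-(\xi\cdot\eta)^2\neq0$, each of the four Bel currents $j(\xi)$, $j(\eta)$, $j(\xi,\eta)$, $j(\eta,\xi)$ lies in $\mathrm{span}\{\xi,\eta\}$ and has vanishing divergence. In particular, if $\xi$ and $\eta$ span non-null 2-planes everywhere (they act orthogonally transitively on non-null surfaces), the four currents are tangent to these planes and divergence-free on all of ${\cal V}$. -/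

import Mathlib

open scoped Manifold ContDiff

noncomputable section

/-! ### Tensor calculus in one coordinate domain

Components with respect to coordinates are functions on the coordinate space
`EuclideanSpace ℝ (Fin 4)`; every index runs over `Fin 4`. -/

namespace Coord

/-- The coordinate space of a four-dimensional manifold. -/
abbrev Space : Type := EuclideanSpace ℝ (Fin 4)

/-- The partial derivative `∂_i f`. -/
def partialDeriv (i : Fin 4) (f : Space → ℝ) (x : Space) : ℝ :=
  fderiv ℝ f x (EuclideanSpace.single i 1)

section

variable (G : Space → Matrix (Fin 4) (Fin 4) ℝ)

/-- The components `g^{ij}` of the inverse metric. -/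
def inv (x : Space) (i j : Fin 4) : ℝ := (G x)⁻¹ i j

/-- The Christoffel symbols
`Γ^k_{ij} = ½ g^{kl} (∂_i g_{jl} + ∂_j g_{il} - ∂_l g_{ij})`. -/
def christoffel (k i j : Fin 4) (x : Space) : ℝ :=
  (1 / 2) * ∑ l, inv G x k l *
    (partialDeriv i (fun y => G y j l) x + partialDeriv j (fun y => G y i l) x
      - partialDeriv l (fun y => G y i j) x)

/-- The curvature tensor
`R^a_{bcd} = ∂_c Γ^a_{db} - ∂_d Γ^a_{cb} + Γ^a_{ce} Γ^e_{db} - Γ^a_{de} Γ^e_{cb}`. -/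
def riemannUp (a b c d : Fin 4) (x : Space) : ℝ :=
  partialDeriv c (christoffel G a d b) x - partialDeriv d (christoffel G a c b) x
    + ∑ e, (christoffel G a c e x * christoffel G e d b x
      - christoffel G a d e x * christoffel G e c b x)

/-- The Riemann tensor `R_{abcd} = g_{ae} R^e_{bcd}`. -/
def riemann (a b c d : Fin 4) (x : Space) : ℝ :=
  ∑ e, G x a e * riemannUp G e b c d x

/-- The contraction `R_{aρcσ} R_b^ρ_d^σ`. -/
def riemannSq (a b c d : Fin 4) (x : Space) : ℝ :=
  ∑ r, ∑ s, ∑ r', ∑ s', inv G x r r' * inv G x s s' *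
    riemann G a r c s x * riemann G b r' d s' x

/-- The contraction `R_{ρτcσ} R^{ρτ}_d^σ`. -/
def riemannSqLeft (c d : Fin 4) (x : Space) : ℝ :=
  ∑ r, ∑ t, ∑ s, ∑ r', ∑ t', ∑ s', inv G x r r' * inv G x t t' * inv G x s s' *
    riemann G r t c s x * riemann G r' t' d s' x

/-- The contraction `R_{aρστ} R_b^{ρστ}`. -/
def riemannSqRight (a b : Fin 4) (x : Space) : ℝ :=
  ∑ r, ∑ s, ∑ t, ∑ r', ∑ s', ∑ t', inv G x r r' * inv G x s s' * inv G x t t' *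
    riemann G a r s t x * riemann G b r' s' t' x

/-- The contraction `R_{ρτσν} R^{ρτσν}`. -/
def riemannSqTrace (x : Space) : ℝ :=
  ∑ r, ∑ t, ∑ s, ∑ n, ∑ r', ∑ t', ∑ s', ∑ n',
    inv G x r r' * inv G x t t' * inv G x s s' * inv G x n n' *
      riemann G r t s n x * riemann G r' t' s' n' x

/-- The Bel tensor
`B_{abcd} = R_{aρcσ} R_b^ρ_d^σ + R_{aρdσ} R_b^ρ_c^σ - ½ g_{ab} R_{ρτcσ} R^{ρτ}_d^σ
  - ½ g_{cd} R_{aρστ} R_b^{ρστ} + ⅛ g_{ab} g_{cd} R_{ρτσν} R^{ρτσν}`. -/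
def bel (a b c d : Fin 4) (x : Space) : ℝ :=
  riemannSq G a b c d x + riemannSq G a b d c x
    - (1 / 2) * G x a b * riemannSqLeft G c d x
    - (1 / 2) * G x c d * riemannSqRight G a b x
    + (1 / 8) * G x a b * G x c d * riemannSqTrace G x

/-- The symmetrization `B_{(abc)d}` over the first three indices. -/
def belSymm (a b c d : Fin 4) (x : Space) : ℝ :=
  (1 / 6) * (bel G a b c d x + bel G a c b d x + bel G b a c d x
    + bel G b c a d x + bel G c a b d x + bel G c b a d x)

/-- The components `X_i = g_{ij} X^j` of the 1-form metrically equivalent to `X`. -/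
def lower (X : Space → Fin 4 → ℝ) (i : Fin 4) (x : Space) : ℝ := ∑ j, G x i j * X x j

/-- The covariant derivative `∇_i X_j = ∂_i X_j - Γ^k_{ij} X_k`. -/
def covDerivLower (X : Space → Fin 4 → ℝ) (i j : Fin 4) (x : Space) : ℝ :=
  partialDeriv i (lower G X j) x - ∑ k, christoffel G k i j x * lower G X k x

/-- The divergence `∇_i X^i = ∂_i X^i + Γ^i_{ik} X^k`. -/
def divergence (X : Space → Fin 4 → ℝ) (x : Space) : ℝ :=
  ∑ i, (partialDeriv i (fun y => X y i) x + ∑ k, christoffel G i i k x * X x k)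

/-- The components `∂_i X_j - ∂_j X_i` of the exterior differential of the 1-form metrically
equivalent to `X`. -/
def dLower (X : Space → Fin 4 → ℝ) (i j : Fin 4) (x : Space) : ℝ :=
  partialDeriv i (lower G X j) x - partialDeriv j (lower G X i) x

/-- The components of the exterior product `X ∧ dX` of 1-form and 2-form, up to a nonzero
numerical factor: the antisymmetrization of `X_i (dX)_{jk}`. -/
def wedgeD (X : Space → Fin 4 → ℝ) (i : Fin 3 → Fin 4) (x : Space) : ℝ :=
  ∑ p : Equiv.Perm (Fin 3), ((Equiv.Perm.sign p : ℤ) : ℝ) *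
    (lower G X (i (p 0)) x * dLower G X (i (p 1)) (i (p 2)) x)

/-- The components of the exterior product `X ∧ Y ∧ dZ`, up to a nonzero numerical factor:
the antisymmetrization of `X_i Y_j (dZ)_{kl}`. -/
def wedgeWedgeD (X Y Z : Space → Fin 4 → ℝ) (i : Fin 4 → Fin 4) (x : Space) : ℝ :=
  ∑ p : Equiv.Perm (Fin 4), ((Equiv.Perm.sign p : ℤ) : ℝ) *
    (lower G X (i (p 0)) x * lower G Y (i (p 1)) x * dLower G Z (i (p 2)) (i (p 3)) x)

/-- The components `j_m = B_{(abc)m} X^a Y^b Z^c` of the Bel current of `X, Y, Z`. -/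
def belCurrentLower (X Y Z : Space → Fin 4 → ℝ) (m : Fin 4) (x : Space) : ℝ :=
  ∑ a, ∑ b, ∑ c, belSymm G a b c m x * X x a * Y x b * Z x c

/-- The contravariant components `j^m = g^{mn} j_n` of the Bel current of `X, Y, Z`. -/
def belCurrent (X Y Z : Space → Fin 4 → ℝ) (x : Space) (m : Fin 4) : ℝ :=
  ∑ n, inv G x m n * belCurrentLower G X Y Z n x

end

end Coord

/-! ### Spacetimes -/

section

variable (M : Type*) [TopologicalSpace M] [ChartedSpace Coord.Space M] [IsManifold (𝓡 4) ∞ M]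

/-- A smooth metric of signature `(-,+,+,+)` on a four-dimensional manifold. -/
structure LorentzMetric where
  /-- The scalar product on each tangent space. -/
  val (p : M) : TangentSpace (𝓡 4) p →L[ℝ] TangentSpace (𝓡 4) p →L[ℝ] ℝ
  symm (p : M) (v w : TangentSpace (𝓡 4) p) : val p v w = val p w v
  signature (p : M) : ∃ b : Module.Basis (Fin 4) ℝ (TangentSpace (𝓡 4) p),
    ∀ i j, val p (b i) (b j) = if i = j then (if i = 0 then -1 else 1) else 0
  contMDiff : ContMDiff (𝓡 4) ((𝓡 4).prod 𝓘(ℝ, Coord.Space →L[ℝ] Coord.Space →L[ℝ] ℝ)) ∞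
    (fun p => Bundle.TotalSpace.mk' (Coord.Space →L[ℝ] Coord.Space →L[ℝ] ℝ)
      (E := fun p : M => TangentSpace (𝓡 4) p →L[ℝ] TangentSpace (𝓡 4) p →L[ℝ] ℝ) p (val p))

/-- The smooth coordinate charts of the manifold. -/
abbrev SmoothChart : Type _ :=
  {φ : OpenPartialHomeomorph M Coord.Space // φ ∈ IsManifold.maximalAtlas (𝓡 4) ∞ M}

end

section

variable {M : Type*} [TopologicalSpace M] [ChartedSpace Coord.Space M] [IsManifold (𝓡 4) ∞ M]

/-- The coordinate vector `∂_i` of the chart `φ`, at the point with coordinates `x`. -/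
def coordVector (φ : SmoothChart M) (x : Coord.Space) (i : Fin 4) :
    TangentSpace (𝓡 4) (φ.1.symm x) :=
  mfderiv (𝓡 4) (𝓡 4) φ.1.symm x (EuclideanSpace.single i (1 : ℝ) : Coord.Space)

/-- The components `g_{ij} = g(∂_i, ∂_j)` of the metric in the chart `φ`. -/
def metricIn (g : LorentzMetric M) (φ : SmoothChart M) (x : Coord.Space) :
    Matrix (Fin 4) (Fin 4) ℝ :=
  Matrix.of fun i j => g.val (φ.1.symm x) (coordVector φ x i) (coordVector φ x j)

/-- The components `ξ^i = dx^i(ξ)` of a vector field in the chart `φ`. -/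
def fieldIn (ξ : Π p : M, TangentSpace (𝓡 4) p) (φ : SmoothChart M) (x : Coord.Space)
    (i : Fin 4) : ℝ :=
  (show Coord.Space from mfderiv (𝓡 4) (𝓡 4) φ.1 (φ.1.symm x) (ξ (φ.1.symm x))) i

/-- `ξ` is a Killing vector field: it is smooth, and `∇_i ξ_j + ∇_j ξ_i = 0` in all charts. -/
structure IsKilling (g : LorentzMetric M) (ξ : Π p : M, TangentSpace (𝓡 4) p) : Prop where
  contMDiff : ContMDiff (𝓡 4) (𝓡 4).tangent ∞ (fun p => (⟨p, ξ p⟩ : TangentBundle (𝓡 4) M))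
  killing : ∀ (φ : SmoothChart M), ∀ x ∈ φ.1.target, ∀ i j,
    Coord.covDerivLower (metricIn g φ) (fieldIn ξ φ) i j x
      + Coord.covDerivLower (metricIn g φ) (fieldIn ξ φ) j i x = 0

/-- `ξ` is hypersurface-orthogonal: `ξ ∧ dξ = 0`, where `ξ` also denotes the equivalent 1-form. -/
def IsHypersurfaceOrthogonal (g : LorentzMetric M) (ξ : Π p : M, TangentSpace (𝓡 4) p) : Prop :=
  ∀ (φ : SmoothChart M), ∀ x ∈ φ.1.target, ∀ i,
    Coord.wedgeD (metricIn g φ) (fieldIn ξ φ) i x = 0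

/-- The planes orthogonal to `ξ` and `η` are integrable: `ξ ∧ η ∧ dξ = ξ ∧ η ∧ dη = 0`. -/
def IsOrthogonallyTransitive (g : LorentzMetric M) (ξ η : Π p : M, TangentSpace (𝓡 4) p) : Prop :=
  ∀ (φ : SmoothChart M), ∀ x ∈ φ.1.target, ∀ i,
    Coord.wedgeWedgeD (metricIn g φ) (fieldIn ξ φ) (fieldIn η φ) (fieldIn ξ φ) i x = 0 ∧
    Coord.wedgeWedgeD (metricIn g φ) (fieldIn ξ φ) (fieldIn η φ) (fieldIn η φ) i x = 0

/-- At `p`, the vectors `ξ` and `η` are independent and the plane that they span is not null: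
`(ξ·ξ)(η·η) - (ξ·η)² ≠ 0`. -/
def SpanNonNullPlaneAt (g : LorentzMetric M) (ξ η : Π p : M, TangentSpace (𝓡 4) p) (p : M) : Prop :=
  g.val p (ξ p) (ξ p) * g.val p (η p) (η p) - g.val p (ξ p) (η p) ^ 2 ≠ 0

/-- The Bel current `j(ξ₁, ξ₂, ξ₃)`, at the point whose coordinates in the chart `φ` are `x`, as
the tangent vector `j^m ∂_m`. -/
def belCurrentAt (g : LorentzMetric M) (ξ₁ ξ₂ ξ₃ : Π p : M, TangentSpace (𝓡 4) p)
    (φ : SmoothChart M) (x : Coord.Space) : TangentSpace (𝓡 4) (φ.1.symm x) :=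
  ∑ m, Coord.belCurrent (metricIn g φ) (fieldIn ξ₁ φ) (fieldIn ξ₂ φ) (fieldIn ξ₃ φ) x m •
    coordVector φ x m

/-- The divergence `∇_m j^m` of the Bel current `j(ξ₁, ξ₂, ξ₃)`, at the point whose coordinates in
the chart `φ` are `x`. -/
def divBelCurrentAt (g : LorentzMetric M) (ξ₁ ξ₂ ξ₃ : Π p : M, TangentSpace (𝓡 4) p)
    (φ : SmoothChart M) (x : Coord.Space) : ℝ :=
  Coord.divergence (metricIn g φ)
    (Coord.belCurrent (metricIn g φ) (fieldIn ξ₁ φ) (fieldIn ξ₂ φ) (fieldIn ξ₃ φ)) x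

end

end

/-!
The Bel current is built naturally from the metric, the curvature and three vectors, and it is odd
in the vectors. Both halves of the theorem are consequences of this, once the Killing equations have
been turned into algebraic conditions on the curvature at a point.

*Position of the current.* A Killing field satisfies `∇_c ∇_a ξ_b = R_{mcab} ξ^m`
(`MetricRing.Killing.cov2_eq`). Differentiating `ξ ∧ ∇ξ = 0` therefore gives
`ξ ∧ R(·, ·, m, ξ) = 0`, as the terms quadratic in `∇ξ` cancel by a Pfaffian identity. This makes
`B(ξ, ξ, ξ, ·)` vanish on the vectors orthogonal to `ξ`, also where `ξ` is null
(`BelAlgebra.CurvatureAt.belSymm_eq_zero`), so that `j(ξ)` is a multiple of `ξ`. For two commuting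
fields, the derivatives of `ξ ∧ η ∧ ∇ξ = 0`, of `ξ ∧ η ∧ ∇η = 0` and of `∇_ξ η = ∇_η ξ` show that
the components of the curvature with an odd number of indices in the plane of `ξ` and `η` vanish
(`BelAlgebra.CurvatureAt.odd_components_eq_zero`). Then the reflection that reverses a non-null
plane preserves the metric and the curvature, hence maps the current of three vectors of the plane
to its negative; a vector with this property lies in the plane
(`BelAlgebra.CurvatureAt.current_mem_plane`).

*Divergence.* The flow of a Killing field `ξ` preserves the metric, the curvature and every vector
field that commutes with `ξ`, so by naturality `L_ξ j = 0`. To use naturality literally, the Lie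
derivative is encoded as the ring homomorphism `f ↦ f + ε L_ξ f` into the dual numbers, where the
infinitesimal flow is a change of basis (`MetricRing.Killing.along_belCurrent`). Taking the
divergence of `ξ^i j = j^i ξ`, and of the analogous identity with the `2 × 2` minors of `ξ` and `η`,
and using that Killing fields are divergence-free, one gets `ξ^i div j = 0`, respectively the same
with a minor in place of `ξ^i`. In this form no quotient of vector fields has to be differentiated.
At the zeros of `ξ` the divergence of `j(ξ)` vanishes because the current is cubic in `ξ`.

The tensor calculus is done over an abstract commutative ring with four commuting derivations and an
invertible metric, `MetricRing`; it is applied to the ring of smooth functions on an open subset of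
the domain of a chart: the whole domain for one field, the set where the plane of the fields is not
null for two.
-/

open scoped Manifold ContDiff

/-! ### Multilinear forms on coordinate vectors and the Bel current -/

noncomputable section

namespace BelAlgebra

section Forms

variable {k : Type*} [CommRing k]

/-- The `i`-th vector of the standard basis. -/
abbrev e (i : Fin 4) : Fin 4 → k := Pi.single i 1

/-- Bilinear forms on `k⁴`. -/
abbrev Form2 (k : Type*) [CommRing k] : Type _ :=
  (Fin 4 → k) →ₗ[k] (Fin 4 → k) →ₗ[k] k

/-- Covariant tensors of rank four on `k⁴`. -/
abbrev Form4 (k : Type*) [CommRing k] : Type _ :=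
  (Fin 4 → k) →ₗ[k] (Fin 4 → k) →ₗ[k] (Fin 4 → k) →ₗ[k] (Fin 4 → k) →ₗ[k] k

/-- The linear form with components `φ`. -/
def form1 (φ : Fin 4 → k) : (Fin 4 → k) →ₗ[k] k := Fintype.linearCombination k φ

/-- The bilinear form with components `B`. -/
def form2 (B : Fin 4 → Fin 4 → k) : Form2 k :=
  Fintype.linearCombination k fun i => form1 (B i)

/-- The covariant tensor of rank four with components `T`. -/
def form4 (T : Fin 4 → Fin 4 → Fin 4 → Fin 4 → k) : Form4 k :=
  Fintype.linearCombination k fun a => Fintype.linearCombination k fun b => form2 (T a b)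

theorem form1_apply (φ v : Fin 4 → k) : form1 φ v = ∑ i, v i * φ i := by
  simp [form1, Fintype.linearCombination_apply]

@[simp] theorem form1_e (φ : Fin 4 → k) (i : Fin 4) : form1 φ (e i) = φ i := by
  simp [form1, Fintype.linearCombination_apply_single]

@[simp] theorem form2_e (B : Fin 4 → Fin 4 → k) (i j : Fin 4) : form2 B (e i) (e j) = B i j := by
  simp [form2, Fintype.linearCombination_apply_single]

theorem form2_apply (B : Fin 4 → Fin 4 → k) (u v : Fin 4 → k) :
    form2 B u v = ∑ i, ∑ j, u i * v j * B i j := by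
  simp [form2, Fintype.linearCombination_apply, form1_apply, Finset.mul_sum, mul_assoc]

@[simp] theorem form4_e (T : Fin 4 → Fin 4 → Fin 4 → Fin 4 → k) (a b c d : Fin 4) :
    form4 T (e a) (e b) (e c) (e d) = T a b c d := by
  simp [form4, Fintype.linearCombination_apply_single]

theorem sum_smul_e (v : Fin 4 → k) : ∑ i, v i • (e i : Fin 4 → k) = v := by
  ext j
  simp [Pi.single_apply]

/-- A linear function is determined by its values on the standard basis. -/
theorem linear_expand {M : Type*} [AddCommGroup M] [Module k M] {f : (Fin 4 → k) → M}
    (hf : IsLinearMap k f) (v : Fin 4 → k) : f v = ∑ i, v i • f (e i) := by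
  conv_lhs => rw [← sum_smul_e v]
  refine (map_sum (hf.mk' f) (fun i => v i • (e i : Fin 4 → k)) Finset.univ).trans ?_
  exact Finset.sum_congr rfl fun i _ => hf.map_smul _ _

/-- Bilinearity of a scalar function of two vectors. -/
structure Bilin (f : (Fin 4 → k) → (Fin 4 → k) → k) : Prop where
  left : ∀ v, IsLinearMap k fun u => f u v
  right : ∀ u, IsLinearMap k fun v => f u v

/-- The contraction `H^{ij} f_{ij}` of a function of two vectors. -/
def contr (H : Fin 4 → Fin 4 → k) (f : (Fin 4 → k) → (Fin 4 → k) → k) : k :=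
  ∑ i, ∑ j, H i j * f (e i) (e j)

theorem contr_add (H : Fin 4 → Fin 4 → k) (f f' : (Fin 4 → k) → (Fin 4 → k) → k) :
    contr H (fun u v => f u v + f' u v) = contr H f + contr H f' := by
  simp [contr, mul_add, Finset.sum_add_distrib]

theorem contr_smul (H : Fin 4 → Fin 4 → k) (x : k) (f : (Fin 4 → k) → (Fin 4 → k) → k) :
    contr H (fun u v => x • f u v) = x • contr H f := by
  simp [contr, Finset.mul_sum, mul_left_comm]

theorem Bilin.expand {f : (Fin 4 → k) → (Fin 4 → k) → k} (hf : Bilin f) (u v : Fin 4 → k) :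
    f u v = ∑ i, ∑ j, u i * v j * f (e i) (e j) := by
  rw [linear_expand (hf.left v)]
  refine Finset.sum_congr rfl fun i _ => ?_
  rw [linear_expand (hf.right (e i)) v]
  simp [Finset.mul_sum, mul_assoc]

theorem sum_comm_pair (F : Fin 4 → Fin 4 → Fin 4 → Fin 4 → k) :
    ∑ r, ∑ s, ∑ i, ∑ j, F r s i j = ∑ i, ∑ j, ∑ r, ∑ s, F r s i j := by
  have h : ∑ x : Fin 4 × Fin 4, ∑ y : Fin 4 × Fin 4, F x.1 x.2 y.1 y.2
    = ∑ y : Fin 4 × Fin 4, ∑ x : Fin 4 × Fin 4, F x.1 x.2 y.1 y.2 := Finset.sum_comm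
  simpa only [Fintype.sum_prod_type] using h

/-- Contractions do not depend on the basis: `H` is the image of `H'` under `q`. -/
theorem contr_comp {H H' : Fin 4 → Fin 4 → k} {q : (Fin 4 → k) →ₗ[k] (Fin 4 → k)}
    (hH : ∀ i j, H i j = ∑ r, ∑ s, H' r s * q (e r) i * q (e s) j)
    {f : (Fin 4 → k) → (Fin 4 → k) → k} (hf : Bilin f) :
    contr H' (fun u v => f (q u) (q v)) = contr H f := by
  simp only [contr, hH, Finset.sum_mul]
  have h1 : ∀ r s : Fin 4, H' r s * f (q (e r)) (q (e s))
      = ∑ i, ∑ j, H' r s * q (e r) i * q (e s) j * f (e i) (e j) := fun r s => by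
    rw [hf.expand, Finset.mul_sum]
    refine Finset.sum_congr rfl fun i _ => ?_
    rw [Finset.mul_sum]
    exact Finset.sum_congr rfl fun j _ => by ring
  simp only [h1]
  exact sum_comm_pair fun r s i j => H' r s * q (e r) i * q (e s) j * f (e i) (e j)

end Forms

section Bel

variable {k : Type*} [CommRing k] (H : Fin 4 → Fin 4 → k) (g : Form2 k) (T : Form4 k)

/-- The contraction `T_{aρcσ} T_b^ρ_d^σ`. -/
def sq (a b c d : Fin 4 → k) : k :=
  contr H fun r r' => contr H fun s s' => T a r c s * T b r' d s'

/-- The contraction `T_{ρτcσ} T^{ρτ}_d^σ`. -/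
def sqLeft (c d : Fin 4 → k) : k :=
  contr H fun r r' => contr H fun t t' => contr H fun s s' => T r t c s * T r' t' d s'

/-- The contraction `T_{aρστ} T_b^{ρστ}`. -/
def sqRight (a b : Fin 4 → k) : k :=
  contr H fun r r' => contr H fun s s' => contr H fun t t' => T a r s t * T b r' s' t'

/-- The contraction `T_{ρτσν} T^{ρτσν}`. -/
def sqTrace : k :=
  contr H fun r r' => contr H fun t t' => contr H fun s s' => contr H fun n n' =>
    T r t s n * T r' t' s' n'

theorem sq_linear₁ (b c d : Fin 4 → k) : IsLinearMap k fun a => sq H T a b c d := by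
  constructor <;> intros <;>
    simp only [sq, map_add, map_smul, LinearMap.add_apply, LinearMap.smul_apply, add_mul,
      smul_mul_assoc, contr_add, contr_smul]

theorem sq_linear₂ (a c d : Fin 4 → k) : IsLinearMap k fun b => sq H T a b c d := by
  constructor <;> intros <;>
    simp only [sq, map_add, map_smul, LinearMap.add_apply, LinearMap.smul_apply, mul_add,
      mul_smul_comm, contr_add, contr_smul]

theorem sq_linear₃ (a b d : Fin 4 → k) : IsLinearMap k fun c => sq H T a b c d := by
  constructor <;> intros <;>
    simp only [sq, map_add, map_smul, LinearMap.add_apply, LinearMap.smul_apply, add_mul,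
      smul_mul_assoc, contr_add, contr_smul]

theorem sq_linear₄ (a b c : Fin 4 → k) : IsLinearMap k fun d => sq H T a b c d := by
  constructor <;> intros <;>
    simp only [sq, map_add, map_smul, LinearMap.add_apply, LinearMap.smul_apply, mul_add,
      mul_smul_comm, contr_add, contr_smul]

theorem sqLeft_bilin : Bilin (sqLeft H T) := by
  constructor <;> intro <;> constructor <;> intros <;>
    simp only [sqLeft, map_add, map_smul, LinearMap.add_apply, LinearMap.smul_apply, mul_add,
      mul_smul_comm, add_mul, smul_mul_assoc, contr_add, contr_smul]

theorem sqRight_bilin : Bilin (sqRight H T) := by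
  constructor <;> intro <;> constructor <;> intros <;>
    simp only [sqRight, map_add, map_smul, LinearMap.add_apply, LinearMap.smul_apply, mul_add,
      mul_smul_comm, add_mul, smul_mul_assoc, contr_add, contr_smul]

variable [Algebra ℝ k]

/-- The Bel tensor of a tensor `T` of rank four, as a function of four vectors. -/
def bel (a b c d : Fin 4 → k) : k :=
  sq H T a b c d + sq H T a b d c
    - algebraMap ℝ k (1 / 2) * g a b * sqLeft H T c d
    - algebraMap ℝ k (1 / 2) * g c d * sqRight H T a b
    + algebraMap ℝ k (1 / 8) * g a b * g c d * sqTrace H T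

/-- The symmetrization of the Bel tensor over the first three arguments. -/
def belSymm (a b c d : Fin 4 → k) : k :=
  algebraMap ℝ k (1 / 6) * (bel H g T a b c d + bel H g T a c b d + bel H g T b a c d
    + bel H g T b c a d + bel H g T c a b d + bel H g T c b a d)

/-- The contravariant components of the Bel current of three vectors. -/
def current (X Y Z : Fin 4 → k) (m : Fin 4) : k :=
  ∑ n, H m n * belSymm H g T X Y Z (e n)

theorem bel_linear₁ (b c d : Fin 4 → k) : IsLinearMap k fun a => bel H g T a b c d := by
  constructor <;> intros <;>
    simp only [bel, (sq_linear₁ H T _ _ _).map_add, (sq_linear₁ H T _ _ _).map_smul,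
      ((sqRight_bilin H T).left _).map_add, ((sqRight_bilin H T).left _).map_smul,
      map_add, map_smul, LinearMap.add_apply, LinearMap.smul_apply, smul_eq_mul] <;> ring

theorem bel_linear₂ (a c d : Fin 4 → k) : IsLinearMap k fun b => bel H g T a b c d := by
  constructor <;> intros <;>
    simp only [bel, (sq_linear₂ H T _ _ _).map_add, (sq_linear₂ H T _ _ _).map_smul,
      ((sqRight_bilin H T).right _).map_add, ((sqRight_bilin H T).right _).map_smul,
      map_add, map_smul, smul_eq_mul] <;> ring

theorem bel_linear₃ (a b d : Fin 4 → k) : IsLinearMap k fun c => bel H g T a b c d := by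
  constructor <;> intros <;>
    simp only [bel, (sq_linear₃ H T _ _ _).map_add, (sq_linear₃ H T _ _ _).map_smul,
      (sq_linear₄ H T _ _ _).map_add, (sq_linear₄ H T _ _ _).map_smul,
      ((sqLeft_bilin H T).left _).map_add, ((sqLeft_bilin H T).left _).map_smul,
      map_add, map_smul, LinearMap.add_apply, LinearMap.smul_apply, smul_eq_mul] <;> ring

theorem bel_linear₄ (a b c : Fin 4 → k) : IsLinearMap k fun d => bel H g T a b c d := by
  constructor <;> intros <;>
    simp only [bel, (sq_linear₃ H T _ _ _).map_add, (sq_linear₃ H T _ _ _).map_smul,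
      (sq_linear₄ H T _ _ _).map_add, (sq_linear₄ H T _ _ _).map_smul,
      ((sqLeft_bilin H T).right _).map_add, ((sqLeft_bilin H T).right _).map_smul,
      map_add, map_smul, smul_eq_mul] <;> ring

theorem belSymm_linear₁ (b c d : Fin 4 → k) : IsLinearMap k fun a => belSymm H g T a b c d := by
  constructor <;> intros <;>
    simp only [belSymm, (bel_linear₁ H g T _ _ _).map_add, (bel_linear₁ H g T _ _ _).map_smul,
      (bel_linear₂ H g T _ _ _).map_add, (bel_linear₂ H g T _ _ _).map_smul,
      (bel_linear₃ H g T _ _ _).map_add, (bel_linear₃ H g T _ _ _).map_smul, smul_eq_mul] <;> ring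

theorem belSymm_linear₂ (a c d : Fin 4 → k) : IsLinearMap k fun b => belSymm H g T a b c d := by
  constructor <;> intros <;>
    simp only [belSymm, (bel_linear₁ H g T _ _ _).map_add, (bel_linear₁ H g T _ _ _).map_smul,
      (bel_linear₂ H g T _ _ _).map_add, (bel_linear₂ H g T _ _ _).map_smul,
      (bel_linear₃ H g T _ _ _).map_add, (bel_linear₃ H g T _ _ _).map_smul, smul_eq_mul] <;> ring

theorem belSymm_linear₃ (a b d : Fin 4 → k) : IsLinearMap k fun c => belSymm H g T a b c d := by
  constructor <;> intros <;>
    simp only [belSymm, (bel_linear₁ H g T _ _ _).map_add, (bel_linear₁ H g T _ _ _).map_smul,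
      (bel_linear₂ H g T _ _ _).map_add, (bel_linear₂ H g T _ _ _).map_smul,
      (bel_linear₃ H g T _ _ _).map_add, (bel_linear₃ H g T _ _ _).map_smul, smul_eq_mul] <;> ring

theorem belSymm_linear₄ (a b c : Fin 4 → k) : IsLinearMap k fun d => belSymm H g T a b c d := by
  constructor <;> intros <;>
    simp only [belSymm, (bel_linear₄ H g T _ _ _).map_add, (bel_linear₄ H g T _ _ _).map_smul,
      smul_eq_mul] <;> ring

/-- The contraction `B_{(abc)d} X^a Y^b Z^c` in components. -/
theorem belSymm_expand (X Y Z d : Fin 4 → k) : belSymm H g T X Y Z d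
    = ∑ a, ∑ b, ∑ c, belSymm H g T (e a) (e b) (e c) d * X a * Y b * Z c := by
  rw [linear_expand (belSymm_linear₁ H g T Y Z d) X]
  refine Finset.sum_congr rfl fun a _ => ?_
  rw [linear_expand (belSymm_linear₂ H g T (e a) Z d) Y, Finset.smul_sum]
  refine Finset.sum_congr rfl fun b _ => ?_
  rw [linear_expand (belSymm_linear₃ H g T (e a) (e b) d) Z, Finset.smul_sum, Finset.smul_sum]
  refine Finset.sum_congr rfl fun c _ => ?_
  simp only [smul_eq_mul]
  ring

end Bel

section Equivariance

variable {k : Type*} [CommRing k] {H H' : Fin 4 → Fin 4 → k} {g g' : Form2 k} {T T' : Form4 k}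
  {q : (Fin 4 → k) →ₗ[k] (Fin 4 → k)}

theorem sq_comp (hH : ∀ i j, H i j = ∑ r, ∑ s, H' r s * q (e r) i * q (e s) j)
    (hT : ∀ a b c d, T' a b c d = T (q a) (q b) (q c) (q d)) (a b c d : Fin 4 → k) :
    sq H' T' a b c d = sq H T (q a) (q b) (q c) (q d) := by
  simp only [sq, hT]
  have h1 : ∀ r r', contr H' (fun s s' => T (q a) r (q c) (q s) * T (q b) r' (q d) (q s'))
      = contr H (fun s s' => T (q a) r (q c) s * T (q b) r' (q d) s') := fun r r' =>
    contr_comp hH (f := fun s s' => T (q a) r (q c) s * T (q b) r' (q d) s') <| by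
      constructor <;> intro <;> constructor <;> intros <;>
        simp only [map_add, map_smul, mul_add, mul_smul_comm, add_mul, smul_mul_assoc]
  simp only [h1]
  refine contr_comp hH (f := fun r r' => contr H (fun s s' => T (q a) r (q c) s *
    T (q b) r' (q d) s')) ?_
  constructor <;> intro <;> constructor <;> intros <;>
    simp only [map_add, map_smul, LinearMap.add_apply, LinearMap.smul_apply, mul_add,
      mul_smul_comm, add_mul, smul_mul_assoc, contr_add, contr_smul]

theorem sqLeft_comp (hH : ∀ i j, H i j = ∑ r, ∑ s, H' r s * q (e r) i * q (e s) j)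
    (hT : ∀ a b c d, T' a b c d = T (q a) (q b) (q c) (q d)) (c d : Fin 4 → k) :
    sqLeft H' T' c d = sqLeft H T (q c) (q d) := by
  simp only [sqLeft, hT]
  have h1 : ∀ r r' t t', contr H' (fun s s' => T r t (q c) (q s) * T r' t' (q d) (q s'))
      = contr H (fun s s' => T r t (q c) s * T r' t' (q d) s') := fun r r' t t' =>
    contr_comp hH (f := fun s s' => T r t (q c) s * T r' t' (q d) s') <| by
      constructor <;> intro <;> constructor <;> intros <;>
        simp only [map_add, map_smul, mul_add, mul_smul_comm, add_mul, smul_mul_assoc]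
  simp only [h1]
  have h2 : ∀ r r', contr H' (fun t t' => contr H (fun s s' => T r (q t) (q c) s *
        T r' (q t') (q d) s'))
      = contr H (fun t t' => contr H (fun s s' => T r t (q c) s * T r' t' (q d) s')) :=
    fun r r' => contr_comp hH (f := fun t t' => contr H (fun s s' => T r t (q c) s *
        T r' t' (q d) s')) <| by
      constructor <;> intro <;> constructor <;> intros <;>
        simp only [map_add, map_smul, LinearMap.add_apply, LinearMap.smul_apply, mul_add,
          mul_smul_comm, add_mul, smul_mul_assoc, contr_add, contr_smul]
  simp only [h2]
  refine contr_comp hH (f := fun r r' => contr H (fun t t' => contr H (fun s s' =>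
    T r t (q c) s * T r' t' (q d) s'))) ?_
  constructor <;> intro <;> constructor <;> intros <;>
    simp only [map_add, map_smul, LinearMap.add_apply, LinearMap.smul_apply, mul_add,
      mul_smul_comm, add_mul, smul_mul_assoc, contr_add, contr_smul]

theorem sqRight_comp (hH : ∀ i j, H i j = ∑ r, ∑ s, H' r s * q (e r) i * q (e s) j)
    (hT : ∀ a b c d, T' a b c d = T (q a) (q b) (q c) (q d)) (a b : Fin 4 → k) :
    sqRight H' T' a b = sqRight H T (q a) (q b) := by
  simp only [sqRight, hT]
  have h1 : ∀ r r' t t', contr H' (fun s s' => T (q a) r t (q s) * T (q b) r' t' (q s'))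
      = contr H (fun s s' => T (q a) r t s * T (q b) r' t' s') := fun r r' t t' =>
    contr_comp hH (f := fun s s' => T (q a) r t s * T (q b) r' t' s') <| by
      constructor <;> intro <;> constructor <;> intros <;>
        simp only [map_add, map_smul, mul_add, mul_smul_comm, add_mul, smul_mul_assoc]
  simp only [h1]
  have h2 : ∀ r r', contr H' (fun t t' => contr H (fun s s' => T (q a) r (q t) s *
        T (q b) r' (q t') s'))
      = contr H (fun t t' => contr H (fun s s' => T (q a) r t s * T (q b) r' t' s')) :=
    fun r r' => contr_comp hH (f := fun t t' => contr H (fun s s' => T (q a) r t s *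
        T (q b) r' t' s')) <| by
      constructor <;> intro <;> constructor <;> intros <;>
        simp only [map_add, map_smul, LinearMap.add_apply, LinearMap.smul_apply, mul_add,
          mul_smul_comm, add_mul, smul_mul_assoc, contr_add, contr_smul]
  simp only [h2]
  refine contr_comp hH (f := fun r r' => contr H (fun t t' => contr H (fun s s' =>
    T (q a) r t s * T (q b) r' t' s'))) ?_
  constructor <;> intro <;> constructor <;> intros <;>
    simp only [map_add, map_smul, LinearMap.add_apply, LinearMap.smul_apply, mul_add,
      mul_smul_comm, add_mul, smul_mul_assoc, contr_add, contr_smul]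

theorem sqTrace_comp (hH : ∀ i j, H i j = ∑ r, ∑ s, H' r s * q (e r) i * q (e s) j)
    (hT : ∀ a b c d, T' a b c d = T (q a) (q b) (q c) (q d)) :
    sqTrace H' T' = sqTrace H T := by
  have h1 : ∀ r r', contr H' (fun s s' => contr H' fun t t' => contr H' fun n n' =>
      T' r s t n * T' r' s' t' n') = contr H (fun s s' => contr H fun t t' => contr H fun n n' =>
      T (q r) s t n * T (q r') s' t' n') := fun r r' => sqRight_comp hH hT r r'
  simp only [sqTrace, h1]
  refine contr_comp hH (f := fun r r' => sqRight H T r r') (sqRight_bilin H T)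

variable [Algebra ℝ k]

theorem belSymm_comp (hH : ∀ i j, H i j = ∑ r, ∑ s, H' r s * q (e r) i * q (e s) j)
    (hg : ∀ a b, g' a b = g (q a) (q b))
    (hT : ∀ a b c d, T' a b c d = T (q a) (q b) (q c) (q d)) (a b c d : Fin 4 → k) :
    belSymm H' g' T' a b c d = belSymm H g T (q a) (q b) (q c) (q d) := by
  simp only [belSymm, bel, sq_comp hH hT, sqLeft_comp hH hT, sqRight_comp hH hT,
    sqTrace_comp hH hT, hg]

/-- The Bel current is natural under changes of basis. -/
theorem current_comp (hH : ∀ i j, H i j = ∑ r, ∑ s, H' r s * q (e r) i * q (e s) j)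
    (hg : ∀ a b, g' a b = g (q a) (q b))
    (hT : ∀ a b c d, T' a b c d = T (q a) (q b) (q c) (q d)) (X Y Z : Fin 4 → k) :
    q (current H' g' T' X Y Z) = current H g T (q X) (q Y) (q Z) := by
  ext i
  have h1 := contr_comp hH (f := fun u v => u i * belSymm H g T (q X) (q Y) (q Z) v) <| by
    constructor <;> intro <;> constructor <;> intros <;>
      simp only [(belSymm_linear₄ H g T _ _ _).map_add, (belSymm_linear₄ H g T _ _ _).map_smul,
        mul_add, add_mul, mul_smul_comm, smul_mul_assoc, Pi.add_apply, Pi.smul_apply]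
  rw [← sum_smul_e (current H' g' T' X Y Z)]
  simp only [map_sum, map_smul, Finset.sum_apply, Pi.smul_apply, smul_eq_mul, current,
    belSymm_comp hH hg hT]
  simp only [contr] at h1
  trans ∑ m, ∑ n, H' m n * (q (e m) i * belSymm H g T (q X) (q Y) (q Z) (q (e n)))
  · refine Finset.sum_congr rfl fun m _ => ?_
    rw [Finset.sum_mul]
    exact Finset.sum_congr rfl fun n _ => by ring
  · rw [h1]
    simp [Pi.single_apply]

end Equivariance

end BelAlgebra

end

/-! ### Tensor calculus over a ring of functions -/

noncomputable section

/-- Tensor calculus in one coordinate domain, over a commutative ring of functions: commuting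
derivations `D i`, which stand for the partial derivatives, and a metric `g` with inverse `h`. -/
structure MetricRing (A : Type*) [CommRing A] [Algebra ℝ A] where
  /-- The partial derivatives. -/
  D : Fin 4 → Derivation ℝ A A
  D_comm : ∀ i j f, D i (D j f) = D j (D i f)
  /-- The components of the metric. -/
  g : Fin 4 → Fin 4 → A
  g_symm : ∀ i j, g i j = g j i
  /-- The components of the inverse metric. -/
  h : Fin 4 → Fin 4 → A
  h_mul : ∀ i j, ∑ k, h i k * g k j = if i = j then 1 else 0

namespace MetricRing

variable {A : Type*} [CommRing A] [Algebra ℝ A] (S : MetricRing A)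

/-- The constant function `1/2`. -/
def half (A : Type*) [CommRing A] [Algebra ℝ A] : A := algebraMap ℝ A (1 / 2)

theorem half_add_half : half A + half A = 1 := by
  rw [half, ← map_add]
  norm_num

theorem eq_zero_of_add_self {x : A} (hx : x + x = 0) : x = 0 := by
  linear_combination half A * hx - x * half_add_half (A := A)

/-- The Christoffel symbols of the first kind `Γ_{lij}`. -/
def low (l i j : Fin 4) : A :=
  half A * (S.D i (S.g j l) + S.D j (S.g i l) - S.D l (S.g i j))

/-- The Christoffel symbols `Γ^k_{ij}`. -/
def chr (k i j : Fin 4) : A := ∑ l, S.h k l * S.low l i j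

/-- The curvature tensor `R^a_{bcd}`. -/
def riemUp (a b c d : Fin 4) : A :=
  S.D c (S.chr a d b) - S.D d (S.chr a c b)
    + ∑ e, (S.chr a c e * S.chr e d b - S.chr a d e * S.chr e c b)

/-- The Riemann tensor `R_{abcd}`. -/
def riem (a b c d : Fin 4) : A := ∑ e, S.g a e * S.riemUp e b c d

theorem mul_h (i j : Fin 4) : ∑ k, S.g i k * S.h k j = if i = j then 1 else 0 := by
  have h1 : (Matrix.of S.h) * (Matrix.of S.g) = 1 := by
    ext a b
    simp [Matrix.mul_apply, S.h_mul, Matrix.one_apply]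
  have h2 : (Matrix.of S.g * Matrix.of S.h) i j = (1 : Matrix (Fin 4) (Fin 4) A) i j := by
    rw [mul_eq_one_comm.mp h1]
  simpa [Matrix.mul_apply, Matrix.one_apply] using h2

theorem h_symm (i j : Fin 4) : S.h i j = S.h j i := by
  have hg : (Matrix.of S.g).transpose = Matrix.of S.g := by
    ext a b
    simp [S.g_symm b a]
  have h1 : (Matrix.of S.h) * (Matrix.of S.g) = 1 := by
    ext a b
    simp [Matrix.mul_apply, S.h_mul, Matrix.one_apply]
  have h2 : (Matrix.of S.g) * (Matrix.of S.h).transpose = 1 := by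
    rw [← hg, ← Matrix.transpose_mul, h1, Matrix.transpose_one]
  have h3 : Matrix.of S.h = (Matrix.of S.h).transpose := left_inv_eq_right_inv h1 h2
  exact congrFun (congrFun h3 i) j

theorem low_symm (l i j : Fin 4) : S.low l i j = S.low l j i := by
  simp only [low, S.g_symm i j]
  ring

theorem chr_symm (k i j : Fin 4) : S.chr k i j = S.chr k j i := by
  simp only [chr, S.low_symm _ i j]

theorem D_g (c a b : Fin 4) : S.D c (S.g a b) = S.low a c b + S.low b c a := by
  simp only [low, S.g_symm b a, S.g_symm c b, S.g_symm c a]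
  linear_combination -(S.D c (S.g a b)) * half_add_half (A := A)

theorem g_contract_h (x : Fin 4 → A) (i : Fin 4) :
    ∑ k, S.g i k * ∑ l, S.h k l * x l = x i := by
  simp only [Finset.mul_sum, ← mul_assoc]
  rw [Finset.sum_comm]
  simp [← Finset.sum_mul, S.mul_h]

theorem h_contract_g (x : Fin 4 → A) (i : Fin 4) :
    ∑ k, S.h i k * ∑ l, S.g k l * x l = x i := by
  simp only [Finset.mul_sum, ← mul_assoc]
  rw [Finset.sum_comm]
  simp [← Finset.sum_mul, S.h_mul]

theorem g_chr (l i j : Fin 4) : ∑ k, S.g l k * S.chr k i j = S.low l i j :=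
  S.g_contract_h (fun l => S.low l i j) l

/-- A vector is zero if the metrically equivalent 1-form is. -/
theorem eq_zero_of_lower {x : Fin 4 → A} (hx : ∀ l, ∑ k, S.g l k * x k = 0) (i : Fin 4) :
    x i = 0 := by
  rw [← S.h_contract_g x i]
  simp [hx]

/-- The derivative along a vector field. -/
def along (ξ : Fin 4 → A) : Derivation ℝ A A := ∑ k, ξ k • S.D k

theorem along_apply (ξ : Fin 4 → A) (f : A) : S.along ξ f = ∑ k, ξ k * S.D k f := by
  simp only [along, Fin.sum_univ_four, Derivation.add_apply, Derivation.smul_apply, smul_eq_mul]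

theorem along_D (ξ : Fin 4 → A) (i : Fin 4) (f : A) :
    S.along ξ (S.D i f) = S.D i (S.along ξ f) - ∑ k, S.D i (ξ k) * S.D k f := by
  simp only [along_apply, map_sum, Derivation.leibniz, smul_eq_mul, Finset.sum_add_distrib,
    S.D_comm i _ f]
  rw [eq_sub_iff_add_eq]
  congr 1
  exact Finset.sum_congr rfl fun k _ => mul_comm _ _

@[simp] theorem along_half (ξ : Fin 4 → A) : S.along ξ (half A) = 0 :=
  (S.along ξ).map_algebraMap _

/-- The components `ξ_i`. -/
def lower (ξ : Fin 4 → A) (i : Fin 4) : A := ∑ j, S.g i j * ξ j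

/-- The covariant derivative `∇_i ξ_j`. -/
def cov (ξ : Fin 4 → A) (i j : Fin 4) : A :=
  S.D i (S.lower ξ j) - ∑ k, S.chr k i j * S.lower ξ k

/-- The second covariant derivative `∇_c ∇_a ξ_b`. -/
def cov2 (ξ : Fin 4 → A) (c a b : Fin 4) : A :=
  S.D c (S.cov ξ a b) - ∑ m, (S.chr m c a * S.cov ξ m b + S.chr m c b * S.cov ξ a m)

/-- The Killing equation `∇_i ξ_j + ∇_j ξ_i = 0`. -/
def Killing (ξ : Fin 4 → A) : Prop := ∀ i j, S.cov ξ i j + S.cov ξ j i = 0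

/-- Contraction of the Christoffel symbols with the lowered components. -/
theorem chr_lower (ξ : Fin 4 → A) (i j : Fin 4) :
    ∑ k, S.chr k i j * S.lower ξ k = ∑ m, S.low m i j * ξ m := by
  simp only [lower, Finset.mul_sum]
  rw [Finset.sum_comm]
  refine Finset.sum_congr rfl fun m _ => ?_
  rw [← S.g_chr m i j, Finset.sum_mul]
  exact Finset.sum_congr rfl fun k _ => by rw [S.g_symm k m]; ring

theorem cov_eq (ξ : Fin 4 → A) (i j : Fin 4) :
    S.cov ξ i j = ∑ m, (S.g j m * S.D i (ξ m) + S.low j i m * ξ m) := by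
  rw [cov, chr_lower]
  simp only [lower, map_sum, Derivation.leibniz, smul_eq_mul, D_g, ← Finset.sum_sub_distrib]
  exact Finset.sum_congr rfl fun m _ => by ring

variable {S} {ξ : Fin 4 → A}

/-- The Lie derivative of the metric vanishes. -/
theorem Killing.along_g (hξ : S.Killing ξ) (i j : Fin 4) :
    S.along ξ (S.g i j) = -∑ m, (S.D i (ξ m) * S.g m j + S.D j (ξ m) * S.g i m) := by
  have h1 := hξ i j
  rw [cov_eq, cov_eq, ← Finset.sum_add_distrib] at h1
  rw [along_apply, eq_neg_iff_add_eq_zero, ← Finset.sum_add_distrib, ← h1]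
  refine Finset.sum_congr rfl fun m _ => ?_
  rw [S.D_g m i j, S.g_symm m j, S.low_symm j i m, S.low_symm i j m]
  have h2 : S.low i m j + S.low j m i = S.low j m i + S.low i m j := add_comm _ _
  ring

/-- The derivative of the Christoffel symbols of the first kind along a Killing vector field. The
term with second derivatives is the inhomogeneous part of their transformation law. -/
theorem Killing.along_low (hξ : S.Killing ξ) (l i j : Fin 4) :
    S.along ξ (S.low l i j) = -∑ m, (S.D i (ξ m) * S.low l m j + S.D j (ξ m) * S.low l i m
      + S.D l (ξ m) * S.low m i j + S.g l m * S.D i (S.D j (ξ m))) := by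
  have hD : ∀ a b c, S.along ξ (S.D a (S.g b c)) = -∑ m, (S.D b (ξ m) * S.D a (S.g m c)
      + S.g m c * S.D a (S.D b (ξ m)) + S.D c (ξ m) * S.D a (S.g b m)
      + S.g b m * S.D a (S.D c (ξ m)) + S.D a (ξ m) * S.D m (S.g b c)) := fun a b c => by
    rw [along_D, hξ.along_g]
    simp only [map_neg, map_sum, map_add, Derivation.leibniz, smul_eq_mul]
    rw [← neg_add', ← Finset.sum_add_distrib]
    exact congrArg _ (Finset.sum_congr rfl fun m _ => by ring)
  conv_lhs => rw [low]
  simp only [Derivation.leibniz, map_add, map_sub, along_half, smul_eq_mul, mul_zero, add_zero, hD]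
  rw [← neg_add, ← Finset.sum_add_distrib, neg_sub_neg, ← neg_sub, ← Finset.sum_sub_distrib,
    mul_neg, Finset.mul_sum]
  refine congrArg _ (Finset.sum_congr rfl fun m _ => ?_)
  simp only [low, S.g_symm m l, S.g_symm m j, S.g_symm i m, S.D_comm j i, S.D_comm l i,
    S.D_comm l j, S.g_symm j l, S.g_symm i l]
  linear_combination (S.g l m * S.D i (S.D j (ξ m))) * half_add_half (A := A)

/-- The Lie derivative of the Levi-Civita connection vanishes. -/
theorem Killing.along_chr (hξ : S.Killing ξ) (k i j : Fin 4) :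
    S.along ξ (S.chr k i j) = ∑ m, (S.D m (ξ k) * S.chr m i j - S.D i (ξ m) * S.chr k m j
      - S.D j (ξ m) * S.chr k i m) - S.D i (S.D j (ξ k)) := by
  rw [← sub_eq_zero]
  refine S.eq_zero_of_lower (x := fun k => S.along ξ (S.chr k i j) -
    (∑ m, (S.D m (ξ k) * S.chr m i j - S.D i (ξ m) * S.chr k m j
      - S.D j (ξ m) * S.chr k i m) - S.D i (S.D j (ξ k)))) (fun l => ?_) k
  have h1 := congrArg (S.along ξ) (S.g_chr l i j)
  rw [hξ.along_low] at h1
  simp only [← S.g_chr l] at h1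
  simp only [← S.g_chr _ i j] at h1
  simp only [map_sum, Derivation.leibniz, smul_eq_mul, hξ.along_g] at h1
  simp only [Fin.sum_univ_four] at h1 ⊢
  linear_combination h1

/-- The Lie derivative of the curvature vanishes. -/
theorem Killing.along_riemUp (hξ : S.Killing ξ) (a b c d : Fin 4) :
    S.along ξ (S.riemUp a b c d) = ∑ m, (S.D m (ξ a) * S.riemUp m b c d
      - S.D b (ξ m) * S.riemUp a m c d - S.D c (ξ m) * S.riemUp a b m d
      - S.D d (ξ m) * S.riemUp a b c m) := by
  simp only [riemUp, map_add, map_sub, Derivation.leibniz, smul_eq_mul, along_D,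
    hξ.along_chr, Fin.sum_univ_four]
  have h0 : ∀ f, S.D d (S.D c f) = S.D c (S.D d f) := fun f => S.D_comm d c f
  rw [h0 (ξ 0), h0 (ξ 1), h0 (ξ 2), h0 (ξ 3), S.D_comm d c (S.D b (ξ a))]
  simp only [S.chr_symm _ _ b, S.D_comm _ _ (ξ a), S.D_comm _ b (ξ _)]
  ring

end MetricRing
end

/-! ### Killing vector fields: covariant derivatives and exterior products -/

noncomputable section

/-- The components of the exterior product `α ∧ β ∧ F` of two 1-forms and a 2-form. The arguments
are indices, or vectors. -/
def wedge {I A : Type*} [CommRing A] (α β : I → A) (F : I → I → A) (a b c d : I) : A :=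
  (α a * β b - α b * β a) * F c d - (α a * β c - α c * β a) * F b d
    + (α a * β d - α d * β a) * F b c + (α b * β c - α c * β b) * F a d
    - (α b * β d - α d * β b) * F a c + (α c * β d - α d * β c) * F a b

namespace MetricRing

variable {A : Type*} [CommRing A] [Algebra ℝ A] {S : MetricRing A} {ξ : Fin 4 → A}

theorem Killing.along_riem (hξ : S.Killing ξ) (a b c d : Fin 4) :
    S.along ξ (S.riem a b c d) = -∑ m, (S.D a (ξ m) * S.riem m b c d
      + S.D b (ξ m) * S.riem a m c d + S.D c (ξ m) * S.riem a b m d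
      + S.D d (ξ m) * S.riem a b c m) := by
  simp only [riem, map_sum, Derivation.leibniz, smul_eq_mul, hξ.along_g, hξ.along_riemUp]
  simp only [Fin.sum_univ_four]
  ring

variable (S)

/-- The curvature in terms of the Christoffel symbols of the first kind. -/
theorem riem_eq (a b c d : Fin 4) : S.riem a b c d = S.D c (S.low a d b) - S.D d (S.low a c b)
    - ∑ m, (S.low m c a * S.chr m d b - S.low m d a * S.chr m c b) := by
  rw [← S.g_chr a d b, ← S.g_chr a c b]
  simp only [riem, riemUp, map_sum, Derivation.leibniz, smul_eq_mul, D_g]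
  simp only [← S.g_chr a]
  simp only [Fin.sum_univ_four]
  ring

theorem low_chr_comm (a b c d : Fin 4) :
    ∑ m, S.low m a b * S.chr m c d = ∑ m, S.low m c d * S.chr m a b := by
  simp only [chr, Finset.mul_sum]
  rw [Finset.sum_comm]
  refine Finset.sum_congr rfl fun m _ => Finset.sum_congr rfl fun l _ => ?_
  rw [S.h_symm]
  ring

theorem riem_antisymm_right (a b c d : Fin 4) : S.riem a b c d = -S.riem a b d c := by
  simp only [riem_eq, Finset.sum_sub_distrib]
  ring

theorem riem_antisymm_left (a b c d : Fin 4) : S.riem a b c d = -S.riem b a c d := by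
  have h1 := congrArg (S.D c) (S.D_g d a b)
  have h2 := congrArg (S.D d) (S.D_g c a b)
  rw [map_add] at h1 h2
  simp only [riem_eq, Finset.sum_sub_distrib]
  linear_combination h2 - h1 + S.D_comm c d (S.g a b) - S.low_chr_comm c a d b
    + S.low_chr_comm d a c b

theorem riem_cyclic (a b c d : Fin 4) :
    S.riem a b c d + S.riem a c d b + S.riem a d b c = 0 := by
  simp only [riem_eq, Finset.sum_sub_distrib, S.low_symm a d b, S.low_symm a c b, S.low_symm a d c,
    S.chr_symm _ d b, S.chr_symm _ d c, S.chr_symm _ c b]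
  ring

theorem riem_pair (a b c d : Fin 4) : S.riem a b c d = S.riem c d a b := by
  rw [← sub_eq_zero]
  apply eq_zero_of_add_self
  have hb : S.riem a b c d + S.riem b c a d + S.riem d b a c = 0 := by
    linear_combination -S.riem_cyclic b a c d + S.riem_antisymm_left b a c d
      + S.riem_antisymm_right b c d a + S.riem_antisymm_left b d a c
  have hc : S.riem a c d b + S.riem b c a d + S.riem c d a b = 0 := by
    linear_combination S.riem_cyclic c a b d - S.riem_antisymm_left c a b d
      + S.riem_antisymm_right a c b d - S.riem_antisymm_left c b d a
      + S.riem_antisymm_right b c d a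
  have hd : S.riem a d b c + S.riem d b a c + S.riem c d a b = 0 := by
    linear_combination -S.riem_cyclic d a b c + S.riem_antisymm_left d a b c
      + S.riem_antisymm_right d b c a + S.riem_antisymm_left d c a b
  linear_combination S.riem_cyclic a b c d + hb - hc - hd

/-- The Ricci identity. -/
theorem cov2_sub (ξ : Fin 4 → A) (c a b : Fin 4) :
    S.cov2 ξ c a b - S.cov2 ξ a c b = -∑ m, S.riem m b c a * ξ m := by
  have h1 : ∑ m, S.riem m b c a * ξ m = ∑ n, S.riemUp n b c a * S.lower ξ n := by
    simp only [riem, lower, Finset.sum_mul, Finset.mul_sum]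
    rw [Finset.sum_comm]
    refine Finset.sum_congr rfl fun m _ => Finset.sum_congr rfl fun l _ => ?_
    rw [S.g_symm]
    ring
  rw [h1]
  simp only [cov2, cov, riemUp, map_sub, map_sum, Derivation.leibniz, smul_eq_mul, S.D_comm a c,
    S.chr_symm _ a c]
  simp only [Fin.sum_univ_four]
  ring

variable {S}

theorem Killing.cov_antisymm (hξ : S.Killing ξ) (a b : Fin 4) : S.cov ξ a b = -S.cov ξ b a :=
  eq_neg_of_add_eq_zero_left (hξ a b)

theorem Killing.cov2_antisymm (hξ : S.Killing ξ) (c a b : Fin 4) :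
    S.cov2 ξ c a b = -S.cov2 ξ c b a := by
  simp only [cov2, hξ.cov_antisymm b a, hξ.cov_antisymm b _, hξ.cov_antisymm _ a, map_neg]
  rw [hξ.cov_antisymm a b]
  simp only [map_neg, Fin.sum_univ_four]
  ring

/-- The second derivative of a Killing vector field is determined by the curvature. -/
theorem Killing.cov2_eq (hξ : S.Killing ξ) (c a b : Fin 4) :
    S.cov2 ξ c a b = ∑ m, S.riem m c a b * ξ m := by
  have hcyc : ∑ m, S.riem m a b c * ξ m + ∑ m, S.riem m b c a * ξ m + ∑ m, S.riem m c a b * ξ m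
      = 0 := by
    rw [← Finset.sum_add_distrib, ← Finset.sum_add_distrib]
    refine Finset.sum_eq_zero fun m _ => ?_
    linear_combination ξ m * S.riem_cyclic m a b c
  rw [← sub_eq_zero]
  apply eq_zero_of_add_self
  linear_combination S.cov2_sub ξ c a b + hξ.cov2_antisymm a c b - S.cov2_sub ξ a b c
    - hξ.cov2_antisymm b a c + S.cov2_sub ξ b c a + hξ.cov2_antisymm c a b - hcyc

theorem D_lower (ξ : Fin 4 → A) (c a : Fin 4) :
    S.D c (S.lower ξ a) = S.cov ξ c a + ∑ m, S.chr m c a * S.lower ξ m := by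
  rw [cov]
  ring

theorem D_cov (ξ : Fin 4 → A) (c a b : Fin 4) : S.D c (S.cov ξ a b) = S.cov2 ξ c a b
    + ∑ m, (S.chr m c a * S.cov ξ m b + S.chr m c b * S.cov ξ a m) := by
  rw [cov2]
  ring

theorem D_component (ξ : Fin 4 → A) (c a : Fin 4) : S.D c (ξ a)
    = ∑ n, S.h a n * S.cov ξ c n - ∑ m, S.chr a c m * ξ m := by
  have h1 : ∀ n, ∑ m, S.g n m * S.D c (ξ m) = S.cov ξ c n - ∑ m, S.low n c m * ξ m := fun n => by
    rw [cov_eq, Finset.sum_add_distrib]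
    ring
  rw [← S.h_contract_g (fun m => S.D c (ξ m)) a]
  simp only [h1, mul_sub, Finset.sum_sub_distrib, chr, Finset.mul_sum, Finset.sum_mul]
  congr 1
  rw [Finset.sum_comm]
  exact Finset.sum_congr rfl fun m _ => Finset.sum_congr rfl fun l _ => by ring

/-- The derivative of the condition `ξ ∧ ∇ξ = 0`. -/
theorem cov_wedge (hW : ∀ a b c, S.lower ξ a * S.cov ξ b c + S.lower ξ b * S.cov ξ c a
      + S.lower ξ c * S.cov ξ a b = 0) (m a b c : Fin 4) :
    S.cov ξ m a * S.cov ξ b c + S.cov ξ m b * S.cov ξ c a + S.cov ξ m c * S.cov ξ a b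
      + S.lower ξ a * S.cov2 ξ m b c + S.lower ξ b * S.cov2 ξ m c a
      + S.lower ξ c * S.cov2 ξ m a b = 0 := by
  have h1 := congrArg (S.D m) (hW a b c)
  simp only [map_add, map_zero, Derivation.leibniz, smul_eq_mul, D_lower, D_cov] at h1
  simp only [Fin.sum_univ_four] at h1
  linear_combination h1
    - S.chr 0 m a * hW 0 b c - S.chr 1 m a * hW 1 b c - S.chr 2 m a * hW 2 b c
    - S.chr 3 m a * hW 3 b c
    - S.chr 0 m b * hW a 0 c - S.chr 1 m b * hW a 1 c - S.chr 2 m b * hW a 2 c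
    - S.chr 3 m b * hW a 3 c
    - S.chr 0 m c * hW a b 0 - S.chr 1 m c * hW a b 1 - S.chr 2 m c * hW a b 2
    - S.chr 3 m c * hW a b 3

variable {η ζ : Fin 4 → A}

/-- The derivative of the condition `ξ ∧ η ∧ ∇ζ = 0`. -/
theorem cov_wedge_wedge
    (hW : ∀ a b c d, wedge (S.lower ξ) (S.lower η) (S.cov ζ) a b c d = 0) (m a b c d : Fin 4) :
    wedge (S.cov ξ m) (S.lower η) (S.cov ζ) a b c d
      + wedge (S.lower ξ) (S.cov η m) (S.cov ζ) a b c d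
      + wedge (S.lower ξ) (S.lower η) (S.cov2 ζ m) a b c d = 0 := by
  simp only [wedge] at hW ⊢
  have h1 := congrArg (S.D m) (hW a b c d)
  simp only [map_add, map_sub, map_zero, Derivation.leibniz, smul_eq_mul, D_lower, D_cov] at h1
  simp only [Fin.sum_univ_four] at h1
  linear_combination h1
    - S.chr 0 m a * hW 0 b c d - S.chr 1 m a * hW 1 b c d - S.chr 2 m a * hW 2 b c d
    - S.chr 3 m a * hW 3 b c d
    - S.chr 0 m b * hW a 0 c d - S.chr 1 m b * hW a 1 c d - S.chr 2 m b * hW a 2 c d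
    - S.chr 3 m b * hW a 3 c d
    - S.chr 0 m c * hW a b 0 d - S.chr 1 m c * hW a b 1 d - S.chr 2 m c * hW a b 2 d
    - S.chr 3 m c * hW a b 3 d
    - S.chr 0 m d * hW a b c 0 - S.chr 1 m d * hW a b c 1 - S.chr 2 m d * hW a b c 2
    - S.chr 3 m d * hW a b c 3

theorem cov_of_commute (hC : ∀ i, S.along ξ (η i) = S.along η (ξ i)) (b : Fin 4) :
    ∑ a, ξ a * S.cov η a b = ∑ a, η a * S.cov ξ a b := by
  simp only [cov_eq, Finset.mul_sum, mul_add, Finset.sum_add_distrib]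
  have h1 : ∑ a, ∑ m, ξ a * (S.g b m * S.D a (η m)) = ∑ a, ∑ m, η a * (S.g b m * S.D a (ξ m)) := by
    rw [Finset.sum_comm]
    conv_rhs => rw [Finset.sum_comm]
    refine Finset.sum_congr rfl fun m _ => ?_
    have h2 := hC m
    rw [along_apply, along_apply] at h2
    simp only [mul_left_comm _ (S.g b m), ← Finset.mul_sum, h2]
  have h3 : ∑ a, ∑ m, ξ a * (S.low b a m * η m) = ∑ a, ∑ m, η a * (S.low b a m * ξ m) := by
    rw [Finset.sum_comm]
    exact Finset.sum_congr rfl fun m _ => Finset.sum_congr rfl fun a _ => by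
      rw [S.low_symm b m a]; ring
  rw [h1, h3]

/-- The derivative of the identity `ξ^a ∇_a η_b = η^a ∇_a ξ_b` for commuting fields. -/
theorem cov2_of_commute (hC : ∀ i, S.along ξ (η i) = S.along η (ξ i)) (c b : Fin 4) :
    ∑ a, ∑ n, S.h a n * (S.cov ξ c n * S.cov η a b - S.cov η c n * S.cov ξ a b)
      + ∑ a, (ξ a * S.cov2 η c a b - η a * S.cov2 ξ c a b) = 0 := by
  have hZ := fun b => cov_of_commute hC b
  have h1 := congrArg (S.D c) (hZ b)
  simp only [map_sum, Derivation.leibniz, smul_eq_mul, D_component ξ, D_component η, D_cov] at h1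
  have h0 := hZ 0
  have h2 := hZ 1
  have h3 := hZ 2
  have h4 := hZ 3
  simp only [Fin.sum_univ_four] at h0 h1 h2 h3 h4 ⊢
  linear_combination h1 - S.chr 0 c b * h0 - S.chr 1 c b * h2 - S.chr 2 c b * h3
    - S.chr 3 c b * h4

/-- The divergence `∇_i X^i`. -/
def div (S : MetricRing A) (X : Fin 4 → A) : A :=
  ∑ i, (S.D i (X i) + ∑ k, S.chr i i k * X k)

theorem Killing.div_eq_zero (hξ : S.Killing ξ) : S.div ξ = 0 := by
  have h1 : ∀ i, S.D i (ξ i) + ∑ k, S.chr i i k * ξ k = ∑ n, S.h i n * S.cov ξ i n := fun i => by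
    rw [D_component]
    ring
  simp only [div, h1]
  apply eq_zero_of_add_self
  conv_lhs => lhs; rw [Finset.sum_comm]
  rw [← Finset.sum_add_distrib]
  refine Finset.sum_eq_zero fun i _ => ?_
  rw [← Finset.sum_add_distrib]
  refine Finset.sum_eq_zero fun n _ => ?_
  linear_combination S.h i n * hξ i n + S.cov ξ n i * S.h_symm n i

theorem div_smul (f : A) (X : Fin 4 → A) :
    S.div (fun i => f * X i) = f * S.div X + S.along X f := by
  simp only [div, along_apply, Derivation.leibniz, smul_eq_mul, mul_add, Finset.mul_sum,
    Finset.sum_add_distrib]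
  simp only [mul_left_comm f]
  ring

theorem div_sub (X Y : Fin 4 → A) : S.div (fun i => X i - Y i) = S.div X - S.div Y := by
  simp only [div, map_sub, mul_sub, Finset.sum_sub_distrib, Finset.sum_add_distrib]
  ring

end MetricRing
end

/-! ### Invariance of the Bel current under Killing flows -/

noncomputable section

namespace BelAlgebra

section Naturality

variable {k k' : Type*} [CommRing k] [CommRing k'] [Algebra ℝ k] [Algebra ℝ k'] (f : k →ₐ[ℝ] k')

theorem map_e (i : Fin 4) : (e i : Fin 4 → k') = fun j => f ((e i : Fin 4 → k) j) := by
  ext j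
  simp [Pi.single_apply, apply_ite f]

theorem form1_map (φ v : Fin 4 → k) :
    form1 (fun i => f (φ i)) (fun i => f (v i)) = f (form1 φ v) := by
  simp [form1, Fintype.linearCombination_apply]

theorem form2_map (B : Fin 4 → Fin 4 → k) (u v : Fin 4 → k) :
    form2 (fun i j => f (B i j)) (fun i => f (u i)) (fun i => f (v i)) = f (form2 B u v) := by
  simp [form2, Fintype.linearCombination_apply, form1_map]

theorem form4_map (T : Fin 4 → Fin 4 → Fin 4 → Fin 4 → k) (a b c d : Fin 4 → k) :
    form4 (fun i j k l => f (T i j k l)) (fun i => f (a i)) (fun i => f (b i))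
      (fun i => f (c i)) (fun i => f (d i)) = f (form4 T a b c d) := by
  simp [form4, Fintype.linearCombination_apply, form2_map]

theorem contr_map {h : Fin 4 → Fin 4 → k} {F : (Fin 4 → k) → (Fin 4 → k) → k}
    {F' : (Fin 4 → k') → (Fin 4 → k') → k'}
    (hF : ∀ u v, F' (fun i => f (u i)) (fun i => f (v i)) = f (F u v)) :
    contr (fun i j => f (h i j)) F' = f (contr h F) := by
  simp only [contr, map_e f, hF, map_sum f, map_mul f]

theorem sq_map (h : Fin 4 → Fin 4 → k) (T : Fin 4 → Fin 4 → Fin 4 → Fin 4 → k)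
    (a b c d : Fin 4 → k) :
    sq (fun i j => f (h i j)) (form4 fun i j k l => f (T i j k l)) (fun i => f (a i))
      (fun i => f (b i)) (fun i => f (c i)) (fun i => f (d i)) = f (sq h (form4 T) a b c d) :=
  contr_map f fun r r' => contr_map f fun s s' => by rw [form4_map f, form4_map f, map_mul f]

theorem sqLeft_map (h : Fin 4 → Fin 4 → k) (T : Fin 4 → Fin 4 → Fin 4 → Fin 4 → k)
    (c d : Fin 4 → k) :
    sqLeft (fun i j => f (h i j)) (form4 fun i j k l => f (T i j k l)) (fun i => f (c i))
      (fun i => f (d i)) = f (sqLeft h (form4 T) c d) :=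
  contr_map f fun r r' => contr_map f fun s s' => contr_map f fun t t' => by
    rw [form4_map f, form4_map f, map_mul f]

theorem sqRight_map (h : Fin 4 → Fin 4 → k) (T : Fin 4 → Fin 4 → Fin 4 → Fin 4 → k)
    (a b : Fin 4 → k) :
    sqRight (fun i j => f (h i j)) (form4 fun i j k l => f (T i j k l)) (fun i => f (a i))
      (fun i => f (b i)) = f (sqRight h (form4 T) a b) :=
  contr_map f fun r r' => contr_map f fun s s' => contr_map f fun t t' => by
    rw [form4_map f, form4_map f, map_mul f]

theorem sqTrace_map (h : Fin 4 → Fin 4 → k) (T : Fin 4 → Fin 4 → Fin 4 → Fin 4 → k) :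
    sqTrace (fun i j => f (h i j)) (form4 fun i j k l => f (T i j k l))
      = f (sqTrace h (form4 T)) :=
  contr_map f fun r r' => contr_map f fun s s' => contr_map f fun t t' =>
    contr_map f fun n n' => by rw [form4_map f, form4_map f, map_mul f]

/-- The Bel current is natural under homomorphisms of the ring of scalars. -/
theorem current_map (h g : Fin 4 → Fin 4 → k) (T : Fin 4 → Fin 4 → Fin 4 → Fin 4 → k)
    (X Y Z : Fin 4 → k) (m : Fin 4) :
    current (fun i j => f (h i j)) (form2 fun i j => f (g i j))
      (form4 fun i j k l => f (T i j k l)) (fun i => f (X i)) (fun i => f (Y i))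
      (fun i => f (Z i)) m = f (current h (form2 g) (form4 T) X Y Z m) := by
  have hc : ∀ x : ℝ, f (algebraMap ℝ k x) = algebraMap ℝ k' x := fun x => f.commutes x
  simp only [current, belSymm, bel, map_e f, sq_map f, sqLeft_map f, sqRight_map f, sqTrace_map f,
    form2_map f, map_sum f, map_mul f, map_add f, map_sub f, hc]

end Naturality

section ChangeOfBasis

variable {k : Type*} [CommRing k]

theorem linear_ext {f f' : (Fin 4 → k) → k} (hf : IsLinearMap k f) (hf' : IsLinearMap k f')
    (h : ∀ i, f (e i) = f' (e i)) (v : Fin 4 → k) : f v = f' v := by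
  rw [linear_expand hf, linear_expand hf']
  simp only [h]

theorem form2_comp_ext {g g' : Form2 k} {q : (Fin 4 → k) →ₗ[k] (Fin 4 → k)}
    (h : ∀ i j, g' (e i) (e j) = g (q (e i)) (q (e j))) (u v : Fin 4 → k) :
    g' u v = g (q u) (q v) := by
  refine linear_ext (f := fun u => g' u v) (f' := fun u => g (q u) (q v)) ?_ ?_ (fun i =>
    linear_ext (f := fun v => g' (e i) v) (f' := fun v => g (q (e i)) (q v)) ?_ ?_ (h i) v) u <;>
  constructor <;> intros <;>
    simp only [map_add, map_smul, LinearMap.add_apply, LinearMap.smul_apply]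

theorem form4_comp_ext {T T' : Form4 k} {q : (Fin 4 → k) →ₗ[k] (Fin 4 → k)}
    (h : ∀ i j k l, T' (e i) (e j) (e k) (e l) = T (q (e i)) (q (e j)) (q (e k)) (q (e l)))
    (a b c d : Fin 4 → k) : T' a b c d = T (q a) (q b) (q c) (q d) := by
  refine linear_ext (f := fun a => T' a b c d) (f' := fun a => T (q a) (q b) (q c) (q d)) ?_ ?_
    (fun i => linear_ext (f := fun b => T' (e i) b c d)
      (f' := fun b => T (q (e i)) (q b) (q c) (q d)) ?_ ?_
      (fun j => form2_comp_ext (g' := T' (e i) (e j)) (g := T (q (e i)) (q (e j))) (h i j) c d) b)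
    a <;>
  constructor <;> intros <;>
    simp only [map_add, map_smul, LinearMap.add_apply, LinearMap.smul_apply]

/-- The inverse metric in a new basis. -/
theorem inverse_comp {g g' h h' : Fin 4 → Fin 4 → k} {q : (Fin 4 → k) →ₗ[k] (Fin 4 → k)}
    (hh : ∀ i j, ∑ l, h i l * g l j = if i = j then 1 else 0)
    (hh' : ∀ i j, ∑ l, h' i l * g' l j = if i = j then 1 else 0)
    (hg : ∀ i j, g' i j = form2 g (q (e i)) (q (e j))) (i j : Fin 4) :
    h i j = ∑ r, ∑ s, h' r s * q (e r) i * q (e s) j := by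
  set Q : Matrix (Fin 4) (Fin 4) k := Matrix.of fun r i => q (e r) i with hQ
  have h1 : Matrix.of h * Matrix.of g = 1 := by
    ext a b
    simp [Matrix.mul_apply, hh, Matrix.one_apply]
  have h2 : Matrix.of h' * Matrix.of g' = 1 := by
    ext a b
    simp [Matrix.mul_apply, hh', Matrix.one_apply]
  have h3 : Matrix.of g' = Q * Matrix.of g * Q.transpose := by
    ext a b
    simp only [Matrix.of_apply, hg, form2_apply, Matrix.mul_apply, Matrix.transpose_apply, hQ,
      Finset.sum_mul]
    rw [Finset.sum_comm]
    exact Finset.sum_congr rfl fun x _ => Finset.sum_congr rfl fun y _ => by ring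
  have h4 : Q.transpose * (Matrix.of h' * Q * Matrix.of g) = 1 := by
    rw [mul_eq_one_comm, ← h2, h3]
    simp only [mul_assoc]
  have h5 : Q.transpose * Matrix.of h' * Q = Matrix.of h := by
    calc Q.transpose * Matrix.of h' * Q
        = Q.transpose * (Matrix.of h' * Q * Matrix.of g) * Matrix.of h := by
          simp only [mul_assoc]
          rw [mul_eq_one_comm.mp h1, mul_one]
      _ = Matrix.of h := by rw [h4, one_mul]
  have h6 : h i j = (Q.transpose * Matrix.of h' * Q) i j := by rw [h5]; rfl
  rw [h6]
  simp only [Matrix.mul_apply, Matrix.transpose_apply, Matrix.of_apply, hQ, Finset.sum_mul]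
  rw [Finset.sum_comm]
  exact Finset.sum_congr rfl fun x _ => Finset.sum_congr rfl fun y _ => by ring

theorem form2_sub_smul {ε : k} (hε : ε * ε = 0) (B : Form2 k) (u v : Fin 4 → k) (i j : Fin 4) :
    B (e i - ε • u) (e j - ε • v)
      = B (e i) (e j) - ε * ∑ m, (u m * B (e m) (e j) + v m * B (e i) (e m)) := by
  have h1 : B u (e j) = ∑ m, u m * B (e m) (e j) :=
    linear_expand (f := fun u => B u (e j)) ⟨by simp, by simp⟩ u
  have h2 : B (e i) v = ∑ m, v m * B (e i) (e m) := linear_expand (LinearMap.isLinear _) v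
  rw [Finset.sum_add_distrib, ← h1, ← h2]
  simp only [map_sub, map_smul, LinearMap.sub_apply, LinearMap.smul_apply, smul_eq_mul]
  linear_combination B u v * hε

theorem form4_sub_smul {ε : k} (hε : ε * ε = 0) (T : Form4 k) (u v w x : Fin 4 → k)
    (a b c d : Fin 4) :
    T (e a - ε • u) (e b - ε • v) (e c - ε • w) (e d - ε • x)
      = T (e a) (e b) (e c) (e d) - ε * ∑ m, (u m * T (e m) (e b) (e c) (e d)
        + v m * T (e a) (e m) (e c) (e d) + w m * T (e a) (e b) (e m) (e d)
        + x m * T (e a) (e b) (e c) (e m)) := by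
  have h1 : T u (e b) (e c) (e d) = ∑ m, u m * T (e m) (e b) (e c) (e d) :=
    linear_expand (f := fun u => T u (e b) (e c) (e d)) ⟨by simp, by simp⟩ u
  have h2 : T (e a) v (e c) (e d) = ∑ m, v m * T (e a) (e m) (e c) (e d) :=
    linear_expand (f := fun u => T (e a) u (e c) (e d)) ⟨by simp, by simp⟩ v
  have h3 : T (e a) (e b) w (e d) = ∑ m, w m * T (e a) (e b) (e m) (e d) :=
    linear_expand (f := fun u => T (e a) (e b) u (e d)) ⟨by simp, by simp⟩ w
  have h4 : T (e a) (e b) (e c) x = ∑ m, x m * T (e a) (e b) (e c) (e m) :=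
    linear_expand (LinearMap.isLinear _) x
  have hε' : -ε * -ε = 0 := by rw [neg_mul_neg, hε]
  simp only [Finset.sum_add_distrib, ← h1, ← h2, ← h3, ← h4]
  simp only [sub_eq_add_neg, ← neg_smul, map_add, map_smul, LinearMap.add_apply,
    LinearMap.smul_apply, smul_add, smul_smul, hε', zero_smul,
    LinearMap.zero_apply]
  simp only [smul_eq_mul]
  ring

end ChangeOfBasis

/-- If two images of the data of a Bel current under homomorphisms of rings differ by a change of
basis, then so do the images of the current. -/
theorem current_map_comp {k k' : Type*} [CommRing k] [CommRing k'] [Algebra ℝ k] [Algebra ℝ k']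
    (f f' : k →ₐ[ℝ] k') {h g : Fin 4 → Fin 4 → k} {T : Fin 4 → Fin 4 → Fin 4 → Fin 4 → k}
    {q : (Fin 4 → k') →ₗ[k'] (Fin 4 → k')}
    (hh : ∀ i j, ∑ l, h i l * g l j = if i = j then 1 else 0)
    (hg : ∀ i j, f' (g i j) = form2 (fun i j => f (g i j)) (q (e i)) (q (e j)))
    (hT : ∀ a b c d, f' (T a b c d) = form4 (fun i j k l => f (T i j k l)) (q (e a)) (q (e b))
      (q (e c)) (q (e d)))
    {X Y Z : Fin 4 → k} (hX : q (fun i => f' (X i)) = fun i => f (X i))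
    (hY : q (fun i => f' (Y i)) = fun i => f (Y i))
    (hZ : q (fun i => f' (Z i)) = fun i => f (Z i)) :
    q (fun i => f' (current h (form2 g) (form4 T) X Y Z i))
      = fun i => f (current h (form2 g) (form4 T) X Y Z i) := by
  have hm : ∀ φ : k →ₐ[ℝ] k', ∀ i j, ∑ l, φ (h i l) * φ (g l j) = if i = j then 1 else 0 :=
    fun φ i j => by
      have h1 := congrArg φ (hh i j)
      simpa only [map_sum, map_mul, apply_ite φ, map_one, map_zero] using h1
  have h1 := current_comp (H := fun i j => f (h i j)) (H' := fun i j => f' (h i j))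
    (g := form2 fun i j => f (g i j)) (g' := form2 fun i j => f' (g i j))
    (T := form4 fun i j k l => f (T i j k l)) (T' := form4 fun i j k l => f' (T i j k l)) (q := q)
    (inverse_comp (hm f) (hm f') hg)
    (form2_comp_ext fun i j => by rw [form2_e, hg])
    (form4_comp_ext fun i j k l => by rw [form4_e, hT])
    (fun i => f' (X i)) (fun i => f' (Y i)) (fun i => f' (Z i))
  rw [hX, hY, hZ] at h1
  simp only [← current_map]
  exact h1

end BelAlgebra

open DualNumber BelAlgebra

/-- The homomorphism `f ↦ f + ε δ f` into the dual numbers. -/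
def Derivation.toDual {A : Type*} [CommRing A] [Algebra ℝ A] (δ : Derivation ℝ A A) :
    A →ₐ[ℝ] A[ε] where
  toFun f := TrivSqZeroExt.inl f + TrivSqZeroExt.inr (δ f)
  map_one' := by ext <;> simp
  map_mul' x y := by ext <;> simp [mul_comm]
  map_zero' := by ext <;> simp
  map_add' x y := by ext <;> simp
  commutes' x := by ext <;> simp [TrivSqZeroExt.algebraMap_eq_inl']

theorem Derivation.toDual_apply {A : Type*} [CommRing A] [Algebra ℝ A] (δ : Derivation ℝ A A)
    (f : A) : δ.toDual f = TrivSqZeroExt.inl f + TrivSqZeroExt.inr (δ f) := rfl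

namespace MetricRing

variable {A : Type*} [CommRing A] [Algebra ℝ A] (S : MetricRing A)

/-- The contravariant components of the Bel current. -/
def belCurrent (X Y Z : Fin 4 → A) (m : Fin 4) : A :=
  current S.h (form2 S.g) (form4 S.riem) X Y Z m

section FirstOrder

variable {k : Type*} [CommRing k] [Algebra ℝ k] (f : A →ₐ[ℝ] k) (τ : k)

/-- The change of basis, of first order in `τ`, by the flow of the vector field `ξ`. -/
def flowBasis (ξ : Fin 4 → A) : (Fin 4 → k) →ₗ[k] (Fin 4 → k) :=
  Fintype.linearCombination k fun i => e i - τ • fun a => f (S.D i (ξ a))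

theorem flowBasis_e (ξ : Fin 4 → A) (i : Fin 4) :
    S.flowBasis f τ ξ (e i) = e i - τ • fun a => f (S.D i (ξ a)) := by
  simp [flowBasis, Fintype.linearCombination_apply_single]

variable {τ} {ξ : Fin 4 → A}

/-- The flow of `ξ` changes a vector field `X` to first order by the Lie bracket of `ξ` and `X`. -/
theorem flowBasis_map (hτ : τ * τ = 0) (f' : A →ₐ[ℝ] k)
    (hf : ∀ x, f' x = f x + τ * f (S.along ξ x)) (X : Fin 4 → A) (a : Fin 4) :
    S.flowBasis f τ ξ (fun i => f' (X i)) a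
      = f (X a) + τ * f (S.along ξ (X a) - S.along X (ξ a)) := by
  have h1 : ∀ i, f' (X i) * (τ * f (S.D i (ξ a))) = τ * f (X i * S.D i (ξ a)) := fun i => by
    rw [hf, map_mul]
    linear_combination f (S.along ξ (X i)) * f (S.D i (ξ a)) * hτ
  simp only [flowBasis, Fintype.linearCombination_apply, Finset.sum_apply, Pi.smul_apply,
    Pi.sub_apply, smul_eq_mul, mul_sub, Finset.sum_sub_distrib, h1, ← Finset.mul_sum, ← map_sum,
    ← along_apply, map_sub]
  simp only [Pi.single_apply, mul_ite, mul_one, mul_zero, Finset.sum_ite_eq, Finset.mem_univ,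
    if_true, hf (X a)]
  ring

/-- The flow of a Killing vector field preserves the metric, to first order. -/
theorem Killing.map_g (hτ : τ * τ = 0) (f' : A →ₐ[ℝ] k)
    (hf : ∀ x, f' x = f x + τ * f (S.along ξ x))
    (hξ : S.Killing ξ) (i j : Fin 4) : f' (S.g i j)
    = form2 (fun i j => f (S.g i j)) (S.flowBasis f τ ξ (e i)) (S.flowBasis f τ ξ (e j)) := by
  rw [flowBasis_e, flowBasis_e, form2_sub_smul hτ, hf, hξ.along_g]
  simp only [form2_e, map_neg, map_sum, map_add, map_mul]
  ring

/-- The flow of a Killing vector field preserves the curvature, to first order. -/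
theorem Killing.map_riem (hτ : τ * τ = 0) (f' : A →ₐ[ℝ] k)
    (hf : ∀ x, f' x = f x + τ * f (S.along ξ x))
    (hξ : S.Killing ξ) (a b c d : Fin 4) : f' (S.riem a b c d)
    = form4 (fun i j k l => f (S.riem i j k l)) (S.flowBasis f τ ξ (e a))
      (S.flowBasis f τ ξ (e b)) (S.flowBasis f τ ξ (e c)) (S.flowBasis f τ ξ (e d)) := by
  rw [flowBasis_e, flowBasis_e, flowBasis_e, flowBasis_e, form4_sub_smul hτ, hf, hξ.along_riem]
  simp only [form4_e, map_neg, map_sum, map_add, map_mul]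
  ring

/-- The flow of a Killing vector field preserves the Bel current of invariant vector fields, to
first order, because the current is natural both in the ring of scalars and in the basis. -/
theorem Killing.map_belCurrent (hτ : τ * τ = 0) (f' : A →ₐ[ℝ] k)
    (hf : ∀ x, f' x = f x + τ * f (S.along ξ x))
    (hξ : S.Killing ξ) {X Y Z : Fin 4 → A}
    (hX : ∀ i, S.along ξ (X i) = S.along X (ξ i)) (hY : ∀ i, S.along ξ (Y i) = S.along Y (ξ i))
    (hZ : ∀ i, S.along ξ (Z i) = S.along Z (ξ i)) (i : Fin 4) :
    τ * f (S.along ξ (S.belCurrent X Y Z i) - S.along (S.belCurrent X Y Z) (ξ i)) = 0 := by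
  have hq : ∀ X : Fin 4 → A, (∀ i, S.along ξ (X i) = S.along X (ξ i)) →
      S.flowBasis f τ ξ (fun i => f' (X i)) = fun i => f (X i) := fun X hX => by
    ext1 i
    rw [S.flowBasis_map f hτ f' hf, hX, sub_self, map_zero, mul_zero, add_zero]
  have h1 := current_map_comp f f' S.h_mul (hξ.map_g S f hτ f' hf) (hξ.map_riem S f hτ f' hf)
    (hq X hX) (hq Y hY) (hq Z hZ)
  have h2 := S.flowBasis_map f hτ f' hf (S.belCurrent X Y Z) i
  exact left_eq_add.mp ((congrFun h1 i).symm.trans h2)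

end FirstOrder

variable {S} {ξ : Fin 4 → A}

/-- The Lie derivative along a Killing vector field `ξ` of the Bel current of vector fields that
commute with `ξ` vanishes. -/
theorem Killing.along_belCurrent (hξ : S.Killing ξ) {X Y Z : Fin 4 → A}
    (hX : ∀ i, S.along ξ (X i) = S.along X (ξ i)) (hY : ∀ i, S.along ξ (Y i) = S.along Y (ξ i))
    (hZ : ∀ i, S.along ξ (Z i) = S.along Z (ξ i)) (i : Fin 4) :
    S.along ξ (S.belCurrent X Y Z i) = S.along (S.belCurrent X Y Z) (ξ i) := by
  have h1 := hξ.map_belCurrent S (TrivSqZeroExt.inlAlgHom ℝ A A) (τ := (ε : A[ε])) eps_mul_eps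
    (S.along ξ).toDual (fun x => by ext <;> simp [Derivation.toDual_apply]) hX hY hZ i
  have h2 := congrArg TrivSqZeroExt.snd h1
  simpa [sub_eq_zero] using h2

end MetricRing
end

/-! ### The Bel current at a point, by parity under reflections -/

open DualNumber BelAlgebra

noncomputable section

namespace BelAlgebra

/-- A nondegenerate scalar product on `ℝ⁴`, and a tensor with the symmetries of a Riemann tensor. -/
structure CurvatureAt where
  /-- The components of the scalar product. -/
  g : Fin 4 → Fin 4 → ℝ
  g_symm : ∀ i j, g i j = g j i
  /-- The components of the inverse scalar product. -/
  h : Fin 4 → Fin 4 → ℝ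
  h_mul : ∀ i j, ∑ k, h i k * g k j = if i = j then 1 else 0
  h_symm : ∀ i j, h i j = h j i
  /-- The components of the curvature. -/
  riem : Fin 4 → Fin 4 → Fin 4 → Fin 4 → ℝ
  antisymm_left : ∀ a b c d, riem a b c d = -riem b a c d
  antisymm_right : ∀ a b c d, riem a b c d = -riem a b d c
  pair : ∀ a b c d, riem a b c d = riem c d a b
  cyclic : ∀ a b c d, riem a b c d + riem a c d b + riem a d b c = 0

theorem form4_sub {k : Type*} [CommRing k] (T : Form4 k) (u v b c d : Fin 4 → k) :
    T (u - v) b c d = T u b c d - T v b c d := by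
  have h : IsLinearMap k fun u => T u b c d := ⟨by simp, by simp⟩
  exact h.map_sub u v

/-- A function of four vectors that is linear in each of them and vanishes on the standard basis
vanishes. -/
theorem multilinear_zero {k : Type*} [CommRing k]
    {f : (Fin 4 → k) → (Fin 4 → k) → (Fin 4 → k) → (Fin 4 → k) → k}
    (h₁ : ∀ b c d, IsLinearMap k fun a => f a b c d)
    (h₂ : ∀ a c d, IsLinearMap k fun b => f a b c d)
    (h₃ : ∀ a b d, IsLinearMap k fun c => f a b c d)
    (h₄ : ∀ a b c, IsLinearMap k fun d => f a b c d)
    (h : ∀ i j l m, f (e i) (e j) (e l) (e m) = 0) (a b c d : Fin 4 → k) : f a b c d = 0 := by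
  have h0 : IsLinearMap k fun _ : Fin 4 → k => (0 : k) := ⟨by simp, by simp⟩
  exact linear_ext (h₁ b c d) h0 (fun i => linear_ext (h₂ (e i) c d) h0 (fun j =>
    linear_ext (h₃ (e i) (e j) d) h0 (fun l => linear_ext (h₄ (e i) (e j) (e l)) h0
      (fun m => h i j l m) d) c) b) a

namespace CurvatureAt

variable (C : CurvatureAt)

/-- The scalar product. -/
def G : Form2 ℝ := form2 C.g

/-- The curvature, as a function of four vectors. -/
def R : Form4 ℝ := form4 C.riem

theorem G_symm (u v : Fin 4 → ℝ) : C.G u v = C.G v u := by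
  simp only [G, form2_apply]
  rw [Finset.sum_comm]
  exact Finset.sum_congr rfl fun i _ => Finset.sum_congr rfl fun j _ => by rw [C.g_symm]; ring

theorem R_antisymm_left (a b c d : Fin 4 → ℝ) : C.R a b c d = -C.R b a c d := by
  rw [eq_neg_iff_add_eq_zero]
  refine multilinear_zero (f := fun a b c d => C.R a b c d + C.R b a c d) ?_ ?_ ?_ ?_ ?_ a b c d
  on_goal 5 => intro i j k l; simp only [R, form4_e]; linarith [C.antisymm_left i j k l]
  all_goals
    intros; constructor <;> intros <;>
      simp only [map_add, map_smul, LinearMap.add_apply, LinearMap.smul_apply, smul_eq_mul] <;> ring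

theorem R_antisymm_right (a b c d : Fin 4 → ℝ) : C.R a b c d = -C.R a b d c := by
  rw [eq_neg_iff_add_eq_zero]
  refine multilinear_zero (f := fun a b c d => C.R a b c d + C.R a b d c) ?_ ?_ ?_ ?_ ?_ a b c d
  on_goal 5 => intro i j k l; simp only [R, form4_e]; linarith [C.antisymm_right i j k l]
  all_goals
    intros; constructor <;> intros <;>
      simp only [map_add, map_smul, LinearMap.add_apply, LinearMap.smul_apply, smul_eq_mul] <;> ring

theorem R_pair (a b c d : Fin 4 → ℝ) : C.R a b c d = C.R c d a b := by
  rw [← sub_eq_zero]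
  refine multilinear_zero (f := fun a b c d => C.R a b c d - C.R c d a b) ?_ ?_ ?_ ?_ ?_ a b c d
  on_goal 5 => intro i j k l; simp only [R, form4_e]; linarith [C.pair i j k l]
  all_goals
    intros; constructor <;> intros <;>
      simp only [map_add, map_smul, LinearMap.add_apply, LinearMap.smul_apply, smul_eq_mul] <;> ring

theorem R_cyclic (a b c d : Fin 4 → ℝ) : C.R a b c d + C.R a c d b + C.R a d b c = 0 := by
  refine multilinear_zero (f := fun a b c d => C.R a b c d + C.R a c d b + C.R a d b c)
    ?_ ?_ ?_ ?_ ?_ a b c d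
  on_goal 5 => intro i j k l; simp only [R, form4_e]; linarith [C.cyclic i j k l]
  all_goals
    intros; constructor <;> intros <;>
      simp only [map_add, map_smul, LinearMap.add_apply, LinearMap.smul_apply, smul_eq_mul] <;> ring

theorem R_self_left (a c d : Fin 4 → ℝ) : C.R a a c d = 0 := by
  linarith [C.R_antisymm_left a a c d]

theorem R_self_right (a b c : Fin 4 → ℝ) : C.R a b c c = 0 := by
  linarith [C.R_antisymm_right a b c c]

theorem h_contract_G (w : Fin 4 → ℝ) (j : Fin 4) : ∑ i, C.h i j * C.G w (e i) = w j := by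
  have h1 : ∀ i, C.G w (e i) = ∑ l, w l * C.g l i := fun i => by
    simp [G, form2_apply, Pi.single_apply]
  simp only [h1, Finset.mul_sum]
  rw [Finset.sum_comm]
  have h2 : ∀ l, ∑ i, C.h i j * (w l * C.g l i) = w l * if j = l then 1 else 0 := fun l => by
    rw [← C.h_mul, Finset.mul_sum]
    exact Finset.sum_congr rfl fun i _ => by rw [C.h_symm i j, C.g_symm l i]; ring
  simp [h2]

/-- Contraction with the 1-form equivalent to `w` is evaluation at `w`. -/
theorem contr_left {φ : (Fin 4 → ℝ) → ℝ} (hφ : IsLinearMap ℝ φ) (w : Fin 4 → ℝ) :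
    contr C.h (fun u v => C.G w u * φ v) = φ w := by
  rw [linear_expand hφ w, contr, Finset.sum_comm]
  refine Finset.sum_congr rfl fun j _ => ?_
  rw [← C.h_contract_G w j, smul_eq_mul, Finset.sum_mul]
  exact Finset.sum_congr rfl fun i _ => by ring

theorem contr_right {φ : (Fin 4 → ℝ) → ℝ} (hφ : IsLinearMap ℝ φ) (w : Fin 4 → ℝ) :
    contr C.h (fun u v => φ u * C.G w v) = φ w := by
  rw [← C.contr_left hφ w, contr, contr, Finset.sum_comm]
  exact Finset.sum_congr rfl fun i _ => Finset.sum_congr rfl fun j _ => by rw [C.h_symm]; ring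

theorem exists_dual {ξ : Fin 4 → ℝ} (hξ : ξ ≠ 0) : ∃ u, C.G ξ u = 1 := by
  by_contra! hu
  refine hξ (funext fun j => ?_)
  have h0 : ∀ i, C.G ξ (e i) = 0 := fun i => by
    by_contra hi
    refine hu ((C.G ξ (e i))⁻¹ • e i) ?_
    rw [map_smul, smul_eq_mul, inv_mul_cancel₀ hi]
  rw [← C.h_contract_G ξ j]
  simp [h0]

/-- If `ξ ∧ R(·, ·, m, ξ) = 0` for all `m`, then the 1-form `B(ξ, ξ, ξ, ·)` vanishes on the
vectors orthogonal to `ξ`. This holds also where `ξ` is null. -/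
theorem belSymm_eq_zero {ξ : Fin 4 → ℝ} (hξ : ξ ≠ 0)
    (hA : ∀ a b c m, C.G ξ a * C.R b c m ξ + C.G ξ b * C.R c a m ξ + C.G ξ c * C.R a b m ξ = 0)
    {X : Fin 4 → ℝ} (hX : C.G ξ X = 0) : belSymm C.h C.G C.R ξ ξ ξ X = 0 := by
  obtain ⟨u, hu⟩ := C.exists_dual hξ
  -- `R(b, c, m, ξ) = ξ_b S(c, m) - ξ_c S(b, m)`, where `S(·, ξ) = 0`.
  let S : (Fin 4 → ℝ) → (Fin 4 → ℝ) → ℝ := fun c m => C.R u c m ξ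
  have hS : ∀ b c m, C.R b c m ξ = C.G ξ b * S c m - C.G ξ c * S b m := fun b c m => by
    have h1 := hA u b c m
    rw [hu, C.R_antisymm_left c u m ξ] at h1
    simp only [S]
    linarith
  have hSξ : ∀ c, S c ξ = 0 := fun c => C.R_self_right u c ξ
  have hSr : ∀ c, IsLinearMap ℝ fun m => S c m := fun c => by
    constructor <;> intros <;>
      simp only [S, map_add, map_smul, LinearMap.add_apply, LinearMap.smul_apply]
  have hRX : ∀ r s, C.R ξ r X s = C.G ξ s * S X r := fun r s => by
    rw [C.R_pair, C.R_antisymm_right, hS X s r, hX]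
    ring
  have h1 : sq C.h C.R ξ ξ ξ X = 0 := by
    have h2 : ∀ r r', contr C.h (fun s s' => C.R ξ r ξ s * C.R ξ r' X s') = 0 := fun r r' => by
      have h3 : ∀ s s', C.R ξ r ξ s * C.R ξ r' X s' = (S X r' * C.R ξ r ξ s) * C.G ξ s' :=
        fun s s' => by rw [hRX]; ring
      simp only [h3]
      rw [C.contr_right (φ := fun s => S X r' * C.R ξ r ξ s), C.R_self_right, mul_zero]
      constructor <;> intros <;> simp only [map_add, map_smul, smul_eq_mul] <;> ring
    simp only [sq, h2]
    simp [contr]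
  have h2 : sq C.h C.R ξ ξ X ξ = 0 := by
    have h2 : ∀ r r', contr C.h (fun s s' => C.R ξ r X s * C.R ξ r' ξ s') = 0 := fun r r' => by
      have h3 : ∀ s s', C.R ξ r X s * C.R ξ r' ξ s' = C.G ξ s * (S X r * C.R ξ r' ξ s') :=
        fun s s' => by rw [hRX]; ring
      simp only [h3]
      rw [C.contr_left (φ := fun s => S X r * C.R ξ r' ξ s), C.R_self_right, mul_zero]
      constructor <;> intros <;> simp only [map_add, map_smul, smul_eq_mul] <;> ring
    simp only [sq, h2]
    simp [contr]
  have h3 : sqLeft C.h C.R ξ X = 0 := by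
    have hzero : contr C.h (fun t t' => contr C.h fun s s' => S t s * C.R ξ t' X s') = 0 := by
      have h4 : ∀ t t', contr C.h (fun s s' => S t s * C.R ξ t' X s') = 0 := fun t t' => by
        have h5 : ∀ s s', S t s * C.R ξ t' X s' = (S X t' * S t s) * C.G ξ s' :=
          fun s s' => by rw [hRX]; ring
        simp only [h5]
        rw [C.contr_right (φ := fun s => S X t' * S t s), hSξ, mul_zero]
        exact ⟨fun x y => by rw [(hSr t).map_add, mul_add],
          fun x y => by rw [(hSr t).map_smul, smul_eq_mul, smul_eq_mul]; ring⟩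
      simp only [h4]
      simp [contr]
    have h4 : ∀ r t s r' t' s', C.R r t ξ s * C.R r' t' X s'
        = (-1 : ℝ) • (C.G ξ r * (S t s * C.R r' t' X s'))
          + C.G ξ t * (S r s * C.R r' t' X s') := fun r t s r' t' s' => by
      rw [C.R_antisymm_right r t ξ s, hS, smul_eq_mul]
      ring
    have hm : ∀ (x : ℝ) (F : (Fin 4 → ℝ) → (Fin 4 → ℝ) → ℝ),
        contr C.h (fun s s' => x * F s s') = x * contr C.h F := fun x F => contr_smul C.h x F
    simp only [sqLeft, h4, contr_add, contr_smul, hm]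
    rw [C.contr_left (φ := fun r' => contr C.h fun t t' => contr C.h fun s s' =>
      S t s * C.R r' t' X s'), hzero]
    · have h5 : ∀ r r', contr C.h (fun t t' => C.G ξ t * contr C.h fun s s' =>
          S r s * C.R r' t' X s') = (-1 : ℝ) • contr C.h fun s s' => S r s * C.R ξ r' X s' :=
        fun r r' => by
          rw [C.contr_left (φ := fun t' => contr C.h fun s s' => S r s * C.R r' t' X s'),
            ← contr_smul]
          · simp only [C.R_antisymm_left r' ξ, smul_eq_mul, mul_neg, neg_mul, one_mul]
          · constructor <;> intros <;> simp only [map_add, map_smul, LinearMap.add_apply,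
              LinearMap.smul_apply, mul_add, mul_smul_comm, contr_add, contr_smul]
      simp only [h5, contr_smul, hzero, smul_zero, add_zero]
    · constructor <;> intros <;> simp only [map_add, map_smul, LinearMap.add_apply,
        LinearMap.smul_apply, mul_add, mul_smul_comm, contr_add, contr_smul]
  simp only [belSymm, bel, h1, h2, h3, hX]
  ring

/-- If `ξ ∧ R(·, ·, m, ξ) = 0` for all `m`, then the Bel current of `ξ` is a multiple of `ξ`. -/
theorem current_eq_smul {ξ : Fin 4 → ℝ}
    (hA : ∀ a b c m, C.G ξ a * C.R b c m ξ + C.G ξ b * C.R c a m ξ + C.G ξ c * C.R a b m ξ = 0) :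
    ∃ x : ℝ, current C.h C.G C.R ξ ξ ξ = x • ξ := by
  rcases eq_or_ne ξ 0 with rfl | hξ
  · refine ⟨0, funext fun m => ?_⟩
    simp [current, (belSymm_linear₁ C.h C.G C.R 0 0 _).map_zero]
  obtain ⟨u, hu⟩ := C.exists_dual hξ
  refine ⟨belSymm C.h C.G C.R ξ ξ ξ u, funext fun m => ?_⟩
  have h1 : ∀ v, belSymm C.h C.G C.R ξ ξ ξ v = belSymm C.h C.G C.R ξ ξ ξ u * C.G ξ v := fun v => by
    have h2 := C.belSymm_eq_zero hξ hA (X := v - C.G ξ v • u) (by simp [hu])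
    rw [(belSymm_linear₄ C.h C.G C.R ξ ξ ξ).map_sub,
      (belSymm_linear₄ C.h C.G C.R ξ ξ ξ).map_smul, smul_eq_mul] at h2
    linarith
  rw [current, Pi.smul_apply, smul_eq_mul, ← C.h_contract_G ξ m, Finset.mul_sum]
  exact Finset.sum_congr rfl fun n _ => by rw [h1, C.h_symm]; ring

section Plane

variable {ξ η : Fin 4 → ℝ}

/-- The determinant of the scalar product on the plane of `ξ` and `η`. -/
def gram (ξ η : Fin 4 → ℝ) : ℝ := C.G ξ ξ * C.G η η - C.G ξ η ^ 2

/-- The first coefficient of the orthogonal projection to the plane of `ξ` and `η`. -/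
def coeff (ξ η : Fin 4 → ℝ) : (Fin 4 → ℝ) →ₗ[ℝ] ℝ :=
  (C.gram ξ η)⁻¹ • (C.G η η • C.G ξ - C.G ξ η • C.G η)

/-- The second coefficient of the orthogonal projection to the plane of `ξ` and `η`. -/
def coeff' (ξ η : Fin 4 → ℝ) : (Fin 4 → ℝ) →ₗ[ℝ] ℝ :=
  (C.gram ξ η)⁻¹ • (C.G ξ ξ • C.G η - C.G ξ η • C.G ξ)

/-- The orthogonal projection to the non-null plane of `ξ` and `η`. -/
def proj (ξ η : Fin 4 → ℝ) : (Fin 4 → ℝ) →ₗ[ℝ] (Fin 4 → ℝ) :=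
  (C.coeff ξ η).smulRight ξ + (C.coeff' ξ η).smulRight η

/-- The reflection that reverses the non-null plane of `ξ` and `η`. -/
def refl (ξ η : Fin 4 → ℝ) : (Fin 4 → ℝ) →ₗ[ℝ] (Fin 4 → ℝ) :=
  LinearMap.id - (2 : ℝ) • C.proj ξ η

theorem proj_apply (v : Fin 4 → ℝ) : C.proj ξ η v = C.coeff ξ η v • ξ + C.coeff' ξ η v • η := rfl

theorem refl_apply (v : Fin 4 → ℝ) : C.refl ξ η v = v - (2 : ℝ) • C.proj ξ η v := rfl

theorem coeff_mul (v : Fin 4 → ℝ) :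
    C.coeff ξ η v = (C.gram ξ η)⁻¹ * (C.G η η * C.G ξ v - C.G ξ η * C.G η v) := rfl

theorem coeff'_mul (v : Fin 4 → ℝ) :
    C.coeff' ξ η v = (C.gram ξ η)⁻¹ * (C.G ξ ξ * C.G η v - C.G ξ η * C.G ξ v) := rfl

theorem proj_left (hΔ : C.gram ξ η ≠ 0) : C.proj ξ η ξ = ξ := by
  have h1 : C.coeff ξ η ξ = 1 := by
    rw [coeff_mul, C.G_symm η ξ, inv_mul_eq_one₀ hΔ, gram]
    ring
  have h2 : C.coeff' ξ η ξ = 0 := by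
    rw [coeff'_mul, C.G_symm η ξ]
    ring
  rw [proj_apply, h1, h2, one_smul, zero_smul, add_zero]

theorem proj_right (hΔ : C.gram ξ η ≠ 0) : C.proj ξ η η = η := by
  have h1 : C.coeff' ξ η η = 1 := by
    rw [coeff'_mul, inv_mul_eq_one₀ hΔ, gram]
    ring
  have h2 : C.coeff ξ η η = 0 := by
    rw [coeff_mul]
    ring
  rw [proj_apply, h1, h2, one_smul, zero_smul, zero_add]

theorem G_left_sub_proj (hΔ : C.gram ξ η ≠ 0) (v : Fin 4 → ℝ) : C.G ξ (v - C.proj ξ η v) = 0 := by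
  have h1 : C.gram ξ η * C.G ξ (v - C.proj ξ η v) = 0 := by
    simp only [proj_apply, coeff_mul, coeff'_mul, map_sub, map_add, map_smul, smul_eq_mul, mul_sub,
      mul_add, ← mul_assoc, mul_inv_cancel₀ hΔ, one_mul]
    rw [gram]
    ring
  exact (mul_eq_zero.mp h1).resolve_left hΔ

theorem G_right_sub_proj (hΔ : C.gram ξ η ≠ 0) (v : Fin 4 → ℝ) : C.G η (v - C.proj ξ η v) = 0 := by
  have h1 : C.gram ξ η * C.G η (v - C.proj ξ η v) = 0 := by
    simp only [proj_apply, coeff_mul, coeff'_mul, map_sub, map_add, map_smul, smul_eq_mul, mul_sub,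
      mul_add, ← mul_assoc, mul_inv_cancel₀ hΔ, one_mul]
    rw [gram, C.G_symm η ξ]
    ring
  exact (mul_eq_zero.mp h1).resolve_left hΔ

theorem G_refl (hΔ : C.gram ξ η ≠ 0) (u v : Fin 4 → ℝ) :
    C.G u v = C.G (C.refl ξ η u) (C.refl ξ η v) := by
  have h1 : ∀ w v, C.G (C.proj ξ η w) (v - C.proj ξ η v) = 0 := fun w v => by
    conv_lhs => rw [C.proj_apply w]
    rw [map_add, map_smul, map_smul, LinearMap.add_apply, LinearMap.smul_apply,
      LinearMap.smul_apply, C.G_left_sub_proj hΔ, C.G_right_sub_proj hΔ, smul_zero, smul_zero,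
      add_zero]
  have h2 := h1 u v
  have h3 := h1 v u
  rw [C.G_symm] at h3
  simp only [map_sub, LinearMap.sub_apply] at h2 h3
  simp only [refl_apply, map_sub, map_smul, LinearMap.sub_apply, LinearMap.smul_apply, smul_eq_mul]
  linarith

/-- If the components of the curvature with an odd number of indices in a non-null plane vanish,
then the curvature is invariant under the reflection that reverses this plane: the components with
an even number of such indices are multiplied by `1`. -/
theorem R_refl (hΔ : C.gram ξ η ≠ 0)
    (h₁ : ∀ X Y Z, C.G ξ X = 0 → C.G η X = 0 → C.G ξ Y = 0 → C.G η Y = 0 → C.G ξ Z = 0 →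
      C.G η Z = 0 → C.R X Y Z ξ = 0 ∧ C.R X Y Z η = 0)
    (h₃ : ∀ X, C.G ξ X = 0 → C.G η X = 0 → C.R ξ η ξ X = 0 ∧ C.R ξ η η X = 0)
    (a b c d : Fin 4 → ℝ) :
    C.R a b c d = C.R (C.refl ξ η a) (C.refl ξ η b) (C.refl ξ η c) (C.refl ξ η d) := by
  have o₁ : ∀ a b c d, C.R (a - C.proj ξ η a) (b - C.proj ξ η b) (c - C.proj ξ η c)
      (C.proj ξ η d) = 0 := fun a b c d => by
    have h := h₁ _ _ _ (C.G_left_sub_proj hΔ a) (C.G_right_sub_proj hΔ a) (C.G_left_sub_proj hΔ b)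
      (C.G_right_sub_proj hΔ b) (C.G_left_sub_proj hΔ c) (C.G_right_sub_proj hΔ c)
    rw [C.proj_apply d, map_add, map_smul, map_smul, h.1, h.2]
    simp
  have o₃ : ∀ a b c d, C.R (C.proj ξ η a) (C.proj ξ η b) (C.proj ξ η c)
      (d - C.proj ξ η d) = 0 := fun a b c d => by
    have h := h₃ _ (C.G_left_sub_proj hΔ d) (C.G_right_sub_proj hΔ d)
    set X := d - C.proj ξ η d
    simp only [proj_apply, map_add, map_smul, LinearMap.add_apply, LinearMap.smul_apply,
      C.R_self_left, C.R_antisymm_left η ξ, h.1, h.2]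
    simp
  have o₁' : ∀ a b c d, C.R (a - C.proj ξ η a) (b - C.proj ξ η b) (C.proj ξ η c)
      (d - C.proj ξ η d) = 0 := fun a b c d => by rw [C.R_antisymm_right, o₁, neg_zero]
  have o₃' : ∀ a b c d, C.R (C.proj ξ η a) (C.proj ξ η b) (c - C.proj ξ η c)
      (C.proj ξ η d) = 0 := fun a b c d => by rw [C.R_antisymm_right, o₃, neg_zero]
  have e₁ := o₁ a b c d
  have e₂ := o₁' a b c d
  have e₃ := o₁ c d a b
  have e₄ := o₁' c d a b
  have e₅ := o₃ a b c d
  have e₆ := o₃' a b c d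
  have e₇ := o₃ c d a b
  have e₈ := o₃' c d a b
  rw [C.R_pair] at e₃ e₄ e₇ e₈
  simp only [form4_sub, map_sub, LinearMap.sub_apply] at e₁ e₂ e₃ e₄ e₅ e₆ e₇ e₈
  simp only [refl_apply, form4_sub, map_sub, map_smul, LinearMap.sub_apply, LinearMap.smul_apply,
    smul_eq_mul]
  linarith

/-- If the components of the curvature with an odd number of indices in a non-null plane vanish,
then the Bel currents of vectors in this plane lie in this plane. -/
theorem current_mem_plane (hΔ : C.gram ξ η ≠ 0)
    (h₁ : ∀ X Y Z, C.G ξ X = 0 → C.G η X = 0 → C.G ξ Y = 0 → C.G η Y = 0 → C.G ξ Z = 0 →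
      C.G η Z = 0 → C.R X Y Z ξ = 0 ∧ C.R X Y Z η = 0)
    (h₃ : ∀ X, C.G ξ X = 0 → C.G η X = 0 → C.R ξ η ξ X = 0 ∧ C.R ξ η η X = 0)
    {X Y Z : Fin 4 → ℝ} (hX : C.proj ξ η X = X) (hY : C.proj ξ η Y = Y) (hZ : C.proj ξ η Z = Z) :
    ∃ x y : ℝ, current C.h C.G C.R X Y Z = x • ξ + y • η := by
  have hq : ∀ X, C.proj ξ η X = X → C.refl ξ η X = -X := fun X hX => by
    rw [refl_apply, hX, two_smul]
    abel
  have h1 := current_comp (q := C.refl ξ η) (H := C.h) (H' := C.h)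
    (inverse_comp C.h_mul C.h_mul (fun i j => by
      rw [← G, ← C.G_refl hΔ, G, form2_e])) (C.G_refl hΔ) (C.R_refl hΔ h₁ h₃) X Y Z
  rw [hq X hX, hq Y hY, hq Z hZ] at h1
  have h2 : current C.h C.G C.R (-X) (-Y) (-Z) = -current C.h C.G C.R X Y Z := by
    ext m
    simp only [current, (belSymm_linear₁ C.h C.G C.R _ _ _).map_neg,
      (belSymm_linear₂ C.h C.G C.R _ _ _).map_neg, (belSymm_linear₃ C.h C.G C.R _ _ _).map_neg,
      Pi.neg_apply, neg_neg, mul_neg, Finset.sum_neg_distrib]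
  rw [h2, refl_apply] at h1
  have h3 : current C.h C.G C.R X Y Z = C.proj ξ η (current C.h C.G C.R X Y Z) := by
    ext m
    have h4 := congrFun h1 m
    simp only [Pi.sub_apply, Pi.smul_apply, Pi.neg_apply, smul_eq_mul] at h4
    linarith
  exact ⟨_, _, h3.trans (C.proj_apply _)⟩

/-- The curvature of a spacetime with two commuting Killing vector fields with integrable
orthogonal planes: at a point where their plane is not null, the components with an odd number of
indices in this plane vanish. Here `K` and `L` are the covariant derivatives of the fields. -/
theorem odd_components_eq_zero (hΔ : C.gram ξ η ≠ 0) {K L : Form2 ℝ}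
    (hK : ∀ u v, K u v = -K v u) (hL : ∀ u v, L u v = -L v u) (hKL : ∀ v, L ξ v = K η v)
    (hcomm : ∀ c b, contr C.h (fun u v => K c u * L v b - L c u * K v b)
      + (C.R η c ξ b - C.R ξ c η b) = 0)
    (hWK : ∀ a b c d, wedge (C.G ξ) (C.G η) (fun u v => K u v) a b c d = 0)
    (hWL : ∀ a b c d, wedge (C.G ξ) (C.G η) (fun u v => L u v) a b c d = 0)
    (hDK : ∀ m a b c d, wedge (K m) (C.G η) (fun u v => K u v) a b c d
      + wedge (C.G ξ) (L m) (fun u v => K u v) a b c d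
      + wedge (C.G ξ) (C.G η) (fun u v => C.R ξ m u v) a b c d = 0)
    (hDL : ∀ m a b c d, wedge (K m) (C.G η) (fun u v => L u v) a b c d
      + wedge (C.G ξ) (L m) (fun u v => L u v) a b c d
      + wedge (C.G ξ) (C.G η) (fun u v => C.R η m u v) a b c d = 0) :
    (∀ X Y Z, C.G ξ X = 0 → C.G η X = 0 → C.G ξ Y = 0 → C.G η Y = 0 → C.G ξ Z = 0 →
      C.G η Z = 0 → C.R X Y Z ξ = 0 ∧ C.R X Y Z η = 0) ∧
    ∀ X, C.G ξ X = 0 → C.G η X = 0 → C.R ξ η ξ X = 0 ∧ C.R ξ η η X = 0 := by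
  have hK0 : ∀ v, K v v = 0 := fun v => by linarith [hK v v]
  have hL0 : ∀ v, L v v = 0 := fun v => by linarith [hL v v]
  have hgram : ∀ x : ℝ, C.gram ξ η * x = 0 → x = 0 := fun x hx =>
    (mul_eq_zero.mp hx).resolve_left hΔ
  have hKp : ∀ X Y, C.G ξ X = 0 → C.G η X = 0 → C.G ξ Y = 0 → C.G η Y = 0 → K X Y = 0 :=
    fun X Y h1 h2 h3 h4 => hgram _ <| by
      have h := hWK ξ η X Y
      rw [wedge, h1, h2, h3, h4, C.G_symm η ξ] at h
      rw [gram]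
      linarith
  have hLp : ∀ X Y, C.G ξ X = 0 → C.G η X = 0 → C.G ξ Y = 0 → C.G η Y = 0 → L X Y = 0 :=
    fun X Y h1 h2 h3 h4 => hgram _ <| by
      have h := hWL ξ η X Y
      rw [wedge, h1, h2, h3, h4, C.G_symm η ξ] at h
      rw [gram]
      linarith
  -- The derivatives of the fields along the plane are orthogonal to the plane.
  have hKξη : K ξ η = 0 := by linarith [hK ξ η, hKL ξ, hL0 ξ]
  have hLξη : L ξ η = 0 := by linarith [hKL η, hK0 η]
  refine ⟨fun X Y Z h1 h2 h3 h4 h5 h6 => ⟨?_, ?_⟩, fun X h1 h2 => ?_⟩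
  · rw [C.R_pair, C.R_antisymm_left, neg_eq_zero]
    refine hgram _ ?_
    have h := hDK Z ξ η X Y
    simp only [wedge, h1, h2, h3, h4, hKp _ _ h5 h6 h1 h2, hKp _ _ h5 h6 h3 h4,
      hKp _ _ h1 h2 h3 h4, hLp _ _ h5 h6 h1 h2, hLp _ _ h5 h6 h3 h4, C.G_symm η ξ] at h
    rw [gram]
    linarith
  · rw [C.R_pair, C.R_antisymm_left, neg_eq_zero]
    refine hgram _ ?_
    have h := hDL Z ξ η X Y
    simp only [wedge, h1, h2, h3, h4, hKp _ _ h5 h6 h1 h2, hKp _ _ h5 h6 h3 h4,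
      hLp _ _ h1 h2 h3 h4, hLp _ _ h5 h6 h1 h2, hLp _ _ h5 h6 h3 h4, C.G_symm η ξ] at h
    rw [gram]
    linarith
  · -- The 1-forms `K(X, ·)` and `L(X, ·)` vanish on the orthogonal plane.
    have hdec : ∀ F : Form2 ℝ, (∀ Y, C.G ξ Y = 0 → C.G η Y = 0 → F X Y = 0) → ∀ u, F X u
        = C.G ξ u * ((C.gram ξ η)⁻¹ * (C.G η η * F X ξ - C.G ξ η * F X η))
          + C.G η u * ((C.gram ξ η)⁻¹ * (C.G ξ ξ * F X η - C.G ξ η * F X ξ)) := fun F hF u => by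
      have h := hF _ (C.G_left_sub_proj hΔ u) (C.G_right_sub_proj hΔ u)
      rw [map_sub, sub_eq_zero] at h
      rw [h, proj_apply, map_add, map_smul, map_smul, coeff_mul, coeff'_mul, smul_eq_mul,
        smul_eq_mul]
      ring
    have hK' := hdec K fun Y h3 h4 => hKp X Y h1 h2 h3 h4
    have hL' := hdec L fun Y h3 h4 => hLp X Y h1 h2 h3 h4
    have hz : ∀ F F' : Form2 ℝ, (∀ Y, C.G ξ Y = 0 → C.G η Y = 0 → F X Y = 0) → ∀ w,
        F' ξ w = 0 → F' η w = 0 → contr C.h (fun u v => F X u * F' v w) = 0 :=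
      fun F F' hF w h3 h4 => by
        have h5 : ∀ x : ℝ, IsLinearMap ℝ fun v => x * F' v w := fun x => by
          constructor <;> intros <;>
            simp only [map_add, map_smul, LinearMap.add_apply, LinearMap.smul_apply, smul_eq_mul]
            <;> ring
        have h6 := hdec F hF
        have h7 : ∀ u v, F X u * F' v w
          = C.G ξ u * (((C.gram ξ η)⁻¹ * (C.G η η * F X ξ - C.G ξ η * F X η)) * F' v w)
          + C.G η u * (((C.gram ξ η)⁻¹ * (C.G ξ ξ * F X η - C.G ξ η * F X ξ)) * F' v w) :=
          fun u v => by
            rw [h6]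
            ring
        simp only [h7, contr_add]
        rw [C.contr_left (h5 _), C.contr_left (h5 _), h3, h4]
        ring
    have hp : ∀ w, K ξ w = 0 → K η w = 0 → L ξ w = 0 → L η w = 0 → C.R ξ η w X = 0 :=
      fun w h3 h4 h5 h6 => by
        have h7 := hcomm X w
        have h8 : ∀ u v, K X u * L v w - L X u * K v w
            = K X u * L v w + (-1 : ℝ) • (L X u * K v w) := fun u v => by
          rw [smul_eq_mul]
          ring
        simp only [h8, contr_add, contr_smul] at h7
        rw [hz K L (fun Y h9 h10 => hKp X Y h1 h2 h9 h10) w h5 h6,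
          hz L K (fun Y h9 h10 => hLp X Y h1 h2 h9 h10) w h3 h4] at h7
        have h9 := C.R_cyclic η X ξ w
        have h10 := C.R_pair η w X ξ
        rw [C.R_antisymm_left X ξ η w] at h10
        have h11 := C.R_antisymm_right η ξ w X
        have h12 := C.R_antisymm_left ξ η w X
        simp only [smul_zero] at h7
        linarith
    exact ⟨hp ξ (hK0 ξ) (by linarith [hK η ξ]) (hL0 ξ) (by linarith [hL η ξ]),
      hp η hKξη (hK0 η) hLξη (hL0 η)⟩

end Plane

end CurvatureAt

end BelAlgebra
end

/-! ### The Bel current of Killing fields and its divergence -/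

open DualNumber BelAlgebra

noncomputable section

namespace MetricRing

variable {A : Type*} [CommRing A] [Algebra ℝ A] (S : MetricRing A) (ev : A →ₐ[ℝ] ℝ)

/-- The values of the metric and of the curvature at a point. -/
def curvatureAt : CurvatureAt where
  g i j := ev (S.g i j)
  g_symm i j := by rw [S.g_symm]
  h i j := ev (S.h i j)
  h_mul i j := by
    have h1 := congrArg ev (S.h_mul i j)
    simpa only [map_sum, map_mul, apply_ite ev, map_one, map_zero] using h1
  h_symm i j := by rw [S.h_symm]
  riem a b c d := ev (S.riem a b c d)
  antisymm_left a b c d := by rw [S.riem_antisymm_left, map_neg]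
  antisymm_right a b c d := by rw [S.riem_antisymm_right, map_neg]
  pair a b c d := by rw [S.riem_pair]
  cyclic a b c d := by rw [← map_add, ← map_add, S.riem_cyclic, map_zero]

/-- The value of a vector field at a point. -/
def value (X : Fin 4 → A) : Fin 4 → ℝ := fun i => ev (X i)

theorem belCurrent_value (X Y Z : Fin 4 → A) (i : Fin 4) : ev (S.belCurrent X Y Z i)
    = current (S.curvatureAt ev).h (S.curvatureAt ev).G (S.curvatureAt ev).R (value ev X)
      (value ev Y) (value ev Z) i :=
  (current_map ev S.h S.g S.riem X Y Z i).symm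

theorem G_value (X : Fin 4 → A) (a : Fin 4) :
    (S.curvatureAt ev).G (value ev X) (e a) = ev (S.lower X a) := by
  simp only [CurvatureAt.G, form2_apply, curvatureAt, value, lower, map_sum, map_mul,
    Pi.single_apply, mul_ite, mul_one, mul_zero, ite_mul, zero_mul, Finset.sum_ite_eq',
    Finset.mem_univ, if_true]
  exact Finset.sum_congr rfl fun i _ => by rw [S.g_symm i a, mul_comm]

theorem G_value_value (X Y : Fin 4 → A) : (S.curvatureAt ev).G (value ev X) (value ev Y)
    = ev (∑ i, ∑ j, S.g i j * X i * Y j) := by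
  simp only [CurvatureAt.G, form2_apply, curvatureAt, value, map_sum, map_mul]
  exact Finset.sum_congr rfl fun i _ => Finset.sum_congr rfl fun j _ => by ring

variable {S ev} {ξ η : Fin 4 → A}

theorem Killing.R_value (hξ : S.Killing ξ) (c a b : Fin 4) :
    (S.curvatureAt ev).R (value ev ξ) (e c) (e a) (e b) = ev (S.cov2 ξ c a b) := by
  rw [hξ.cov2_eq, linear_expand (f := fun u => (S.curvatureAt ev).R u (e c) (e a) (e b))
    ⟨by simp, by simp⟩]
  simp only [CurvatureAt.R, form4_e, curvatureAt, value, map_sum, map_mul, smul_eq_mul]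
  exact Finset.sum_congr rfl fun i _ => mul_comm _ _

/-- `F ∧ F = 0` for a 2-form `F` that is divisible by a nonzero 1-form `l`. -/
theorem pfaffian_eq_zero {l : Fin 4 → ℝ} {F : Fin 4 → Fin 4 → ℝ} (hF : ∀ a b, F a b = -F b a)
    (hW : ∀ a b c, l a * F b c + l b * F c a + l c * F a b = 0) {f : Fin 4} (hf : l f ≠ 0)
    (m a b c : Fin 4) : F m a * F b c + F m b * F c a + F m c * F a b = 0 := by
  have h1 : ∀ b c, l f * F b c = l b * F f c - l c * F f b := fun b c => by
    linarith [hW f b c, hF c f, mul_comm (l b) (F c f), congrArg (l b * ·) (hF c f)]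
  have h2 : l f * l f * (F m a * F b c + F m b * F c a + F m c * F a b) = 0 := by
    linear_combination l f * F m a * h1 b c + (l b * F f c - l c * F f b) * h1 m a
      + l f * F m b * h1 c a + (l c * F f a - l a * F f c) * h1 m b
      + l f * F m c * h1 a b + (l a * F f b - l b * F f a) * h1 m c
  exact (mul_eq_zero.mp h2).resolve_left (mul_ne_zero hf hf)

/-- The Bel current of a hypersurface-orthogonal Killing vector field is a multiple of the field. -/
theorem Killing.belCurrent_eq_smul (hξ : S.Killing ξ)
    (hW : ∀ a b c, S.lower ξ a * S.cov ξ b c + S.lower ξ b * S.cov ξ c a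
      + S.lower ξ c * S.cov ξ a b = 0) :
    ∃ x : ℝ, ∀ i, ev (S.belCurrent ξ ξ ξ i) = x * ev (ξ i) := by
  set C := S.curvatureAt ev with hC
  suffices h : ∃ x : ℝ, current C.h C.G C.R (value ev ξ) (value ev ξ) (value ev ξ)
      = x • value ev ξ by
    obtain ⟨x, hx⟩ := h
    exact ⟨x, fun i => by rw [belCurrent_value, ← hC, hx]; rfl⟩
  rcases eq_or_ne (value ev ξ) 0 with h0 | h0
  · exact C.current_eq_smul (by simp [h0])
  obtain ⟨f, hf⟩ : ∃ f, ev (S.lower ξ f) ≠ 0 := by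
    by_contra! hf
    obtain ⟨u, hu⟩ := C.exists_dual h0
    rw [linear_expand (LinearMap.isLinear (C.G (value ev ξ))) u] at hu
    simp [hC, G_value, hf] at hu
  have hpf := pfaffian_eq_zero (l := fun a => ev (S.lower ξ a)) (F := fun a b => ev (S.cov ξ a b))
    (fun a b => by rw [hξ.cov_antisymm, map_neg])
    (fun a b c => by simpa using congrArg ev (hW a b c)) hf
  refine C.current_eq_smul (multilinear_zero (f := fun a b c m => C.G (value ev ξ) a *
    C.R b c m (value ev ξ) + C.G (value ev ξ) b * C.R c a m (value ev ξ) +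
    C.G (value ev ξ) c * C.R a b m (value ev ξ)) ?_ ?_ ?_ ?_ fun a b c m => ?_)
  on_goal 5 =>
    have h1 := congrArg ev (cov_wedge hW m a b c)
    simp only [map_add, map_mul, map_zero] at h1
    have h2 : ∀ b c, C.R (e b) (e c) (e m) (value ev ξ) = -ev (S.cov2 ξ m b c) := fun b c => by
      rw [C.R_antisymm_right, C.R_pair, hC, hξ.R_value]
    have h3 := hpf m a b c
    simp only [h2]
    rw [hC, G_value, G_value, G_value]
    linarith
  all_goals
    intros; constructor <;> intros <;>
      simp only [map_add, map_smul, LinearMap.add_apply, LinearMap.smul_apply, smul_eq_mul] <;> ring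

/-- The Bel currents of two commuting Killing vector fields with integrable orthogonal planes are
linear combinations of these fields, where their plane is not null. -/
theorem Killing.belCurrent_mem_plane (hξ : S.Killing ξ) (hη : S.Killing η)
    (hC : ∀ i, S.along ξ (η i) = S.along η (ξ i))
    (hWξ : ∀ a b c d, wedge (S.lower ξ) (S.lower η) (S.cov ξ) a b c d = 0)
    (hWη : ∀ a b c d, wedge (S.lower ξ) (S.lower η) (S.cov η) a b c d = 0)
    (hΔ : (S.curvatureAt ev).gram (value ev ξ) (value ev η) ≠ 0) {X Y Z : Fin 4 → A}
    (hX : X = ξ ∨ X = η) (hY : Y = ξ ∨ Y = η) (hZ : Z = ξ ∨ Z = η) :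
    ∃ x y : ℝ, ∀ i, ev (S.belCurrent X Y Z i) = x * ev (ξ i) + y * ev (η i) := by
  set C := S.curvatureAt ev with hCdef
  set x := value ev ξ with hx
  set y := value ev η with hy
  set K : Form2 ℝ := form2 fun a b => ev (S.cov ξ a b) with hKdef
  set L : Form2 ℝ := form2 fun a b => ev (S.cov η a b) with hLdef
  have hp : ∀ X, X = ξ ∨ X = η → C.proj x y (value ev X) = value ev X := by
    rintro X (rfl | rfl)
    · exact C.proj_left hΔ
    · exact C.proj_right hΔ
  have hanti : ∀ {ζ : Fin 4 → A}, S.Killing ζ → ∀ u v,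
      form2 (fun a b => ev (S.cov ζ a b)) u v = -form2 (fun a b => ev (S.cov ζ a b)) v u :=
    fun {ζ} hζ u v => by
      simp only [form2_apply]
      rw [Finset.sum_comm, ← Finset.sum_neg_distrib]
      refine Finset.sum_congr rfl fun i _ => ?_
      rw [← Finset.sum_neg_distrib]
      refine Finset.sum_congr rfl fun j _ => ?_
      rw [hζ.cov_antisymm, map_neg]
      ring
  have hKL : ∀ v, L x v = K y v := linear_ext (LinearMap.isLinear _) (LinearMap.isLinear _)
    fun b => by
      rw [linear_expand (f := fun u => L u (e b)) ⟨by simp, by simp⟩,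
        linear_expand (f := fun u => K u (e b)) ⟨by simp, by simp⟩]
      simpa [hLdef, hKdef, hx, hy, value] using congrArg ev (cov_of_commute hC b)
  have hcomm : ∀ c b, contr C.h (fun u v => K c u * L v b - L c u * K v b)
      + (C.R y c x b - C.R x c y b) = 0 := by
    have h0 : IsLinearMap ℝ fun _ : Fin 4 → ℝ => (0 : ℝ) := ⟨by simp, by simp⟩
    have hs : ∀ c b, contr C.h (fun u v => K c u * L v b - L c u * K v b)
        = contr C.h (fun u v => K c u * L v b) + (-1 : ℝ) • contr C.h (fun u v => L c u * K v b) :=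
      fun c b => by
        rw [← contr_smul, ← contr_add]
        simp only [sub_eq_add_neg, neg_smul, one_smul]
    intro c b
    refine linear_ext (f := fun c => contr C.h (fun u v => K c u * L v b - L c u * K v b)
      + (C.R y c x b - C.R x c y b)) ?_ h0 (fun c => linear_ext (f := fun b =>
      contr C.h (fun u v => K (e c) u * L v b - L (e c) u * K v b)
      + (C.R y (e c) x b - C.R x (e c) y b)) ?_ h0 (fun b => ?_) b) c
    · simp only [hs]
      constructor <;> intros <;>
        simp only [map_add, map_smul, LinearMap.add_apply, LinearMap.smul_apply, add_mul,
          smul_mul_assoc, contr_add, contr_smul] <;> simp only [smul_eq_mul] <;> ring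
    · simp only [hs]
      constructor <;> intros <;>
        simp only [map_add, map_smul, mul_add, mul_smul_comm, contr_add, contr_smul] <;>
        simp only [smul_eq_mul] <;> ring
    · have h1 := congrArg ev (cov2_of_commute hC c b)
      have h2 : C.R y (e c) x (e b) = ∑ a, ev (ξ a) * ev (S.cov2 η c a b) := by
        rw [linear_expand (f := fun u => C.R y (e c) u (e b)) ⟨by simp, by simp⟩ x]
        simp only [hCdef, hy, hη.R_value, smul_eq_mul]
        rfl
      have h3 : C.R x (e c) y (e b) = ∑ a, ev (η a) * ev (S.cov2 ξ c a b) := by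
        rw [linear_expand (f := fun u => C.R x (e c) u (e b)) ⟨by simp, by simp⟩ y]
        simp only [hCdef, hx, hξ.R_value, smul_eq_mul]
        rfl
      rw [h2, h3, contr, ← Finset.sum_sub_distrib]
      simp only [hKdef, hLdef, form2_e]
      rw [Finset.sum_comm]
      have h4 : ∀ i j, C.h j i = ev (S.h i j) := fun i j => C.h_symm j i
      simp only [h4]
      simpa using h1
  have hwedge : ∀ {ζ : Fin 4 → A},
      (∀ a b c d, wedge (S.lower ξ) (S.lower η) (S.cov ζ) a b c d = 0) → ∀ a b c d,
      wedge (C.G x) (C.G y) (fun u v => form2 (fun a b => ev (S.cov ζ a b)) u v) a b c d = 0 := by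
    intro ζ hζ
    refine multilinear_zero ?_ ?_ ?_ ?_ fun a b c d => ?_
    on_goal 5 =>
      have h1 := congrArg ev (hζ a b c d)
      simp only [wedge, form2_e, hCdef, hx, hy, G_value]
      simpa [wedge] using h1
    all_goals
      intros; constructor <;> intros <;>
        simp only [wedge, map_add, map_smul, LinearMap.add_apply, LinearMap.smul_apply,
          smul_eq_mul] <;> ring
  have hDwedge : ∀ {ζ : Fin 4 → A}, S.Killing ζ →
      (∀ a b c d, wedge (S.lower ξ) (S.lower η) (S.cov ζ) a b c d = 0) → ∀ m a b c d,
      wedge (K m) (C.G y) (fun u v => form2 (fun a b => ev (S.cov ζ a b)) u v) a b c d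
      + wedge (C.G x) (L m) (fun u v => form2 (fun a b => ev (S.cov ζ a b)) u v) a b c d
      + wedge (C.G x) (C.G y) (fun u v => C.R (value ev ζ) m u v) a b c d = 0 := by
    intro ζ hζ hW m a b c d
    refine linear_ext (f := fun m =>
      wedge (K m) (C.G y) (fun u v => form2 (fun a b => ev (S.cov ζ a b)) u v) a b c d
      + wedge (C.G x) (L m) (fun u v => form2 (fun a b => ev (S.cov ζ a b)) u v) a b c d
      + wedge (C.G x) (C.G y) (fun u v => C.R (value ev ζ) m u v) a b c d) (f' := fun _ => 0) ?_
      ⟨by simp, by simp⟩ (fun m => ?_) m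
    · constructor <;> intros <;>
        simp only [wedge, map_add, map_smul, LinearMap.add_apply, LinearMap.smul_apply,
          smul_eq_mul] <;> ring
    revert a b c d
    refine multilinear_zero ?_ ?_ ?_ ?_ fun a b c d => ?_
    on_goal 5 =>
      have h1 := congrArg ev (cov_wedge_wedge hW m a b c d)
      simp only [wedge, form2_e, hCdef, hx, hy, hKdef, hLdef, G_value, hζ.R_value]
      simpa [wedge] using h1
    all_goals
      intros; constructor <;> intros <;>
        simp only [wedge, map_add, map_smul, LinearMap.add_apply, LinearMap.smul_apply,
          smul_eq_mul] <;> ring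
  obtain ⟨h₁, h₃⟩ := C.odd_components_eq_zero hΔ (hanti hξ) (hanti hη) hKL hcomm (hwedge hWξ)
    (hwedge hWη) (hDwedge hξ hWξ) (hDwedge hη hWη)
  obtain ⟨s, t, hst⟩ := C.current_mem_plane hΔ h₁ h₃ (hp X hX) (hp Y hY) (hp Z hZ)
  exact ⟨s, t, fun i => by rw [belCurrent_value, ← hCdef, hst]; rfl⟩

/-- A multiple of a Killing vector field `ξ` that is invariant along `ξ` is divergence-free, where
`ξ` does not vanish. -/
theorem Killing.smul_div_eq_zero (hξ : S.Killing ξ) {j : Fin 4 → A}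
    (hj : ∀ i, S.along ξ (j i) = S.along j (ξ i)) (hp : ∀ i m, ξ i * j m = j i * ξ m) (i : Fin 4) :
    ξ i * S.div j = 0 := by
  have h1 := S.div_smul (ξ i) j
  rw [funext (hp i), S.div_smul, hξ.div_eq_zero, hj] at h1
  linear_combination -h1

/-- The divergence of the Bel current of `ξ` vanishes where `ξ` vanishes. -/
theorem div_belCurrent_of_zero (S : MetricRing A) (h0 : ∀ i, ev (ξ i) = 0) :
    ev (S.div (S.belCurrent ξ ξ ξ)) = 0 := by
  set B := BelAlgebra.belSymm S.h (form2 S.g) (form4 S.riem) with hB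
  have h1 : ∀ a n, ev (B (e a) ξ ξ (e n)) = 0 := fun a n => by
    rw [hB, linear_expand
      (BelAlgebra.belSymm_linear₂ S.h (form2 S.g) (form4 S.riem) (e a) ξ (e n)) ξ, map_sum]
    exact Finset.sum_eq_zero fun b _ => by rw [smul_eq_mul, map_mul, h0, zero_mul]
  have h2 : ∀ n, B ξ ξ ξ (e n) = ∑ a, ξ a * B (e a) ξ ξ (e n) := fun n =>
    linear_expand (BelAlgebra.belSymm_linear₁ S.h (form2 S.g) (form4 S.riem) ξ ξ (e n)) ξ
  have h3 : ∀ n, ev (B ξ ξ ξ (e n)) = 0 := fun n => by simp [h2, h0]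
  -- Each term of the derivative of an expression cubic in `ξ` keeps an undifferentiated factor.
  have h4 : ∀ i n, ev (S.D i (B ξ ξ ξ (e n))) = 0 := fun i n => by
    simp [h2, h0, h1]
  simp [div, belCurrent, current, ← hB, h3, h4]

/-- A combination of commuting Killing vector fields `ξ` and `η` that is invariant along both is
divergence-free, where `ξ` and `η` are independent. -/
theorem Killing.minor_div_eq_zero (hξ : S.Killing ξ) (hη : S.Killing η)
    (hC : ∀ i, S.along ξ (η i) = S.along η (ξ i)) {j : Fin 4 → A}
    (hjξ : ∀ i, S.along ξ (j i) = S.along j (ξ i)) (hjη : ∀ i, S.along η (j i) = S.along j (η i))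
    (hp : ∀ a b c, (ξ b * η c - ξ c * η b) * j a = (j c * ξ b - j b * ξ c) * η a
      - (j c * η b - j b * η c) * ξ a) (b c : Fin 4) :
    (ξ b * η c - ξ c * η b) * S.div j = 0 := by
  have h1 := S.div_smul (ξ b * η c - ξ c * η b) j
  rw [funext fun a => hp a b c, S.div_sub, S.div_smul, S.div_smul, hξ.div_eq_zero,
    hη.div_eq_zero] at h1
  simp only [map_sub, Derivation.leibniz, smul_eq_mul, hjξ, hjη, hC] at h1
  linear_combination -h1

/-- Vectors that span a non-null plane are independent. -/
theorem exists_minor_ne_zero (hΔ : (S.curvatureAt ev).gram (value ev ξ) (value ev η) ≠ 0) :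
    ∃ b c, ev (ξ b * η c - ξ c * η b) ≠ 0 := by
  by_contra! h0
  set C := S.curvatureAt ev
  set x := value ev ξ with hx
  set y := value ev η with hy
  have h1 : ∀ b, x b • y = y b • x := fun b => funext fun c => by
    have h2 := h0 b c
    simp only [map_sub, map_mul] at h2
    simp only [hx, hy, value, Pi.smul_apply, smul_eq_mul]
    linarith
  have h2 : x = 0 := funext fun b => by
    have h3 := congrArg (fun v => C.G v y) (h1 b)
    have h4 := congrArg (fun v => C.G v x) (h1 b)
    simp only [map_smul, LinearMap.smul_apply, smul_eq_mul, C.G_symm y x] at h3 h4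
    have h5 : C.gram x y * x b = 0 := by
      rw [CurvatureAt.gram]
      linear_combination C.G x x * h3 - C.G x y * h4
    exact (mul_eq_zero.mp h5).resolve_left hΔ
  exact hΔ (by simp [CurvatureAt.gram, h2])

end MetricRing
end

/-! ### The ring of smooth functions on a coordinate domain -/

open DualNumber BelAlgebra

noncomputable section

open Topology

/-- The extension by zero of a function on a subset of the coordinate space. -/
def extendZero {U : Set Coord.Space} (f : U → ℝ) : Coord.Space → ℝ :=
  Function.extend Subtype.val f 0

theorem extendZero_apply {U : Set Coord.Space} (f : U → ℝ) (x : U) : extendZero f x = f x :=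
  Subtype.val_injective.extend_apply f 0 x

/-- The ring of smooth functions on a subset of the coordinate space. Its elements are functions on
the subset, so that equality is equality there; smoothness is that of the extension by zero. -/
def smoothRing (U : Set Coord.Space) : Subalgebra ℝ (U → ℝ) where
  carrier := {f | ContDiffOn ℝ ∞ (extendZero f) U}
  mul_mem' {f g} hf hg := (hf.mul hg).congr fun x hx => by
    simpa using (extendZero_apply (f * g) ⟨x, hx⟩).trans (congrArg₂ (· * ·)
      (extendZero_apply f ⟨x, hx⟩).symm (extendZero_apply g ⟨x, hx⟩).symm)
  add_mem' {f g} hf hg := (hf.add hg).congr fun x hx => by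
    simpa using (extendZero_apply (f + g) ⟨x, hx⟩).trans (congrArg₂ (· + ·)
      (extendZero_apply f ⟨x, hx⟩).symm (extendZero_apply g ⟨x, hx⟩).symm)
  algebraMap_mem' r := (contDiffOn_const (c := r)).congr fun x hx =>
    extendZero_apply (algebraMap ℝ (U → ℝ) r) ⟨x, hx⟩

/-- The function `F` on the coordinate space restricts to the element `f` of the ring of smooth
functions. -/
def Represents {U : Set Coord.Space} (F : Coord.Space → ℝ) (f : smoothRing U) : Prop :=
  ∀ x : U, F x = f.1 x

/-- Evaluation at a point. -/
def evalAt {U : Set Coord.Space} (x : U) : smoothRing U →ₐ[ℝ] ℝ :=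
  (Pi.evalAlgHom ℝ (fun _ : U => ℝ) x).comp (smoothRing U).val

theorem evalAt_apply {U : Set Coord.Space} (x : U) (f : smoothRing U) : evalAt x f = f.1 x := rfl

theorem smoothRing_ext {U : Set Coord.Space} {f g : smoothRing U}
    (h : ∀ x, evalAt x f = evalAt x g) : f = g :=
  Subtype.ext (funext h)

/-- The restriction of a smooth function. -/
def smoothRestrict {U : Set Coord.Space} (F : Coord.Space → ℝ) (hF : ContDiffOn ℝ ∞ F U) :
    smoothRing U :=
  ⟨fun x => F x, hF.congr fun x hx => extendZero_apply (fun x : U => F x) ⟨x, hx⟩⟩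

section Open

variable {U : Set Coord.Space}

theorem Represents.eventuallyEq (hU : IsOpen U) {F : Coord.Space → ℝ} {f : smoothRing U}
    (hF : Represents F f) (x : U) : F =ᶠ[𝓝 (x : Coord.Space)] extendZero f.1 := by
  filter_upwards [hU.mem_nhds x.2] with y hy
  rw [hF ⟨y, hy⟩, ← extendZero_apply f.1 ⟨y, hy⟩]

theorem smoothRing_contDiffAt (hU : IsOpen U) (f : smoothRing U) (x : U) :
    ContDiffAt ℝ ∞ (extendZero f.1) x :=
  (show ContDiffOn ℝ ∞ (extendZero f.1) U from f.2).contDiffAt (hU.mem_nhds x.2)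

theorem smoothRing_differentiableAt (hU : IsOpen U) (f : smoothRing U) (x : U) :
    DifferentiableAt ℝ (extendZero f.1) x :=
  (smoothRing_contDiffAt hU f x).differentiableAt (by simp)

theorem contDiffOn_partialDeriv (hU : IsOpen U) {F : Coord.Space → ℝ} (hF : ContDiffOn ℝ ∞ F U)
    (i : Fin 4) : ContDiffOn ℝ ∞ (fun x => Coord.partialDeriv i F x) U := by
  have h1 : ContDiffOn ℝ ∞ (fderiv ℝ F) U := hF.fderiv_of_isOpen hU (by simp)
  have h2 : ContDiffOn ℝ ∞
      (fun _ : Coord.Space => (EuclideanSpace.single i (1 : ℝ) : Coord.Space)) U := contDiffOn_const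
  exact h1.clm_apply h2

/-- The partial derivatives of smooth functions. -/
def smoothPartial (hU : IsOpen U) (i : Fin 4) : Derivation ℝ (smoothRing U) (smoothRing U) where
  toFun f :=
    smoothRestrict (Coord.partialDeriv i (extendZero f.1)) (contDiffOn_partialDeriv hU f.2 i)
  map_add' f g := smoothRing_ext fun x => by
    have h1 : extendZero (f + g).1 =ᶠ[𝓝 (x : Coord.Space)] extendZero f.1 + extendZero g.1 := by
      filter_upwards [hU.mem_nhds x.2] with y hy
      simp only [Pi.add_apply]
      rw [extendZero_apply _ ⟨y, hy⟩, extendZero_apply _ ⟨y, hy⟩, extendZero_apply _ ⟨y, hy⟩]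
      rfl
    change Coord.partialDeriv i (extendZero (f + g : smoothRing U).1) x
      = Coord.partialDeriv i (extendZero (f : smoothRing U).1) x
        + Coord.partialDeriv i (extendZero (g : smoothRing U).1) x
    unfold Coord.partialDeriv
    rw [h1.fderiv_eq, fderiv_add (smoothRing_differentiableAt hU f x)
      (smoothRing_differentiableAt hU g x)]
    rfl
  map_smul' r f := smoothRing_ext fun x => by
    have h1 : extendZero (r • f).1 =ᶠ[𝓝 (x : Coord.Space)] r • extendZero f.1 := by
      filter_upwards [hU.mem_nhds x.2] with y hy
      simp only [Pi.smul_apply]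
      rw [extendZero_apply _ ⟨y, hy⟩, extendZero_apply _ ⟨y, hy⟩]
      rfl
    change Coord.partialDeriv i (extendZero (r • f : smoothRing U).1) x
      = r * Coord.partialDeriv i (extendZero (f : smoothRing U).1) x
    unfold Coord.partialDeriv
    rw [h1.fderiv_eq, fderiv_const_smul (smoothRing_differentiableAt hU f x)]
    rfl
  map_one_eq_zero' := smoothRing_ext fun x => by
    have h1 : extendZero (1 : smoothRing U).1 =ᶠ[𝓝 (x : Coord.Space)] fun _ => 1 := by
      filter_upwards [hU.mem_nhds x.2] with y hy
      rw [extendZero_apply _ ⟨y, hy⟩]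
      rfl
    change Coord.partialDeriv i (extendZero (1 : smoothRing U).1) x = 0
    unfold Coord.partialDeriv
    rw [h1.fderiv_eq]
    simp
  leibniz' f g := smoothRing_ext fun x => by
    have h1 : extendZero (f * g).1 =ᶠ[𝓝 (x : Coord.Space)] extendZero f.1 * extendZero g.1 := by
      filter_upwards [hU.mem_nhds x.2] with y hy
      simp only [Pi.mul_apply]
      rw [extendZero_apply _ ⟨y, hy⟩, extendZero_apply _ ⟨y, hy⟩, extendZero_apply _ ⟨y, hy⟩]
      rfl
    change Coord.partialDeriv i (extendZero (f * g : smoothRing U).1) x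
      = f.1 x * Coord.partialDeriv i (extendZero (g : smoothRing U).1) x
        + g.1 x * Coord.partialDeriv i (extendZero (f : smoothRing U).1) x
    unfold Coord.partialDeriv
    rw [h1.fderiv_eq, fderiv_mul (smoothRing_differentiableAt hU f x)
      (smoothRing_differentiableAt hU g x), extendZero_apply, extendZero_apply]
    rfl

theorem Represents.partialDeriv (hU : IsOpen U) {F : Coord.Space → ℝ} {f : smoothRing U}
    (hF : Represents F f) (i : Fin 4) :
    Represents (Coord.partialDeriv i F) (smoothPartial hU i f) := fun x => by
  change fderiv ℝ _ _ _ = fderiv ℝ _ _ _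
  rw [(hF.eventuallyEq hU x).fderiv_eq]

theorem smoothPartial_comm (hU : IsOpen U) (i j : Fin 4) (f : smoothRing U) :
    smoothPartial hU i (smoothPartial hU j f) = smoothPartial hU j (smoothPartial hU i f) := by
  refine smoothRing_ext fun x => ?_
  have hf := smoothRing_contDiffAt hU f x
  have hF : Represents (extendZero f.1) f := fun x => extendZero_apply f.1 x
  have hd : DifferentiableAt ℝ (fderiv ℝ (extendZero f.1)) x :=
    (hf.fderiv_right (m := ∞) (by simp)).differentiableAt (by simp)
  have h1 : ∀ a b, evalAt x (smoothPartial hU a (smoothPartial hU b f))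
      = fderiv ℝ (fderiv ℝ (extendZero f.1)) x (EuclideanSpace.single a 1)
        (EuclideanSpace.single b 1) := fun a b => by
    rw [evalAt_apply, ← ((hF.partialDeriv hU b).partialDeriv hU a) x]
    change fderiv ℝ (fun y => fderiv ℝ (extendZero f.1) y (EuclideanSpace.single b 1)) x _ = _
    rw [fderiv_clm_apply hd (differentiableAt_const _)]
    simp
  rw [h1, h1]
  exact (hf.isSymmSndFDerivAt (by simp; exact WithTop.coe_le_coe.2 le_top)) _ _

section Represents

variable {F F' : Coord.Space → ℝ} {f f' : smoothRing U}

theorem Represents.add (hF : Represents F f) (hF' : Represents F' f') :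
    Represents (fun x => F x + F' x) (f + f') := fun x => congrArg₂ (· + ·) (hF x) (hF' x)

theorem Represents.sub (hF : Represents F f) (hF' : Represents F' f') :
    Represents (fun x => F x - F' x) (f - f') := fun x => congrArg₂ (· - ·) (hF x) (hF' x)

theorem Represents.mul (hF : Represents F f) (hF' : Represents F' f') :
    Represents (fun x => F x * F' x) (f * f') := fun x => congrArg₂ (· * ·) (hF x) (hF' x)

theorem Represents.const (r : ℝ) :
    Represents (fun _ => r) (algebraMap ℝ (smoothRing U) r) := fun _ => rfl

theorem Represents.sum {F : Fin 4 → Coord.Space → ℝ} {f : Fin 4 → smoothRing U}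
    (hF : ∀ i, Represents (F i) (f i)) : Represents (fun x => ∑ i, F i x) (∑ i, f i) := fun x => by
  change _ = evalAt x (∑ i, f i)
  rw [map_sum]
  exact Finset.sum_congr rfl fun i _ => hF i x

end Represents

theorem smoothRing_isUnit {f : smoothRing U} (hf : ∀ x, f.1 x ≠ 0) : IsUnit f := by
  have h1 : ContDiffOn ℝ ∞ (fun x => (extendZero f.1 x)⁻¹) U :=
    ContDiffOn.inv f.2 fun x hx => by
      rw [extendZero_apply f.1 ⟨x, hx⟩]
      exact hf _
  refine IsUnit.of_mul_eq_one (smoothRestrict _ h1) (smoothRing_ext fun x => ?_)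
  change f.1 x * (extendZero f.1 x)⁻¹ = 1
  rw [extendZero_apply, mul_inv_cancel₀ (hf x)]

variable {G : Coord.Space → Matrix (Fin 4) (Fin 4) ℝ}

/-- The matrix of the components of the metric, in the ring of smooth functions. -/
def metricMatrix (hG : ∀ i j, ContDiffOn ℝ ∞ (fun x => G x i j) U) :
    Matrix (Fin 4) (Fin 4) (smoothRing U) :=
  Matrix.of fun i j => smoothRestrict _ (hG i j)

theorem metricMatrix_map (hG : ∀ i j, ContDiffOn ℝ ∞ (fun x => G x i j) U) (x : U) :
    (evalAt x).mapMatrix (metricMatrix hG) = G x := rfl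

theorem metricMatrix_isUnit (hG : ∀ i j, ContDiffOn ℝ ∞ (fun x => G x i j) U)
    (hdet : ∀ x ∈ U, (G x).det ≠ 0) : IsUnit (metricMatrix hG).det := by
  refine smoothRing_isUnit fun x => ?_
  have h1 := AlgHom.map_det (evalAt x) (metricMatrix hG)
  rw [metricMatrix_map] at h1
  rw [← evalAt_apply, h1]
  exact hdet x x.2

/-- The tensor calculus of a metric in an open coordinate domain. -/
def metricRing (hU : IsOpen U) (hG : ∀ i j, ContDiffOn ℝ ∞ (fun x => G x i j) U)
    (hs : ∀ x i j, G x i j = G x j i) (hdet : ∀ x ∈ U, (G x).det ≠ 0) :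
    MetricRing (smoothRing U) where
  D := smoothPartial hU
  D_comm := smoothPartial_comm hU
  g i j := metricMatrix hG i j
  g_symm i j := smoothRing_ext fun x => hs x i j
  h i j := (metricMatrix hG)⁻¹ i j
  h_mul i j := by
    rw [← Matrix.mul_apply, Matrix.nonsing_inv_mul _ (metricMatrix_isUnit hG hdet),
      Matrix.one_apply]

end Open

section Components

variable {U : Set Coord.Space} {hU : IsOpen U} {G : Coord.Space → Matrix (Fin 4) (Fin 4) ℝ}
  {hG : ∀ i j, ContDiffOn ℝ ∞ (fun x => G x i j) U} {hs : ∀ x i j, G x i j = G x j i}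
  {hdet : ∀ x ∈ U, (G x).det ≠ 0}

theorem represents_g (i j : Fin 4) :
    Represents (fun x => G x i j) ((metricRing hU hG hs hdet).g i j) := fun _ => rfl

theorem represents_h (i j : Fin 4) :
    Represents (fun x => Coord.inv G x i j) ((metricRing hU hG hs hdet).h i j) := fun x => by
  have h1 : (evalAt x).mapMatrix (metricMatrix hG)⁻¹ * G x = 1 := by
    rw [← metricMatrix_map hG x, ← map_mul,
      Matrix.nonsing_inv_mul _ (metricMatrix_isUnit hG hdet), map_one]
  have h2 := Matrix.inv_eq_left_inv h1
  change (G x)⁻¹ i j = _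
  rw [h2]
  rfl

theorem represents_chr (k i j : Fin 4) :
    Represents (Coord.christoffel G k i j) ((metricRing hU hG hs hdet).chr k i j) := by
  have h1 : (metricRing hU hG hs hdet).chr k i j = MetricRing.half _ *
      ∑ l, (metricRing hU hG hs hdet).h k l * ((metricRing hU hG hs hdet).D i
        ((metricRing hU hG hs hdet).g j l) + (metricRing hU hG hs hdet).D j
        ((metricRing hU hG hs hdet).g i l) - (metricRing hU hG hs hdet).D l
        ((metricRing hU hG hs hdet).g i j)) := by
    rw [MetricRing.chr, Finset.mul_sum]
    exact Finset.sum_congr rfl fun l _ => by rw [MetricRing.low]; ring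
  rw [h1]
  exact (Represents.const _).mul (Represents.sum fun l => (represents_h k l).mul
    ((((represents_g j l).partialDeriv hU i).add ((represents_g i l).partialDeriv hU j)).sub
      ((represents_g i j).partialDeriv hU l)))

theorem represents_riemUp (a b c d : Fin 4) :
    Represents (Coord.riemannUp G a b c d) ((metricRing hU hG hs hdet).riemUp a b c d) :=
  (((represents_chr a d b).partialDeriv hU c).sub ((represents_chr a c b).partialDeriv hU d)).add
    (Represents.sum fun l => ((represents_chr a c l).mul (represents_chr l d b)).sub
      ((represents_chr a d l).mul (represents_chr l c b)))

theorem represents_riem (a b c d : Fin 4) :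
    Represents (Coord.riemann G a b c d) ((metricRing hU hG hs hdet).riem a b c d) :=
  Represents.sum fun l => (represents_g a l).mul (represents_riemUp l b c d)

variable {X : Coord.Space → Fin 4 → ℝ} {X' : Fin 4 → smoothRing U}

theorem represents_lower (hX : ∀ i, Represents (fun x => X x i) (X' i)) (i : Fin 4) :
    Represents (Coord.lower G X i) ((metricRing hU hG hs hdet).lower X' i) :=
  Represents.sum fun j => (represents_g i j).mul (hX j)

theorem represents_cov (hX : ∀ i, Represents (fun x => X x i) (X' i)) (i j : Fin 4) :
    Represents (Coord.covDerivLower G X i j) ((metricRing hU hG hs hdet).cov X' i j) :=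
  ((represents_lower hX j).partialDeriv hU i).sub
    (Represents.sum fun k => (represents_chr k i j).mul (represents_lower hX k))

theorem represents_dLower (hX : ∀ i, Represents (fun x => X x i) (X' i)) (i j : Fin 4) :
    Represents (Coord.dLower G X i j) ((metricRing hU hG hs hdet).cov X' i j
      - (metricRing hU hG hs hdet).cov X' j i) := by
  have h1 : (metricRing hU hG hs hdet).cov X' i j - (metricRing hU hG hs hdet).cov X' j i
      = (metricRing hU hG hs hdet).D i ((metricRing hU hG hs hdet).lower X' j)
        - (metricRing hU hG hs hdet).D j ((metricRing hU hG hs hdet).lower X' i) := by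
    simp only [MetricRing.cov, MetricRing.chr_symm _ _ i j]
    ring
  rw [h1]
  exact ((represents_lower hX j).partialDeriv hU i).sub ((represents_lower hX i).partialDeriv hU j)

theorem represents_div (hX : ∀ i, Represents (fun x => X x i) (X' i)) :
    Represents (Coord.divergence G X) ((metricRing hU hG hs hdet).div X') :=
  Represents.sum fun i => ((hX i).partialDeriv hU i).add
    (Represents.sum fun k => (represents_chr i i k).mul (hX k))

end Components

section Current

theorem sum_rotate₃ (f : Fin 4 → Fin 4 → Fin 4 → ℝ) :
    ∑ a, ∑ b, ∑ c, f a b c = ∑ c, ∑ a, ∑ b, f a b c := by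
  rw [Finset.sum_congr rfl fun a _ => Finset.sum_comm]
  exact Finset.sum_comm

theorem sum_rotate₄ (f : Fin 4 → Fin 4 → Fin 4 → Fin 4 → ℝ) :
    ∑ a, ∑ b, ∑ c, ∑ d, f a b c d = ∑ d, ∑ a, ∑ b, ∑ c, f a b c d := by
  rw [Finset.sum_congr rfl fun a _ => sum_rotate₃ (f a)]
  exact Finset.sum_comm

variable (G : Coord.Space → Matrix (Fin 4) (Fin 4) ℝ) (x : Coord.Space)

/-- The curvature at the point with coordinates `x`, as a function of four vectors. -/
def riemannForm : Form4 ℝ := form4 fun a b c d => Coord.riemann G a b c d x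

theorem riemannSq_eq (a b c d : Fin 4) : Coord.riemannSq G a b c d x
    = BelAlgebra.sq (Coord.inv G x) (riemannForm G x) (e a) (e b) (e c) (e d) := by
  simp only [Coord.riemannSq, BelAlgebra.sq, contr, riemannForm, form4_e, Finset.mul_sum]
  refine Finset.sum_congr rfl fun r _ => ?_
  rw [Finset.sum_comm]
  refine Finset.sum_congr rfl fun r' _ => Finset.sum_congr rfl fun s _ =>
    Finset.sum_congr rfl fun s' _ => ?_
  ring

theorem riemannSqLeft_eq (c d : Fin 4) : Coord.riemannSqLeft G c d x
    = sqLeft (Coord.inv G x) (riemannForm G x) (e c) (e d) := by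
  simp only [Coord.riemannSqLeft, sqLeft, contr, riemannForm, form4_e, Finset.mul_sum]
  refine Finset.sum_congr rfl fun r _ => ?_
  rw [sum_rotate₃]
  refine Finset.sum_congr rfl fun r' _ => Finset.sum_congr rfl fun t _ => ?_
  rw [Finset.sum_comm]
  refine Finset.sum_congr rfl fun t' _ => Finset.sum_congr rfl fun s _ =>
    Finset.sum_congr rfl fun s' _ => ?_
  ring

theorem riemannSqRight_eq (a b : Fin 4) : Coord.riemannSqRight G a b x
    = sqRight (Coord.inv G x) (riemannForm G x) (e a) (e b) := by
  simp only [Coord.riemannSqRight, sqRight, contr, riemannForm, form4_e, Finset.mul_sum]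
  refine Finset.sum_congr rfl fun r _ => ?_
  rw [sum_rotate₃]
  refine Finset.sum_congr rfl fun r' _ => Finset.sum_congr rfl fun t _ => ?_
  rw [Finset.sum_comm]
  refine Finset.sum_congr rfl fun t' _ => Finset.sum_congr rfl fun s _ =>
    Finset.sum_congr rfl fun s' _ => ?_
  ring

theorem riemannSqTrace_eq : Coord.riemannSqTrace G x
    = sqTrace (Coord.inv G x) (riemannForm G x) := by
  simp only [Coord.riemannSqTrace, sqTrace, contr, riemannForm, form4_e, Finset.mul_sum]
  refine Finset.sum_congr rfl fun r _ => ?_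
  rw [sum_rotate₄]
  refine Finset.sum_congr rfl fun r' _ => Finset.sum_congr rfl fun t _ => ?_
  rw [sum_rotate₃]
  refine Finset.sum_congr rfl fun t' _ => Finset.sum_congr rfl fun s _ => ?_
  rw [Finset.sum_comm]
  refine Finset.sum_congr rfl fun s' _ => Finset.sum_congr rfl fun n _ =>
    Finset.sum_congr rfl fun n' _ => ?_
  ring

theorem belSymm_eq (a b c d : Fin 4) : Coord.belSymm G a b c d x
    = belSymm (Coord.inv G x) (form2 (G x)) (riemannForm G x) (e a) (e b) (e c) (e d) := by
  have h1 : ∀ a b, form2 (G x) (e a) (e b) = G x a b := form2_e _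
  simp only [Coord.belSymm, Coord.bel, belSymm, bel, riemannSq_eq, riemannSqLeft_eq,
    riemannSqRight_eq, riemannSqTrace_eq, h1, Algebra.algebraMap_self, RingHom.id_apply]

theorem belCurrent_eq (X Y Z : Coord.Space → Fin 4 → ℝ) (m : Fin 4) :
    Coord.belCurrent G X Y Z x m
      = current (Coord.inv G x) (form2 (G x)) (riemannForm G x) (X x) (Y x) (Z x) m := by
  simp only [Coord.belCurrent, Coord.belCurrentLower, current, belSymm_eq]
  exact Finset.sum_congr rfl fun n _ => by rw [← belSymm_expand]

end Current

section

variable {U : Set Coord.Space} {hU : IsOpen U} {G : Coord.Space → Matrix (Fin 4) (Fin 4) ℝ}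
  {hG : ∀ i j, ContDiffOn ℝ ∞ (fun x => G x i j) U} {hs : ∀ x i j, G x i j = G x j i}
  {hdet : ∀ x ∈ U, (G x).det ≠ 0}

theorem represents_belCurrent {X Y Z : Coord.Space → Fin 4 → ℝ} {X' Y' Z' : Fin 4 → smoothRing U}
    (hX : ∀ i, Represents (fun x => X x i) (X' i)) (hY : ∀ i, Represents (fun x => Y x i) (Y' i))
    (hZ : ∀ i, Represents (fun x => Z x i) (Z' i)) (m : Fin 4) :
    Represents (fun x => Coord.belCurrent G X Y Z x m)
      ((metricRing hU hG hs hdet).belCurrent X' Y' Z' m) := fun x => by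
  have h1 := (metricRing hU hG hs hdet).belCurrent_value (evalAt x) X' Y' Z' m
  rw [← evalAt_apply, h1]
  refine (belCurrent_eq ..).trans ?_
  have h2 : Coord.inv G x = ((metricRing hU hG hs hdet).curvatureAt (evalAt x)).h :=
    funext fun i => funext fun j => represents_h (hU := hU) (hs := hs) (hdet := hdet) i j x
  have h3 : riemannForm G x = ((metricRing hU hG hs hdet).curvatureAt (evalAt x)).R := by
    rw [riemannForm, CurvatureAt.R]
    congr 1
    funext a b c d
    exact represents_riem (hU := hU) (hG := hG) (hs := hs) (hdet := hdet) a b c d x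
  rw [h2, h3, show X x = MetricRing.value (evalAt x) X' from funext fun i => hX i x,
    show Y x = MetricRing.value (evalAt x) Y' from funext fun i => hY i x,
    show Z x = MetricRing.value (evalAt x) Z' from funext fun i => hZ i x]
  rfl

end

end

/-! ### Metrics and vector fields in a chart -/

open DualNumber BelAlgebra

noncomputable section

section Chart

variable {M : Type*} [TopologicalSpace M] [ChartedSpace Coord.Space M] [IsManifold (𝓡 4) ∞ M]
  (φ : SmoothChart M)

theorem chart_mdifferentiable : φ.1.MDifferentiable (𝓡 4) (𝓡 4) :=
  ⟨(contMDiffOn_of_mem_maximalAtlas φ.2).mdifferentiableOn (by simp),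
    (contMDiffOn_symm_of_mem_maximalAtlas φ.2).mdifferentiableOn (by simp)⟩

variable {φ} {x : Coord.Space}

theorem mfderiv_chart_symm (hx : x ∈ φ.1.target) (v : Coord.Space) :
    mfderiv (𝓡 4) (𝓡 4) φ.1 (φ.1.symm x) (mfderiv (𝓡 4) (𝓡 4) φ.1.symm x v) = v :=
  DFunLike.congr_fun ((chart_mdifferentiable φ).comp_symm_deriv hx) v

theorem mfderiv_symm_chart (hx : x ∈ φ.1.target) (v : TangentSpace (𝓡 4) (φ.1.symm x)) :
    (mfderiv (𝓡 4) (𝓡 4) φ.1.symm x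
      (mfderiv (𝓡 4) (𝓡 4) φ.1 (φ.1.symm x) v : Coord.Space) :
        TangentSpace (𝓡 4) (φ.1.symm x)) = v := by
  have h1 := (chart_mdifferentiable φ).symm_comp_deriv (φ.1.map_target hx)
  rw [φ.1.right_inv hx] at h1
  exact DFunLike.congr_fun h1 v

theorem coord_eq_sum (v : Coord.Space) :
    v = ∑ i, v i • (EuclideanSpace.single i (1 : ℝ) : Coord.Space) := by
  ext j
  simp [Finset.sum_apply, Pi.single_apply]

theorem sum_smul_coordVector (v : Coord.Space) :
    ∑ i, v i • coordVector φ x i = mfderiv (𝓡 4) (𝓡 4) φ.1.symm x v := by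
  conv_rhs => rw [coord_eq_sum v]
  exact ((map_sum (mfderiv (𝓡 4) (𝓡 4) φ.1.symm x) _ _).trans
    (Finset.sum_congr rfl fun i _ => map_smul (mfderiv (𝓡 4) (𝓡 4) φ.1.symm x) _ _)).symm

/-- The vector of the components of a vector field in a chart, in the coordinate space. -/
def fieldVec (ξ : Π p : M, TangentSpace (𝓡 4) p) (φ : SmoothChart M) (x : Coord.Space) :
    Coord.Space :=
  mfderiv (𝓡 4) (𝓡 4) φ.1 (φ.1.symm x) (ξ (φ.1.symm x))

/-- A vector field is the combination `ξ^i ∂_i` of the coordinate vectors. -/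
theorem sum_fieldIn_smul_coordVector (hx : x ∈ φ.1.target) (ξ : Π p : M, TangentSpace (𝓡 4) p) :
    ∑ i, fieldIn ξ φ x i • coordVector φ x i = ξ (φ.1.symm x) :=
  (sum_smul_coordVector _).trans (mfderiv_symm_chart hx _)

theorem metricIn_symm (g : LorentzMetric M) (x : Coord.Space) (i j : Fin 4) :
    metricIn g φ x i j = metricIn g φ x j i := g.symm _ _ _

theorem metric_val_eq_sum (g : LorentzMetric M) (u v : Fin 4 → ℝ) :
    g.val (φ.1.symm x) (∑ i, u i • coordVector φ x i) (∑ i, v i • coordVector φ x i)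
      = ∑ i, ∑ j, metricIn g φ x i j * u i * v j := by
  let B := g.val (φ.1.symm x)
  have h1 : ∀ w, B (∑ i, u i • coordVector φ x i) w = ∑ i, u i * B (coordVector φ x i) w :=
    fun w => by
      rw [map_sum, sum_apply]
      exact Finset.sum_congr rfl fun i _ => by rw [map_smul, smul_apply, smul_eq_mul]
  refine (h1 _).trans (Finset.sum_congr rfl fun i _ => ?_)
  rw [map_sum, Finset.mul_sum]
  refine Finset.sum_congr rfl fun j _ => ?_
  rw [map_smul, smul_eq_mul]
  change u i * (v j * metricIn g φ x i j) = _
  ring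

/-- The matrix of the metric is invertible, as the metric is nondegenerate. -/
theorem metricIn_det_ne_zero (g : LorentzMetric M) (hx : x ∈ φ.1.target) :
    (metricIn g φ x).det ≠ 0 := by
  intro h0
  obtain ⟨v, hv, hv0⟩ := Matrix.exists_mulVec_eq_zero_iff.2 h0
  apply hv
  have h1 : ∀ w, g.val (φ.1.symm x) w (∑ i, v i • coordVector φ x i) = 0 := fun w => by
    obtain ⟨u, rfl⟩ : ∃ u : Fin 4 → ℝ, ∑ i, u i • coordVector φ x i = w :=
      ⟨_, (sum_smul_coordVector _).trans (mfderiv_symm_chart hx w)⟩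
    rw [metric_val_eq_sum]
    refine Finset.sum_eq_zero fun i _ => ?_
    have h2 := congrFun hv0 i
    simp only [Matrix.mulVec, dotProduct, Pi.zero_apply] at h2
    have h3 := congrArg (fun r => u i * r) h2
    simp only [Finset.mul_sum, mul_zero] at h3
    rw [← h3]
    exact Finset.sum_congr rfl fun j _ => by ring
  obtain ⟨b, hb⟩ := g.signature (φ.1.symm x)
  have h2 : ∑ i, v i • coordVector φ x i = 0 := by
    rw [← b.sum_repr (∑ i, v i • coordVector φ x i)]
    refine Finset.sum_eq_zero fun i _ => ?_
    have h3 := h1 (b i)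
    rw [← b.sum_repr (∑ i, v i • coordVector φ x i), map_sum, Finset.sum_eq_single i] at h3
    · rw [map_smul, hb, if_pos rfl, smul_eq_mul] at h3
      have h4 : (if i = 0 then -1 else 1 : ℝ) ≠ 0 := by split_ifs <;> norm_num
      rw [(mul_eq_zero.1 h3).resolve_right h4, zero_smul]
    · intro j _ hj
      rw [map_smul, hb, if_neg hj.symm, smul_zero]
    · simp
  have h3 : (WithLp.toLp 2 v : Coord.Space) = 0 := by
    rw [← mfderiv_chart_symm hx (WithLp.toLp 2 v), ← sum_smul_coordVector]
    refine (congrArg _ h2).trans ?_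
    exact map_zero _
  funext i
  exact congrArg (fun u : Coord.Space => u i) h3

theorem contMDiffOn_coordVector (i : Fin 4) :
    ContMDiffOn (𝓡 4) (𝓡 4).tangent ∞
      (fun x => (⟨φ.1.symm x, coordVector φ x i⟩ : TangentBundle (𝓡 4) M)) φ.1.target := by
  have hu : UniqueMDiffOn (𝓡 4) φ.1.target := φ.1.open_target.uniqueMDiffOn
  have h1 := (contMDiffOn_symm_of_mem_maximalAtlas φ.2).contMDiffOn_tangentMapWithin
    (m := ∞) (by simp) hu
  have h2 : ContMDiffOn (𝓡 4) (𝓡 4).tangent ∞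
      (fun x => (⟨x, (EuclideanSpace.single i (1 : ℝ) : Coord.Space)⟩ :
        TangentBundle (𝓡 4) Coord.Space)) φ.1.target :=
    contMDiffOn_vectorSpace_iff_contDiffOn.2 contDiffOn_const
  refine (h1.comp h2 fun x hx => hx).congr fun x hx => ?_
  simp only [Function.comp, tangentMapWithin, coordVector]
  rw [mfderivWithin_of_isOpen φ.1.open_target hx]

theorem contDiffOn_metricIn (g : LorentzMetric M) (i j : Fin 4) :
    ContDiffOn ℝ ∞ (fun x => metricIn g φ x i j) φ.1.target := by
  rw [← contMDiffOn_iff_contDiffOn]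
  intro x hx
  have h1 := (g.contMDiff.contMDiffAt (x := φ.1.symm x)).comp_contMDiffWithinAt x
    (contMDiffOn_symm_of_mem_maximalAtlas φ.2 x hx)
  have h2 : ContMDiffWithinAt (𝓡 4) ((𝓡 4).prod 𝓘(ℝ)) ∞
      (fun y => Bundle.TotalSpace.mk' ℝ (E := Bundle.Trivial M ℝ) (φ.1.symm y)
        (g.val (φ.1.symm y) (coordVector φ y i) (coordVector φ y j))) φ.1.target x :=
    ContMDiffWithinAt.clm_bundle_apply₂ (F₁ := Coord.Space) (F₂ := Coord.Space) h1
      (contMDiffOn_coordVector i x hx) (contMDiffOn_coordVector j x hx)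
  simp only [Bundle.contMDiffWithinAt_totalSpace] at h2
  exact h2.2

variable {ξ η : Π p : M, TangentSpace (𝓡 4) p}

theorem contDiffOn_fieldVec
    (hξ : ContMDiff (𝓡 4) (𝓡 4).tangent ∞ (fun p => (⟨p, ξ p⟩ : TangentBundle (𝓡 4) M))) :
    ContDiffOn ℝ ∞ (fieldVec ξ φ) φ.1.target := by
  have hu : UniqueMDiffOn (𝓡 4) φ.1.source := φ.1.open_source.uniqueMDiffOn
  have h1 := (contMDiffOn_of_mem_maximalAtlas φ.2).contMDiffOn_tangentMapWithin
    (m := ∞) (by simp) hu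
  have h2 := hξ.comp_contMDiffOn (contMDiffOn_symm_of_mem_maximalAtlas φ.2)
  have h3 := (contMDiff_snd_tangentBundle_modelSpace Coord.Space (𝓡 4) (n := ∞)).comp_contMDiffOn
    (h1.comp h2 fun x hx => φ.1.map_target hx)
  rw [← contMDiffOn_iff_contDiffOn]
  refine h3.congr fun x hx => ?_
  simp only [Function.comp, tangentMapWithin, fieldVec]
  rw [mfderivWithin_of_isOpen φ.1.open_source (φ.1.map_target hx)]

theorem contDiffOn_fieldIn
    (hξ : ContMDiff (𝓡 4) (𝓡 4).tangent ∞ (fun p => (⟨p, ξ p⟩ : TangentBundle (𝓡 4) M)))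
    (i : Fin 4) : ContDiffOn ℝ ∞ (fun x => fieldIn ξ φ x i) φ.1.target :=
  contDiffOn_euclidean.1 (contDiffOn_fieldVec hξ) i

theorem mpullback_chart_symm (hx : x ∈ φ.1.target) :
    VectorField.mpullback (𝓡 4) (𝓡 4) φ.1.symm ξ x
      = fieldVec ξ φ x := by
  have h1 : (mfderiv (𝓡 4) (𝓡 4) φ.1.symm x).IsInvertible :=
    ⟨(chart_mdifferentiable φ).symm.mfderiv hx, rfl⟩
  rw [VectorField.mpullback_apply]
  refine h1.injective ?_
  rw [h1.self_apply_inverse]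
  exact (mfderiv_symm_chart hx _).symm

/-- Commuting vector fields, in coordinates. -/
theorem fieldIn_commute
    (hξ : ContMDiff (𝓡 4) (𝓡 4).tangent ∞ (fun p => (⟨p, ξ p⟩ : TangentBundle (𝓡 4) M)))
    (hη : ContMDiff (𝓡 4) (𝓡 4).tangent ∞ (fun p => (⟨p, η p⟩ : TangentBundle (𝓡 4) M)))
    (hC : VectorField.mlieBracket (𝓡 4) ξ η = 0) (hx : x ∈ φ.1.target) (i : Fin 4) :
    ∑ k, fieldIn ξ φ x k * Coord.partialDeriv k (fun y => fieldIn η φ y i) x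
      = ∑ k, fieldIn η φ x k * Coord.partialDeriv k (fun y => fieldIn ξ φ y i) x := by
  have : IsManifold (𝓡 4) (minSmoothness ℝ 2) M := .of_le (n := ∞) (by
    simp; exact WithTop.coe_le_coe.2 le_top)
  have h1 := VectorField.mpullback_mlieBracket (n := ∞) (f := φ.1.symm) (I := 𝓡 4) (I' := 𝓡 4)
    (hξ.mdifferentiableAt (by simp)) (hη.mdifferentiableAt (by simp))
    (contMDiffAt_symm_of_mem_maximalAtlas φ.2 hx) (by simp; exact WithTop.coe_le_coe.2 le_top)
  rw [hC, VectorField.mpullback_zero] at h1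
  have h2 : ∀ ζ : Π p : M, TangentSpace (𝓡 4) p,
      VectorField.mpullback (𝓡 4) (𝓡 4) φ.1.symm ζ =ᶠ[nhds x] fieldVec ζ φ := fun ζ => by
    filter_upwards [φ.1.open_target.mem_nhds hx] with y hy using mpullback_chart_symm hy
  have hb : ∀ V W : Π y : Coord.Space, TangentSpace 𝓘(ℝ, Coord.Space) y,
      VectorField.mlieBracket 𝓘(ℝ, Coord.Space) V W = VectorField.lieBracket ℝ V W := fun V W => by
    rw [← VectorField.mlieBracketWithin_univ, VectorField.mlieBracketWithin_eq_lieBracketWithin]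
    exact VectorField.lieBracketWithin_univ
  replace h1 : (0 : Coord.Space) = VectorField.lieBracket ℝ (fieldVec ξ φ) (fieldVec η φ) x :=
    h1.trans (((h2 ξ).mlieBracket_vectorField_eq (h2 η)).trans (congrFun (hb _ _) x))
  have h3 : ∀ ζ : Π p : M, TangentSpace (𝓡 4) p,
      ContMDiff (𝓡 4) (𝓡 4).tangent ∞ (fun p => (⟨p, ζ p⟩ : TangentBundle (𝓡 4) M)) →
      ∀ v : Coord.Space, fderiv ℝ (fieldVec ζ φ) x v i
        = ∑ k, v k * Coord.partialDeriv k (fun y => fieldIn ζ φ y i) x := fun ζ hζ v => by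
    have h4 : DifferentiableAt ℝ (fieldVec ζ φ) x :=
      ((contDiffOn_fieldVec hζ).contDiffAt (φ.1.open_target.mem_nhds hx)).differentiableAt
        (by simp)
    have h5 : ∀ u : Coord.Space, fderiv ℝ (fieldVec ζ φ) x u i
        = fderiv ℝ (fun y => fieldIn ζ φ y i) x u := fun u =>
      (DFunLike.congr_fun
        ((EuclideanSpace.proj (𝕜 := ℝ) i).hasFDerivAt.comp x h4.hasFDerivAt).fderiv u).symm
    rw [h5]
    conv_lhs => rw [coord_eq_sum v]
    rw [map_sum]
    exact Finset.sum_congr rfl fun k _ => map_smul _ _ _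
  have h4 := congrArg (fun w : Coord.Space => w i) h1
  have h5 : fderiv ℝ (fieldVec η φ) x (fieldVec ξ φ x) i
    - fderiv ℝ (fieldVec ξ φ) x (fieldVec η φ x) i = 0 := h4.symm
  rw [h3 η hη, h3 ξ hξ] at h5
  exact sub_eq_zero.1 h5

end Chart

end

/-! ### Exterior products in coordinates -/

open DualNumber BelAlgebra

noncomputable section

section Wedge

theorem sum_perm_succ {n : ℕ} (f : Equiv.Perm (Fin (n + 1)) → ℝ) :
    ∑ p, f p = ∑ i, ∑ q, f (Equiv.Perm.decomposeFin.symm (i, q)) := by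
  rw [← Equiv.Perm.decomposeFin.symm.sum_comp, Fintype.sum_prod_type]

theorem decomposeFin_symm_apply_two {n : ℕ} (p : Equiv.Perm (Fin (n + 2))) (i : Fin (n + 3)) :
    Equiv.Perm.decomposeFin.symm (i, p) 2 = Equiv.swap 0 i (p 1).succ :=
  Equiv.Perm.decomposeFin_symm_apply_succ p i 1

theorem decomposeFin_symm_apply_three {n : ℕ} (p : Equiv.Perm (Fin (n + 3))) (i : Fin (n + 4)) :
    Equiv.Perm.decomposeFin.symm (i, p) 3 = Equiv.swap 0 i (p 2).succ :=
  Equiv.Perm.decomposeFin_symm_apply_succ p i 2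

theorem sum_perm_three (f : Fin 3 → Fin 3 → Fin 3 → ℝ) :
    ∑ p : Equiv.Perm (Fin 3), ((Equiv.Perm.sign p : ℤ) : ℝ) * f (p 0) (p 1) (p 2)
      = (f 0 1 2 - f 0 2 1) + (f 1 2 0 - f 1 0 2) + (f 2 0 1 - f 2 1 0) := by
  simp [sum_perm_succ, Fin.sum_univ_succ, decomposeFin_symm_apply_two, Equiv.swap_apply_def]
  ring

theorem sum_perm_four (f : Fin 4 → Fin 4 → Fin 4 → Fin 4 → ℝ) :
    ∑ p : Equiv.Perm (Fin 4), ((Equiv.Perm.sign p : ℤ) : ℝ) * f (p 0) (p 1) (p 2) (p 3)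
      = (f 0 1 2 3 - f 1 0 2 3 - f 0 1 3 2 + f 1 0 3 2)
        - (f 0 2 1 3 - f 2 0 1 3 - f 0 2 3 1 + f 2 0 3 1)
        + (f 0 3 1 2 - f 3 0 1 2 - f 0 3 2 1 + f 3 0 2 1)
        + (f 1 2 0 3 - f 2 1 0 3 - f 1 2 3 0 + f 2 1 3 0)
        - (f 1 3 0 2 - f 3 1 0 2 - f 1 3 2 0 + f 3 1 2 0)
        + (f 2 3 0 1 - f 3 2 0 1 - f 2 3 1 0 + f 3 2 1 0) := by
  simp [sum_perm_succ, Fin.sum_univ_succ, decomposeFin_symm_apply_two,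
    decomposeFin_symm_apply_three, Equiv.swap_apply_def]
  ring

variable {G : Coord.Space → Matrix (Fin 4) (Fin 4) ℝ} {x : Coord.Space}
  {X Y Z : Coord.Space → Fin 4 → ℝ}

theorem wedgeD_eq (a b c : Fin 4) : Coord.wedgeD G X ![a, b, c] x
    = 2 * (Coord.lower G X a x * Coord.dLower G X b c x
      + Coord.lower G X b x * Coord.dLower G X c a x
      + Coord.lower G X c x * Coord.dLower G X a b x) := by
  have h1 := sum_perm_three fun i j k => Coord.lower G X (![a, b, c] i) x
    * Coord.dLower G X (![a, b, c] j) (![a, b, c] k) x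
  refine h1.trans ?_
  simp only [Matrix.cons_val, Coord.dLower]
  ring

theorem wedgeWedgeD_eq (a b c d : Fin 4) : Coord.wedgeWedgeD G X Y Z ![a, b, c, d] x
    = 2 * wedge (fun i => Coord.lower G X i x) (fun i => Coord.lower G Y i x)
      (fun i j => Coord.dLower G Z i j x) a b c d := by
  have h1 := sum_perm_four fun i j k l => Coord.lower G X (![a, b, c, d] i) x
    * Coord.lower G Y (![a, b, c, d] j) x
    * Coord.dLower G Z (![a, b, c, d] k) (![a, b, c, d] l) x
  refine h1.trans ?_
  simp only [Matrix.cons_val, Coord.dLower, wedge]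
  ring

end Wedge

/-! ### Killing vector fields in an open part of a chart -/

section ChartRing

variable {M : Type*} [TopologicalSpace M] [ChartedSpace Coord.Space M] [IsManifold (𝓡 4) ∞ M]
  (g : LorentzMetric M) {ξ η ζ : Π p : M, TangentSpace (𝓡 4) p} {φ : SmoothChart M}
  {U : Set Coord.Space} (hU : IsOpen U) (hUφ : U ⊆ φ.1.target)

/-- The tensor calculus of a Lorentz metric in an open part of a chart. -/
def chartRing : MetricRing (smoothRing U) :=
  metricRing hU (G := metricIn g φ) (fun i j => (contDiffOn_metricIn g i j).mono hUφ)
    (metricIn_symm g) fun _ hx => metricIn_det_ne_zero g (hUφ hx)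

variable {g}

/-- The components of a smooth vector field in an open part of a chart. -/
def fieldOn (hξ : IsKilling g ξ) (hUφ : U ⊆ φ.1.target) (i : Fin 4) : smoothRing U :=
  smoothRestrict (fun x => fieldIn ξ φ x i) ((contDiffOn_fieldIn hξ.contMDiff i).mono hUφ)

theorem represents_fieldOn (hξ : IsKilling g ξ) (i : Fin 4) :
    Represents (fun x => fieldIn ξ φ x i) (fieldOn hξ hUφ i) := fun _ => rfl

theorem killing_fieldOn (hξ : IsKilling g ξ) : (chartRing g hU hUφ).Killing (fieldOn hξ hUφ) :=
  fun i j => smoothRing_ext fun x => by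
    have h1 : ∀ i j, evalAt x ((chartRing g hU hUφ).cov (fieldOn hξ hUφ) i j)
        = Coord.covDerivLower (metricIn g φ) (fieldIn ξ φ) i j x := fun i j =>
      (represents_cov (represents_fieldOn hUφ hξ) i j x).symm
    rw [map_add, h1, h1, hξ.killing φ x (hUφ x.2), map_zero]

theorem along_fieldOn (hξ : IsKilling g ξ) (hη : IsKilling g η)
    (hC : VectorField.mlieBracket (𝓡 4) ξ η = 0) (i : Fin 4) :
    (chartRing g hU hUφ).along (fieldOn hξ hUφ) (fieldOn hη hUφ i)
      = (chartRing g hU hUφ).along (fieldOn hη hUφ) (fieldOn hξ hUφ i) := by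
  refine smoothRing_ext fun x => ?_
  rw [MetricRing.along_apply, MetricRing.along_apply]
  have h1 := fieldIn_commute hξ.contMDiff hη.contMDiff hC (hUφ x.2) i
  have h2 := Represents.sum (fun k => (represents_fieldOn hUφ hξ k).mul
    ((represents_fieldOn hUφ hη i).partialDeriv hU k)) x
  have h3 := Represents.sum (fun k => (represents_fieldOn hUφ hη k).mul
    ((represents_fieldOn hUφ hξ i).partialDeriv hU k)) x
  exact h2.symm.trans (h1.trans h3)

/-- The exterior differential of a Killing 1-form is twice its covariant derivative. -/
theorem dLower_fieldOn (hξ : IsKilling g ξ) (x : U) (i j : Fin 4) :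
    Coord.dLower (metricIn g φ) (fieldIn ξ φ) i j x
      = 2 * evalAt x ((chartRing g hU hUφ).cov (fieldOn hξ hUφ) i j) := by
  have h1 := congrArg (evalAt x) (killing_fieldOn hU hUφ hξ i j)
  have h2 : Coord.dLower (metricIn g φ) (fieldIn ξ φ) i j x
      = evalAt x ((chartRing g hU hUφ).cov (fieldOn hξ hUφ) i j
        - (chartRing g hU hUφ).cov (fieldOn hξ hUφ) j i) :=
    represents_dLower (represents_fieldOn hUφ hξ) i j x
  rw [map_add, map_zero] at h1
  rw [h2, map_sub]
  linarith

theorem lower_fieldOn (hξ : IsKilling g ξ) (x : U) (i : Fin 4) :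
    Coord.lower (metricIn g φ) (fieldIn ξ φ) i x
      = evalAt x ((chartRing g hU hUφ).lower (fieldOn hξ hUφ) i) :=
  represents_lower (represents_fieldOn hUφ hξ) i x

theorem hypersurfaceOrthogonal_fieldOn (hξ : IsKilling g ξ)
    (hW : IsHypersurfaceOrthogonal g ξ) (a b c : Fin 4) :
    (chartRing g hU hUφ).lower (fieldOn hξ hUφ) a * (chartRing g hU hUφ).cov (fieldOn hξ hUφ) b c
      + (chartRing g hU hUφ).lower (fieldOn hξ hUφ) b
        * (chartRing g hU hUφ).cov (fieldOn hξ hUφ) c a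
      + (chartRing g hU hUφ).lower (fieldOn hξ hUφ) c
        * (chartRing g hU hUφ).cov (fieldOn hξ hUφ) a b = 0 := by
  refine smoothRing_ext fun x => ?_
  have h1 := hW φ x (hUφ x.2) ![a, b, c]
  rw [wedgeD_eq] at h1
  simp only [dLower_fieldOn hU hUφ hξ, lower_fieldOn hU hUφ hξ] at h1
  simp only [map_add, map_mul, map_zero]
  linarith

theorem wedge_fieldOn (hξ : IsKilling g ξ) (hη : IsKilling g η) (hζ : IsKilling g ζ)
    (hW : ∀ x ∈ φ.1.target, ∀ i, Coord.wedgeWedgeD (metricIn g φ) (fieldIn ξ φ) (fieldIn η φ)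
      (fieldIn ζ φ) i x = 0) (a b c d : Fin 4) :
    wedge ((chartRing g hU hUφ).lower (fieldOn hξ hUφ))
      ((chartRing g hU hUφ).lower (fieldOn hη hUφ))
      ((chartRing g hU hUφ).cov (fieldOn hζ hUφ)) a b c d = 0 := by
  refine smoothRing_ext fun x => ?_
  have h1 := hW x (hUφ x.2) ![a, b, c, d]
  rw [wedgeWedgeD_eq] at h1
  simp only [wedge, dLower_fieldOn hU hUφ hζ, lower_fieldOn hU hUφ hξ,
    lower_fieldOn hU hUφ hη] at h1
  simp only [wedge, map_add, map_sub, map_mul, map_zero]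
  linarith

section Current

variable {ξ₁ ξ₂ ξ₃ : Π p : M, TangentSpace (𝓡 4) p} (h₁ : IsKilling g ξ₁) (h₂ : IsKilling g ξ₂)
  (h₃ : IsKilling g ξ₃)

/-- The Bel current of three Killing vector fields in an open part of a chart. -/
def currentOn (i : Fin 4) : smoothRing U :=
  (chartRing g hU hUφ).belCurrent (fieldOn h₁ hUφ) (fieldOn h₂ hUφ) (fieldOn h₃ hUφ) i

theorem represents_currentOn (i : Fin 4) :
    Represents (fun x => Coord.belCurrent (metricIn g φ) (fieldIn ξ₁ φ) (fieldIn ξ₂ φ)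
      (fieldIn ξ₃ φ) x i) (currentOn hU hUφ h₁ h₂ h₃ i) :=
  represents_belCurrent (represents_fieldOn hUφ h₁) (represents_fieldOn hUφ h₂)
    (represents_fieldOn hUφ h₃) i

theorem divBelCurrentAt_eq (x : U) : divBelCurrentAt g ξ₁ ξ₂ ξ₃ φ x
    = evalAt x ((chartRing g hU hUφ).div (currentOn hU hUφ h₁ h₂ h₃)) :=
  represents_div (represents_currentOn hU hUφ h₁ h₂ h₃) x

theorem belCurrentAt_eq (x : U) : belCurrentAt g ξ₁ ξ₂ ξ₃ φ x
    = ∑ i, evalAt x (currentOn hU hUφ h₁ h₂ h₃ i) • coordVector φ x i :=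
  Finset.sum_congr rfl fun i _ =>
    congrArg (· • coordVector φ x i) (represents_currentOn hU hUφ h₁ h₂ h₃ i x)

theorem sum_fieldOn_smul_coordVector (x : U) :
    ∑ i, evalAt x (fieldOn h₁ hUφ i) • coordVector φ x i = ξ₁ (φ.1.symm x) :=
  sum_fieldIn_smul_coordVector (hUφ x.2) ξ₁

end Current

end ChartRing

end

/-! ### The Bel currents of Killing vector fields on a spacetime -/

open DualNumber BelAlgebra

noncomputable section

variable {M : Type*} [TopologicalSpace M] [ChartedSpace Coord.Space M] [IsManifold (𝓡 4) ∞ M]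
  {g : LorentzMetric M} {ξ η : Π p : M, TangentSpace (𝓡 4) p} {φ : SmoothChart M}

/-- The scalar product of two vector fields, in the ring of smooth functions on an open part of a
chart. -/
def scalarOn {U : Set Coord.Space} (hU : IsOpen U) (hUφ : U ⊆ φ.1.target)
    (hξ : IsKilling g ξ) (hη : IsKilling g η) : smoothRing U :=
  ∑ i, ∑ j, (chartRing g hU hUφ).g i j * fieldOn hξ hUφ i * fieldOn hη hUφ j

theorem evalAt_scalarOn {U : Set Coord.Space} (hU : IsOpen U) (hUφ : U ⊆ φ.1.target)
    (hξ : IsKilling g ξ) (hη : IsKilling g η) (x : U) : evalAt x (scalarOn hU hUφ hξ hη)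
      = g.val (φ.1.symm x) (ξ (φ.1.symm x)) (η (φ.1.symm x)) := by
  have h1 := metric_val_eq_sum (φ := φ) (x := x) g (fun i => evalAt x (fieldOn hξ hUφ i))
    fun i => evalAt x (fieldOn hη hUφ i)
  rw [sum_fieldOn_smul_coordVector, sum_fieldOn_smul_coordVector] at h1
  rw [h1, scalarOn]
  simp only [map_sum, map_mul]
  rfl

theorem gram_fieldOn {U : Set Coord.Space} (hU : IsOpen U) (hUφ : U ⊆ φ.1.target)
    (hξ : IsKilling g ξ) (hη : IsKilling g η) (x : U) :
    ((chartRing g hU hUφ).curvatureAt (evalAt x)).gram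
      (MetricRing.value (evalAt x) (fieldOn hξ hUφ)) (MetricRing.value (evalAt x) (fieldOn hη hUφ))
      = g.val (φ.1.symm x) (ξ (φ.1.symm x)) (ξ (φ.1.symm x))
        * g.val (φ.1.symm x) (η (φ.1.symm x)) (η (φ.1.symm x))
        - g.val (φ.1.symm x) (ξ (φ.1.symm x)) (η (φ.1.symm x)) ^ 2 := by
  rw [CurvatureAt.gram, MetricRing.G_value_value, MetricRing.G_value_value,
    MetricRing.G_value_value]
  exact congrArg₂ (· - ·) (congrArg₂ (· * ·) (evalAt_scalarOn hU hUφ hξ hξ x)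
    (evalAt_scalarOn hU hUφ hη hη x)) (congrArg (· ^ 2) (evalAt_scalarOn hU hUφ hξ hη x))

theorem isOpen_spanNonNullPlaneAt (hξ : IsKilling g ξ) (hη : IsKilling g η) :
    IsOpen {x ∈ φ.1.target | SpanNonNullPlaneAt g ξ η (φ.1.symm x)} := by
  have hU := φ.1.open_target
  let f : smoothRing φ.1.target := scalarOn hU subset_rfl hξ hξ * scalarOn hU subset_rfl hη hη
    - scalarOn hU subset_rfl hξ hη ^ 2
  have hf : ContDiffOn ℝ ∞ (extendZero f.1) φ.1.target := f.2
  refine (congrArg IsOpen (Set.ext fun x => ?_)).mpr (hf.continuousOn.isOpen_inter_preimage hU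
    (isOpen_compl_singleton (x := (0 : ℝ))))
  refine and_congr_right fun hx => not_congr ?_
  have h1 : extendZero f.1 x = evalAt ⟨x, hx⟩ f := extendZero_apply f.1 ⟨x, hx⟩
  refine Iff.trans ?_ (Eq.congr_left h1 (z := (0 : ℝ))).symm
  simp only [f, map_sub, map_mul, map_pow, evalAt_scalarOn]

/-- The Bel current of a hypersurface-orthogonal Killing vector field is a multiple of it, and its
divergence vanishes. -/
theorem belCurrentAt_of_hypersurfaceOrthogonal (hξ : IsKilling g ξ)
    (hW : IsHypersurfaceOrthogonal g ξ) (φ : SmoothChart M) {x : Coord.Space}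
    (hx : x ∈ φ.1.target) : (∃ a : ℝ, belCurrentAt g ξ ξ ξ φ x = a • ξ (φ.1.symm x)) ∧
      divBelCurrentAt g ξ ξ ξ φ x = 0 := by
  have hU := φ.1.open_target
  have hUφ : φ.1.target ⊆ φ.1.target := subset_rfl
  have hK := killing_fieldOn hU hUφ hξ
  have h1 : ∀ y : φ.1.target, ∃ a : ℝ, ∀ i, evalAt y (currentOn hU hUφ hξ hξ hξ i)
      = a * evalAt y (fieldOn hξ hUφ i) := fun y =>
    hK.belCurrent_eq_smul (hypersurfaceOrthogonal_fieldOn hU hUφ hξ hW)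
  refine ⟨?_, ?_⟩
  · obtain ⟨a, ha⟩ := h1 ⟨x, hx⟩
    refine ⟨a, ?_⟩
    rw [belCurrentAt_eq hU hUφ hξ hξ hξ ⟨x, hx⟩,
      ← sum_fieldOn_smul_coordVector hUφ hξ ⟨x, hx⟩, Finset.smul_sum]
    exact Finset.sum_congr rfl fun i _ => by rw [ha, mul_smul]
  · refine (divBelCurrentAt_eq hU hUφ hξ hξ hξ ⟨x, hx⟩).trans ?_
    by_cases h0 : ∀ i, evalAt ⟨x, hx⟩ (fieldOn hξ hUφ i) = 0
    · exact (chartRing g hU hUφ).div_belCurrent_of_zero h0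
    · push Not at h0
      obtain ⟨i, hi⟩ := h0
      have h2 := hK.smul_div_eq_zero (j := currentOn hU hUφ hξ hξ hξ)
        (hK.along_belCurrent (fun _ => rfl) (fun _ => rfl) fun _ => rfl)
        (fun i m => smoothRing_ext fun y => by
          obtain ⟨a, ha⟩ := h1 y
          rw [map_mul, map_mul, ha, ha]
          ring) i
      have h3 := congrArg (evalAt ⟨x, hx⟩) h2
      rw [map_mul, map_zero] at h3
      exact (mul_eq_zero.1 h3).resolve_left hi

/-- The Bel currents built from two commuting Killing vector fields that act orthogonally
transitively lie in the planes spanned by these vector fields, and their divergences vanish. -/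
theorem belCurrentAt_of_orthogonallyTransitive (hξ : IsKilling g ξ) (hη : IsKilling g η)
    (hC : VectorField.mlieBracket (𝓡 4) ξ η = 0) (hW : IsOrthogonallyTransitive g ξ η)
    (φ : SmoothChart M) {x : Coord.Space} (hx : x ∈ φ.1.target)
    (hΔ : SpanNonNullPlaneAt g ξ η (φ.1.symm x)) {ξ₁ ξ₂ ξ₃ : Π p : M, TangentSpace (𝓡 4) p}
    (h₁ : ξ₁ = ξ ∨ ξ₁ = η) (h₂ : ξ₂ = ξ ∨ ξ₂ = η) (h₃ : ξ₃ = ξ ∨ ξ₃ = η) :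
    belCurrentAt g ξ₁ ξ₂ ξ₃ φ x ∈ Submodule.span ℝ {ξ (φ.1.symm x), η (φ.1.symm x)} ∧
      divBelCurrentAt g ξ₁ ξ₂ ξ₃ φ x = 0 := by
  have hK : ∀ {ζ : Π p : M, TangentSpace (𝓡 4) p}, ζ = ξ ∨ ζ = η → IsKilling g ζ := by
    rintro ζ (rfl | rfl) <;> assumption
  let U := {x ∈ φ.1.target | SpanNonNullPlaneAt g ξ η (φ.1.symm x)}
  have hU : IsOpen U := isOpen_spanNonNullPlaneAt hξ hη
  have hUφ : U ⊆ φ.1.target := fun _ hx => hx.1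
  have hKξ := killing_fieldOn hU hUφ hξ
  have hKη := killing_fieldOn hU hUφ hη
  have hF : ∀ {ζ : Π p : M, TangentSpace (𝓡 4) p} (h : ζ = ξ ∨ ζ = η),
      fieldOn (hK h) hUφ = fieldOn hξ hUφ ∨ fieldOn (hK h) hUφ = fieldOn hη hUφ := by
    rintro ζ (rfl | rfl)
    exacts [.inl rfl, .inr rfl]
  have hcomm := along_fieldOn hU hUφ hξ hη hC
  have hcξ : ∀ {X : Fin 4 → smoothRing U}, X = fieldOn hξ hUφ ∨ X = fieldOn hη hUφ →
      ∀ i, (chartRing g hU hUφ).along (fieldOn hξ hUφ) (X i)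
        = (chartRing g hU hUφ).along X (fieldOn hξ hUφ i) := by
    rintro X (rfl | rfl) i
    exacts [rfl, hcomm i]
  have hcη : ∀ {X : Fin 4 → smoothRing U}, X = fieldOn hξ hUφ ∨ X = fieldOn hη hUφ →
      ∀ i, (chartRing g hU hUφ).along (fieldOn hη hUφ) (X i)
        = (chartRing g hU hUφ).along X (fieldOn hη hUφ i) := by
    rintro X (rfl | rfl) i
    exacts [(hcomm i).symm, rfl]
  have hgram : ∀ y : U, ((chartRing g hU hUφ).curvatureAt (evalAt y)).gram
      (MetricRing.value (evalAt y) (fieldOn hξ hUφ))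
      (MetricRing.value (evalAt y) (fieldOn hη hUφ)) ≠ 0 := fun y => by
    rw [gram_fieldOn hU hUφ hξ hη y]
    exact y.2.2
  have h1 : ∀ y : U, ∃ a b : ℝ, ∀ i, evalAt y (currentOn hU hUφ (hK h₁) (hK h₂) (hK h₃) i)
      = a * evalAt y (fieldOn hξ hUφ i) + b * evalAt y (fieldOn hη hUφ i) := fun y =>
    hKξ.belCurrent_mem_plane hKη hcomm
      (wedge_fieldOn hU hUφ hξ hη hξ fun x hx i => (hW φ x hx i).1)
      (wedge_fieldOn hU hUφ hξ hη hη fun x hx i => (hW φ x hx i).2) (hgram y) (hF h₁) (hF h₂)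
      (hF h₃)
  let p : U := ⟨x, hx, hΔ⟩
  refine ⟨?_, ?_⟩
  · obtain ⟨a, b, hab⟩ := h1 p
    refine Submodule.mem_span_pair.2 ⟨a, b, ?_⟩
    refine Eq.trans ?_ (belCurrentAt_eq hU hUφ (hK h₁) (hK h₂) (hK h₃) p).symm
    rw [← sum_fieldOn_smul_coordVector hUφ hξ p, ← sum_fieldOn_smul_coordVector hUφ hη p,
      Finset.smul_sum, Finset.smul_sum, ← Finset.sum_add_distrib]
    exact Finset.sum_congr rfl fun i _ => by rw [hab, add_smul, mul_smul, mul_smul]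
  · refine (divBelCurrentAt_eq hU hUφ (hK h₁) (hK h₂) (hK h₃) p).trans ?_
    obtain ⟨b, c, hbc⟩ := MetricRing.exists_minor_ne_zero (hgram p)
    have h2 := hKξ.minor_div_eq_zero hKη hcomm
      (j := currentOn hU hUφ (hK h₁) (hK h₂) (hK h₃))
      (hKξ.along_belCurrent (hcξ (hF h₁)) (hcξ (hF h₂)) (hcξ (hF h₃)))
      (hKη.along_belCurrent (hcη (hF h₁)) (hcη (hF h₂)) (hcη (hF h₃)))
      (fun a b c => smoothRing_ext fun y => by
        obtain ⟨r, s, hrs⟩ := h1 y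
        simp only [map_mul, map_sub, hrs]
        ring) b c
    have h3 := congrArg (evalAt p) h2
    rw [map_mul, map_zero] at h3
    exact (mul_eq_zero.1 h3).resolve_left hbc

end

theorem theorem1 {M : Type*} [TopologicalSpace M] [ChartedSpace Coord.Space M]
    [IsManifold (𝓡 4) ∞ M] (g : LorentzMetric M) :
    (∀ ξ : (Π p : M, TangentSpace (𝓡 4) p), IsKilling g ξ → IsHypersurfaceOrthogonal g ξ →
      ∀ (φ : SmoothChart M), ∀ x ∈ φ.1.target,
        (∃ a : ℝ, belCurrentAt g ξ ξ ξ φ x = a • ξ (φ.1.symm x)) ∧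
        divBelCurrentAt g ξ ξ ξ φ x = 0) ∧
    (∀ ξ η : (Π p : M, TangentSpace (𝓡 4) p), IsKilling g ξ → IsKilling g η →
      VectorField.mlieBracket (𝓡 4) ξ η = 0 → IsOrthogonallyTransitive g ξ η →
      ∀ (φ : SmoothChart M), ∀ x ∈ φ.1.target, SpanNonNullPlaneAt g ξ η (φ.1.symm x) →
        (belCurrentAt g ξ ξ ξ φ x ∈
          Submodule.span ℝ {ξ (φ.1.symm x), η (φ.1.symm x)} ∧
          divBelCurrentAt g ξ ξ ξ φ x = 0) ∧
        (belCurrentAt g η η η φ x ∈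
          Submodule.span ℝ {ξ (φ.1.symm x), η (φ.1.symm x)} ∧
          divBelCurrentAt g η η η φ x = 0) ∧
        (belCurrentAt g ξ η η φ x ∈
          Submodule.span ℝ {ξ (φ.1.symm x), η (φ.1.symm x)} ∧
          divBelCurrentAt g ξ η η φ x = 0) ∧
        (belCurrentAt g η ξ ξ φ x ∈
          Submodule.span ℝ {ξ (φ.1.symm x), η (φ.1.symm x)} ∧
          divBelCurrentAt g η ξ ξ φ x = 0)) := by
  refine ⟨fun ξ hξ hW φ x hx => belCurrentAt_of_hypersurfaceOrthogonal hξ hW φ hx,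
    fun ξ η hξ hη hC hW φ x hx hΔ => ?_⟩
  have h1 := fun {ξ₁ ξ₂ ξ₃ : Π p : M, TangentSpace (𝓡 4) p} =>
    belCurrentAt_of_orthogonallyTransitive hξ hη hC hW φ hx hΔ (ξ₁ := ξ₁) (ξ₂ := ξ₂) (ξ₃ := ξ₃)
  exact ⟨h1 (.inl rfl) (.inl rfl) (.inl rfl), h1 (.inr rfl) (.inr rfl) (.inr rfl),
    h1 (.inl rfl) (.inr rfl) (.inr rfl), h1 (.inr rfl) (.inl rfl) (.inl rfl)⟩
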